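/- Theorem 2. Let $m\ge 0$ be an integer. Let $S^m(\mathbb{CP}^\infty)=\bigcup_{N\ge 0} S^m(\mathbb{CP}^N)$ be the set of unordered $m$-tuples of points of $\mathbb{CP}^\infty=\varinjlim\mathbb{CP}^N$, filtered by the varieties $S^m(\mathbb{CP}^N)=(\mathbb{CP}^N)^m/S_m$, and let $\mathbf{Gr}(m,\infty)=\bigcup_{N\ge 0}\mathbf{Gr}(m,N)$ be the set of $m$-dimensional linear subspaces of $\mathbb{C}^\infty=\varinjlim\mathbb{C}^N$, filtered by the Grassmannians $\mathbf{Gr}(m,N)$ of $m$-dimensional subspaces of $\mathbb{C}^N$ (empty for $N<m$). For a union $X=\bigcup_i X_i$ of an increasing sequence of complex quasi-projective varieties, a partition of $X$ compatible with the filtration $\{X_i\}$ is a representation of $X$ as a disjoint union $\coprod_j Z_j$ of at most countably many nonempty quasi-projective varieties $Z_j$ such that each $X_i$ is the union of some of the $Z_j$, each $Z_j$ is contained in some $X_i$, and $Z_j$ is Zariski locally closed in every $X_i$ that contains it. Then $S^m(\mathbb{CP}^\infty)$ and $\mathbf{Gr}(m,\infty)$ are piecewise isomorphic in the following sense: there exist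 partitions $S^m(\mathbb{CP}^\infty)=\coprod_{j\in J}U_j$ and $\mathbf{Gr}(m,\infty)=\coprod_{j\in J}V_j$, with the same index set $J$, compatible with the filtrations $\{S^m(\mathbb{CP}^N)\}_N$ and $\{\mathbf{Gr}(m,N)\}_N$ respectively, such that for every $j\in J$ the quasi-projective varieties $U_j$ and $V_j$ are isomorphic. -/

import Mathlib

namespace PiecewiseVar

open scoped Topology

/-- A space with functions over `ℂ` (the classical language of complex varieties): a topological
space (the Zariski topology) together with a sheaf of `ℂ`-algebras of `ℂ`-valued functions, the
regular functions, such that the nonvanishing locus of a regular function is open and its inverse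
is regular there. A function on the open set `U` is represented by a function `X → ℂ`, of which
only the restriction to `U` matters (`regular_congr`). -/
structure SpaceWithFunctions (X : Type) where
  top : TopologicalSpace X
  /-- `Regular U f`: the restriction of `f` to the open set `U` is a regular function on `U`. -/
  Regular : Set X → (X → ℂ) → Prop
  regular_congr : ∀ {U : Set X} {f g : X → ℂ}, IsOpen[top] U → Set.EqOn f g U →
    Regular U f → Regular U g
  regular_mono : ∀ {U V : Set X} {f : X → ℂ}, IsOpen[top] U → IsOpen[top] V → V ⊆ U →
    Regular U f → Regular V f
  regular_glue : ∀ {U : Set X} {f : X → ℂ}, IsOpen[top] U →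
    (∀ x ∈ U, ∃ V, IsOpen[top] V ∧ x ∈ V ∧ V ⊆ U ∧ Regular V f) → Regular U f
  regular_const : ∀ {U : Set X} (c : ℂ), IsOpen[top] U → Regular U (fun _ => c)
  regular_add : ∀ {U : Set X} {f g : X → ℂ}, IsOpen[top] U → Regular U f → Regular U g →
    Regular U (fun x => f x + g x)
  regular_mul : ∀ {U : Set X} {f g : X → ℂ}, IsOpen[top] U → Regular U f → Regular U g →
    Regular U (fun x => f x * g x)
  isOpen_ne_zero : ∀ {U : Set X} {f : X → ℂ}, IsOpen[top] U → Regular U f →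
    IsOpen[top] {x | x ∈ U ∧ f x ≠ 0}
  regular_inv : ∀ {U : Set X} {f : X → ℂ}, IsOpen[top] U → Regular U f →
    Regular {x | x ∈ U ∧ f x ≠ 0} (fun x => (f x)⁻¹)

/-- Morphisms: continuous maps that pull regular functions back to regular functions. -/
def IsMorphism {X Y : Type} (s : SpaceWithFunctions X) (t : SpaceWithFunctions Y)
    (φ : X → Y) : Prop :=
  ∀ U : Set Y, IsOpen[t.top] U →
    IsOpen[s.top] (φ ⁻¹' U) ∧ ∀ f : Y → ℂ, t.Regular U f → s.Regular (φ ⁻¹' U) (f ∘ φ)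

/-- Isomorphism of spaces with functions. -/
def Isomorphic {X Y : Type} (s : SpaceWithFunctions X) (t : SpaceWithFunctions Y) : Prop :=
  ∃ e : X ≃ Y, IsMorphism s t e ∧ IsMorphism t s e.symm

/-- The Zariski topology on the affine space `ℂ^ι`: the sets `{q ≠ 0}`, `q` a polynomial, form
a basis of the open sets. -/
abbrev zariskiTopology (ι : Type) : TopologicalSpace (ι → ℂ) where
  IsOpen U := ∀ x ∈ U, ∃ q : MvPolynomial ι ℂ,
    MvPolynomial.eval x q ≠ 0 ∧ ∀ y, MvPolynomial.eval y q ≠ 0 → y ∈ U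
  isOpen_univ := fun x _ => ⟨1, by simp, fun _ _ => trivial⟩
  isOpen_inter := by
    rintro U V hU hV x ⟨hxU, hxV⟩
    obtain ⟨p, hp, hpU⟩ := hU x hxU
    obtain ⟨q, hq, hqV⟩ := hV x hxV
    refine ⟨p * q, by simp [hp, hq], fun y hy => ?_⟩
    rw [map_mul] at hy
    exact ⟨hpU y (left_ne_zero_of_mul hy), hqV y (right_ne_zero_of_mul hy)⟩
  isOpen_sUnion := by
    rintro S hS x ⟨U, hU, hxU⟩
    obtain ⟨p, hp, hpU⟩ := hS U hU x hxU
    exact ⟨p, hp, fun y hy => ⟨U, hU, hpU y hy⟩⟩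

/-- The affine space `ℂ^ι`: the regular functions are those that are locally quotients of
polynomials. -/
def affineSpace (ι : Type) : SpaceWithFunctions (ι → ℂ) where
  top := zariskiTopology ι
  Regular U f := ∀ x ∈ U, ∃ p q : MvPolynomial ι ℂ, MvPolynomial.eval x q ≠ 0 ∧
    ∀ y ∈ U, MvPolynomial.eval y q ≠ 0 → f y = MvPolynomial.eval y p / MvPolynomial.eval y q
  regular_congr := by
    intro U f g _ hfg hf x hx
    obtain ⟨p, q, hq, h⟩ := hf x hx
    exact ⟨p, q, hq, fun y hy hqy => by rw [← hfg hy, h y hy hqy]⟩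
  regular_mono := by
    intro U V f _ _ hVU hf x hx
    obtain ⟨p, q, hq, h⟩ := hf x (hVU hx)
    exact ⟨p, q, hq, fun y hy => h y (hVU hy)⟩
  regular_glue := by
    intro U f _ h x hx
    obtain ⟨V, hV, hxV, _, hf⟩ := h x hx
    obtain ⟨p, q, hq, hpq⟩ := hf x hxV
    obtain ⟨r, hr, hrV⟩ := hV x hxV
    refine ⟨p * r, q * r, by simp [hq, hr], fun y _ hy => ?_⟩
    rw [map_mul] at hy
    have h1 := left_ne_zero_of_mul hy
    have h2 := right_ne_zero_of_mul hy
    rw [hpq y (hrV y h2) h1, map_mul, map_mul, mul_div_mul_right _ _ h2]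
  regular_const := fun c _ x _ => ⟨MvPolynomial.C c, 1, by simp, by simp⟩
  regular_add := by
    intro U f g _ hf hg x hx
    obtain ⟨p, q, hq, h⟩ := hf x hx
    obtain ⟨p', q', hq', h'⟩ := hg x hx
    refine ⟨p * q' + q * p', q * q', by simp [hq, hq'], fun y hy hyq => ?_⟩
    rw [map_mul] at hyq
    have h1 := left_ne_zero_of_mul hyq
    have h2 := right_ne_zero_of_mul hyq
    beta_reduce
    rw [h y hy h1, h' y hy h2, div_add_div _ _ h1 h2]
    simp
  regular_mul := by
    intro U f g _ hf hg x hx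
    obtain ⟨p, q, hq, h⟩ := hf x hx
    obtain ⟨p', q', hq', h'⟩ := hg x hx
    refine ⟨p * p', q * q', by simp [hq, hq'], fun y hy hyq => ?_⟩
    rw [map_mul] at hyq
    have h1 := left_ne_zero_of_mul hyq
    have h2 := right_ne_zero_of_mul hyq
    beta_reduce
    rw [h y hy h1, h' y hy h2, div_mul_div_comm]
    simp
  isOpen_ne_zero := by
    rintro U f hU hf x ⟨hx, hfx⟩
    obtain ⟨p, q, hq, h⟩ := hf x hx
    obtain ⟨r, hr, hrU⟩ := hU x hx
    have hp : MvPolynomial.eval x p ≠ 0 := by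
      intro h0
      exact hfx (by rw [h x hx hq, h0, zero_div])
    refine ⟨p * q * r, by simp [hp, hq, hr], fun y hy => ?_⟩
    rw [map_mul, map_mul] at hy
    have h1 := left_ne_zero_of_mul hy
    have hyU := hrU y (right_ne_zero_of_mul hy)
    refine ⟨hyU, ?_⟩
    rw [h y hyU (right_ne_zero_of_mul h1)]
    exact div_ne_zero (left_ne_zero_of_mul h1) (right_ne_zero_of_mul h1)
  regular_inv := by
    rintro U f _ hf x ⟨hx, hfx⟩
    obtain ⟨p, q, hq, h⟩ := hf x hx
    have hp : MvPolynomial.eval x p ≠ 0 := by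
      intro h0
      exact hfx (by rw [h x hx hq, h0, zero_div])
    refine ⟨q * q, p * q, by simp [hp, hq], ?_⟩
    rintro y ⟨hyU, _⟩ hy
    rw [map_mul] at hy
    have h2 := right_ne_zero_of_mul hy
    beta_reduce
    rw [h y hyU h2, map_mul, map_mul, mul_div_mul_right _ _ h2, inv_div]

/-- The structure induced along a map `i : Z → X` (used for injective `i`): the induced topology,
and as regular functions those that are locally pulled back from regular functions on open sets
of `X`. -/
def SpaceWithFunctions.induced {Z X : Type} (s : SpaceWithFunctions X) (i : Z → X) :
    SpaceWithFunctions Z where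
  top := s.top.induced i
  Regular U f := ∀ x ∈ U, ∃ W : Set X, IsOpen[s.top] W ∧ i x ∈ W ∧
    ∃ g : X → ℂ, s.Regular W g ∧ ∀ y ∈ U, i y ∈ W → f y = g (i y)
  regular_congr := by
    intro U f g _ hfg hf x hx
    obtain ⟨W, hW, hxW, k, hk, h⟩ := hf x hx
    exact ⟨W, hW, hxW, k, hk, fun y hy hyW => by rw [← hfg hy, h y hy hyW]⟩
  regular_mono := by
    intro U V f _ _ hVU hf x hx
    obtain ⟨W, hW, hxW, k, hk, h⟩ := hf x (hVU hx)
    exact ⟨W, hW, hxW, k, hk, fun y hy => h y (hVU hy)⟩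
  regular_glue := by
    intro U f _ h x hx
    obtain ⟨V, ⟨V', hV', rfl⟩, hxV, _, hf⟩ := h x hx
    obtain ⟨W, hW, hxW, k, hk, hfk⟩ := hf x hxV
    have hWV : IsOpen[s.top] (W ∩ V') := s.top.isOpen_inter _ _ hW hV'
    exact ⟨W ∩ V', hWV, ⟨hxW, hxV⟩, k, s.regular_mono hW hWV Set.inter_subset_left hk,
      fun y _ hyW => hfk y hyW.2 hyW.1⟩
  regular_const := fun c _ x _ => ⟨Set.univ, s.top.isOpen_univ, trivial, fun _ => c,
    s.regular_const c s.top.isOpen_univ, fun _ _ _ => rfl⟩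
  regular_add := by
    intro U f g _ hf hg x hx
    obtain ⟨W, hW, hxW, k, hk, h⟩ := hf x hx
    obtain ⟨W', hW', hxW', k', hk', h'⟩ := hg x hx
    have hWW : IsOpen[s.top] (W ∩ W') := s.top.isOpen_inter _ _ hW hW'
    refine ⟨W ∩ W', hWW, ⟨hxW, hxW'⟩, fun z => k z + k' z,
      s.regular_add hWW (s.regular_mono hW hWW Set.inter_subset_left hk)
        (s.regular_mono hW' hWW Set.inter_subset_right hk'), fun y hy hyW => ?_⟩
    beta_reduce
    rw [h y hy hyW.1, h' y hy hyW.2]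
  regular_mul := by
    intro U f g _ hf hg x hx
    obtain ⟨W, hW, hxW, k, hk, h⟩ := hf x hx
    obtain ⟨W', hW', hxW', k', hk', h'⟩ := hg x hx
    have hWW : IsOpen[s.top] (W ∩ W') := s.top.isOpen_inter _ _ hW hW'
    refine ⟨W ∩ W', hWW, ⟨hxW, hxW'⟩, fun z => k z * k' z,
      s.regular_mul hWW (s.regular_mono hW hWW Set.inter_subset_left hk)
        (s.regular_mono hW' hWW Set.inter_subset_right hk'), fun y hy hyW => ?_⟩
    beta_reduce
    rw [h y hy hyW.1, h' y hy hyW.2]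
  isOpen_ne_zero := by
    rintro U f ⟨U', hU', rfl⟩ hf
    let _ := s.top
    let _ : TopologicalSpace Z := s.top.induced i
    refine isOpen_iff_forall_mem_open.2 ?_
    rintro x ⟨hx, hfx⟩
    obtain ⟨W, hW, hxW, k, hk, h⟩ := hf x hx
    refine ⟨i ⁻¹' ({z | z ∈ W ∧ k z ≠ 0} ∩ U'), ?_,
      ⟨_, (s.isOpen_ne_zero hW hk).inter hU', rfl⟩, ⟨hxW, by rwa [← h x hx hxW]⟩, hx⟩
    rintro y ⟨⟨hyW, hky⟩, hyU⟩
    exact ⟨hyU, by rwa [h y hyU hyW]⟩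
  regular_inv := by
    rintro U f _ hf x ⟨hx, hfx⟩
    obtain ⟨W, hW, hxW, k, hk, h⟩ := hf x hx
    refine ⟨{z | z ∈ W ∧ k z ≠ 0}, s.isOpen_ne_zero hW hk, ⟨hxW, by rwa [← h x hx hxW]⟩,
      fun z => (k z)⁻¹, s.regular_inv hW hk, ?_⟩
    rintro y ⟨hyU, _⟩ ⟨hyW, _⟩
    beta_reduce
    rw [h y hyU hyW]

/-- A subset `Z` of `X` with its induced (reduced) structure. -/
def SpaceWithFunctions.restrict {X : Type} (s : SpaceWithFunctions X) (Z : Set X) :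
    SpaceWithFunctions Z :=
  s.induced Subtype.val

/-- The quotient structure along a map `π : Y → X` (used for surjective `π`): a set is open if
its preimage is open, a function is regular if its pullback is regular. -/
def SpaceWithFunctions.quotient {Y X : Type} (s : SpaceWithFunctions Y) (π : Y → X) :
    SpaceWithFunctions X where
  top := s.top.coinduced π
  Regular U f := s.Regular (π ⁻¹' U) (f ∘ π)
  regular_congr := fun hU hfg hf => s.regular_congr hU (fun _ hy => hfg hy) hf
  regular_mono := fun hU hV hVU hf => s.regular_mono hU hV (Set.preimage_mono hVU) hf
  regular_glue := by
    intro U f hU h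
    refine s.regular_glue hU fun y hy => ?_
    obtain ⟨V, hV, hyV, hVU, hf⟩ := h (π y) hy
    exact ⟨π ⁻¹' V, hV, hyV, Set.preimage_mono hVU, hf⟩
  regular_const := fun c hU => s.regular_const c hU
  regular_add := fun hU hf hg => s.regular_add hU hf hg
  regular_mul := fun hU hf hg => s.regular_mul hU hf hg
  isOpen_ne_zero := fun hU hf => s.isOpen_ne_zero hU hf
  regular_inv := fun hU hf => s.regular_inv hU hf

/-- The projective space `ℙ(V)` of lines in `V`. -/
abbrev Proj (V : Type) [AddCommGroup V] [Module ℂ V] : Type := Projectivization ℂ V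

/-- `ℂP^n` as a variety: the quotient of `ℂ^{n+1} ∖ {0}` by `ℂ^*`. -/
noncomputable def projectiveSpace (n : ℕ) : SpaceWithFunctions (Proj (Fin (n + 1) → ℂ)) :=
  ((affineSpace (Fin (n + 1))).restrict {v | v ≠ 0}).quotient
    (fun v => Projectivization.mk ℂ v.1 v.2)

/-- A space with functions is a quasi-projective variety if it is isomorphic to a Zariski locally
closed subset of some `ℂP^n`. -/
def IsQuasiProjective {X : Type} (s : SpaceWithFunctions X) : Prop :=
  ∃ (n : ℕ) (Z : Set (Proj (Fin (n + 1) → ℂ))),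
    @IsLocallyClosed _ (projectiveSpace n).top Z ∧ Isomorphic s ((projectiveSpace n).restrict Z)

/-- The variety `(ℂP^n)^m`: the quotient of `(ℂ^{n+1} ∖ {0})^m`, an open subset of `ℂ^{m(n+1)}`,
by `(ℂ^*)^m`. Its closed sets are the zero loci of multihomogeneous polynomials. -/
noncomputable def projectiveSpacePow (m n : ℕ) : SpaceWithFunctions (Fin m → Proj (Fin (n + 1) → ℂ)) :=
  ((affineSpace (Fin m × Fin (n + 1))).induced
    (fun (v : {v : Fin m → Fin (n + 1) → ℂ // ∀ k, v k ≠ 0}) (p : Fin m × Fin (n + 1)) =>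
      v.1 p.1 p.2)).quotient
    (fun v k => Projectivization.mk ℂ (v.1 k) (v.2 k))

/-- The unordered `m`-tuple underlying an ordered `m`-tuple. -/
def toSym {α : Type} {m : ℕ} (x : Fin m → α) : Sym α m :=
  ⟨Finset.univ.val.map x, by simp⟩

/-- The symmetric power `S^m(ℂP^n) = (ℂP^n)^m / S_m` as a variety. -/
noncomputable def symPowProj (m n : ℕ) : SpaceWithFunctions (Sym (Proj (Fin (n + 1) → ℂ)) m) :=
  (projectiveSpacePow m n).quotient toSym

/-- The set of `m`-dimensional linear subspaces of `V`. -/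
abbrev Gr (m : ℕ) (V : Type) [AddCommGroup V] [Module ℂ V] : Type :=
  {W : Submodule ℂ V // Module.rank ℂ W = m}

/-- The subspace spanned by a linearly independent `m`-tuple. -/
def spanGr {m n : ℕ} (v : {v : Fin m → Fin n → ℂ // LinearIndependent ℂ v}) :
    Gr m (Fin n → ℂ) :=
  ⟨Submodule.span ℂ (Set.range v.1), by
    rw [rank_span v.2, Cardinal.mk_range_eq _ v.2.injective]; simp⟩

/-- The Grassmannian `Gr(m,n)` of `m`-dimensional subspaces of `ℂ^n` as a variety: the quotient
of the variety of linearly independent `m`-tuples in `ℂ^n`, an open subset of `ℂ^{mn}`, by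
`GL(m)`. -/
def grassmannian (m n : ℕ) : SpaceWithFunctions (Gr m (Fin n → ℂ)) :=
  ((affineSpace (Fin m × Fin n)).induced
    (fun (v : {v : Fin m → Fin n → ℂ // LinearIndependent ℂ v}) (p : Fin m × Fin n) =>
      v.1 p.1 p.2)).quotient spanGr

/-- A set `X` written as the increasing union of a sequence of spaces with functions. -/
structure FilteredSpace (X : Type) where
  level : ℕ → Type
  str : ∀ N, SpaceWithFunctions (level N)
  incl : ∀ N, level N → X
  incl_injective : ∀ N, Function.Injective (incl N)
  range_subset : ∀ N, Set.range (incl N) ⊆ Set.range (incl (N + 1))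
  iUnion_range : ⋃ N, Set.range (incl N) = Set.univ

/-- The part of `Z ⊆ X` lying in the `N`-th level, as a space with functions. For
`Z ⊆ Set.range (F.incl N)` this is `Z` itself as a subset of the `N`-th level. -/
def FilteredSpace.stratum {X : Type} (F : FilteredSpace X) (N : ℕ) (Z : Set X) :
    SpaceWithFunctions (F.incl N ⁻¹' Z : Set (F.level N)) :=
  (F.str N).restrict (F.incl N ⁻¹' Z)

/-- A partition of `X` compatible with its filtration: `X` is the disjoint union of at most
countably many (nonempty) strata `Z j`, each level is a union of strata, each stratum lies in some
level, and in every level containing it, it is Zariski locally closed and a quasi-projective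
variety. -/
structure IsCompatiblePartition {X J : Type} (F : FilteredSpace X) (Z : J → Set X) : Prop where
  countable : Countable J
  nonempty : ∀ j, (Z j).Nonempty
  disjoint : ∀ j k, j ≠ k → Disjoint (Z j) (Z k)
  iUnion_eq : ⋃ j, Z j = Set.univ
  level_eq : ∀ N, ∃ S : Set J, Set.range (F.incl N) = ⋃ j ∈ S, Z j
  exists_level : ∀ j, ∃ N, Z j ⊆ Set.range (F.incl N)
  isLocallyClosed : ∀ j N, Z j ⊆ Set.range (F.incl N) →
    @IsLocallyClosed _ (F.str N).top (F.incl N ⁻¹' Z j)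
  isQuasiProjective : ∀ j N, Z j ⊆ Set.range (F.incl N) → IsQuasiProjective (F.stratum N (Z j))

/-- `ℂ^∞ = ⋃ ℂ^n`, the finitely supported sequences. -/
abbrev CInf : Type := ℕ →₀ ℂ

/-- The inclusion `ℂ^n → ℂ^∞`, extension by zero. -/
noncomputable def extendZero (n : ℕ) : (Fin n → ℂ) →ₗ[ℂ] CInf :=
  Finsupp.lmapDomain ℂ ℂ (Fin.val : Fin n → ℕ) ∘ₗ
    (Finsupp.linearEquivFunOnFinite ℂ ℂ (Fin n)).symm.toLinearMap

theorem extendZero_injective (n : ℕ) : Function.Injective (extendZero n) :=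
  (Finsupp.mapDomain_injective Fin.val_injective).comp (LinearEquiv.injective _)

theorem mem_range_extendZero (n : ℕ) (x : CInf) :
    x ∈ LinearMap.range (extendZero n) ↔ ∀ k, n ≤ k → x k = 0 := by
  rw [extendZero, LinearMap.range_comp_of_range_eq_top _ (LinearEquiv.range _), LinearMap.mem_range]
  constructor
  · rintro ⟨y, rfl⟩ k hk
    refine Finsupp.mapDomain_of_notMem_range y k ?_
    rintro ⟨i, rfl⟩
    exact absurd i.2 (not_lt.2 hk)
  · intro h
    have := (Finsupp.mem_range_mapDomain_iff _ (Fin.val_injective (n := n)) x).2 (fun k hk =>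
      h k (not_lt.1 fun hkn => hk ⟨⟨k, hkn⟩, rfl⟩))
    exact this

theorem range_extendZero_mono {n n' : ℕ} (h : n ≤ n') :
    LinearMap.range (extendZero n) ≤ LinearMap.range (extendZero n') := by
  intro x hx
  rw [mem_range_extendZero] at hx ⊢
  exact fun k hk => hx k (h.trans hk)

theorem exists_mem_range_extendZero (s : Finset CInf) :
    ∃ n, ∀ x ∈ s, x ∈ LinearMap.range (extendZero n) := by
  classical
  refine ⟨(s.sup fun x => x.support.sup id) + 1, fun x hx => ?_⟩
  rw [mem_range_extendZero]
  intro k hk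
  by_contra hne
  have h1 : k ≤ x.support.sup id :=
    Finset.le_sup (f := id) (Finsupp.mem_support_iff.2 hne)
  have h2 := Finset.le_sup (f := fun x : CInf => x.support.sup id) hx
  have h3 := h1.trans h2
  omega

/-- The inclusion `S^m(ℂP^N) → S^m(ℂP^∞)`. -/
noncomputable def symPowIncl (m N : ℕ) (x : Sym (Proj (Fin (N + 1) → ℂ)) m) :
    Sym (Proj CInf) m :=
  x.map (Projectivization.map (extendZero (N + 1)) (extendZero_injective (N + 1)))

/-- The inclusion `Gr(m,N) → Gr(m,∞)`. -/
noncomputable def grIncl (m N : ℕ) (W : Gr m (Fin N → ℂ)) : Gr m CInf :=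
  ⟨W.1.map (extendZero N), by
    exact (Submodule.equivMapOfInjective _ (extendZero_injective N) W.1).rank_eq.symm.trans W.2⟩

theorem mem_range_symPowIncl (m N : ℕ) (x : Sym (Proj CInf) m) :
    x ∈ Set.range (symPowIncl m N) ↔
      ∀ l ∈ x, l.rep ∈ LinearMap.range (extendZero (N + 1)) := by
  constructor
  · rintro ⟨y, rfl⟩ l hl
    obtain ⟨l', -, rfl⟩ := Sym.mem_map.1 hl
    induction l' using Projectivization.ind with
    | h v hv =>
      rw [Projectivization.map_mk]
      obtain ⟨a, ha⟩ := Projectivization.exists_smul_eq_mk_rep ℂ (extendZero (N + 1) v)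
        (by rwa [Ne, LinearMap.map_eq_zero_iff _ (extendZero_injective _)])
      rw [← ha]
      exact Submodule.smul_mem _ (a : ℂ) ⟨v, rfl⟩
  · intro h
    have hl : ∀ l : {l // l ∈ x}, ∃ l' : Proj (Fin (N + 1) → ℂ),
        Projectivization.map (extendZero (N + 1)) (extendZero_injective (N + 1)) l' = l := by
      rintro ⟨l, hl⟩
      obtain ⟨v, hv⟩ := h l hl
      have hv0 : v ≠ 0 := by
        rintro rfl
        exact l.rep_nonzero (by rw [← hv, map_zero])
      refine ⟨Projectivization.mk ℂ v hv0, ?_⟩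
      rw [Projectivization.map_mk]
      refine Eq.trans ?_ l.mk_rep
      congr 1
    choose f hf using hl
    refine ⟨x.attach.map f, ?_⟩
    rw [symPowIncl, Sym.map_map]
    conv_rhs => rw [← Sym.attach_map_coe x]
    exact Sym.map_congr fun l _ => hf l

theorem mem_range_grIncl (m N : ℕ) (W : Gr m CInf) :
    W ∈ Set.range (grIncl m N) ↔ W.1 ≤ LinearMap.range (extendZero N) := by
  constructor
  · rintro ⟨W', rfl⟩
    exact LinearMap.map_le_range
  · intro h
    have hW : (W.1.comap (extendZero N)).map (extendZero N) = W.1 :=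
      Submodule.map_comap_eq_of_le h
    refine ⟨⟨W.1.comap (extendZero N), ?_⟩, Subtype.ext hW⟩
    rw [(Submodule.equivMapOfInjective _ (extendZero_injective N) _).rank_eq, hW]
    exact W.2

/-- `S^m(ℂP^∞)` with its filtration by the varieties `S^m(ℂP^N)`. -/
noncomputable def symPowProjInf (m : ℕ) : FilteredSpace (Sym (Proj CInf) m) where
  level N := Sym (Proj (Fin (N + 1) → ℂ)) m
  str N := symPowProj m N
  incl N := symPowIncl m N
  incl_injective N := Sym.map_injective (Projectivization.map_injective _ _) m
  range_subset N := by
    intro x hx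
    rw [mem_range_symPowIncl] at hx ⊢
    exact fun l hl => range_extendZero_mono (Nat.le_succ _) (hx l hl)
  iUnion_range := by
    classical
    refine Set.eq_univ_of_forall fun x => ?_
    obtain ⟨n, hn⟩ := exists_mem_range_extendZero
      ((x : Multiset (Proj CInf)).toFinset.image Projectivization.rep)
    refine Set.mem_iUnion.2 ⟨n, (mem_range_symPowIncl m n x).2 fun l hl => ?_⟩
    exact range_extendZero_mono (Nat.le_succ _)
      (hn _ (Finset.mem_image_of_mem _ (Multiset.mem_toFinset.2 hl)))

/-- `Gr(m,∞)` with its filtration by the varieties `Gr(m,N)`. -/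
noncomputable def grassmannianInf (m : ℕ) : FilteredSpace (Gr m CInf) where
  level N := Gr m (Fin N → ℂ)
  str N := grassmannian m N
  incl N := grIncl m N
  incl_injective N := by
    intro W W' h
    exact Subtype.ext (Submodule.map_injective_of_injective (extendZero_injective N)
      (congrArg Subtype.val h))
  range_subset N := by
    intro W hW
    rw [mem_range_grIncl] at hW ⊢
    exact hW.trans (range_extendZero_mono (Nat.le_succ _))
  iUnion_range := by
    refine Set.eq_univ_of_forall fun W => ?_
    have hfin : Module.Finite ℂ W.1 := by
      have : Module.Free ℂ W.1 := Module.Free.of_divisionRing ℂ W.1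
      rw [← Module.rank_lt_aleph0_iff, W.2]
      exact Cardinal.natCast_lt_aleph0
    obtain ⟨s, hs⟩ := Module.Finite.iff_fg.1 hfin
    obtain ⟨n, hn⟩ := exists_mem_range_extendZero s
    refine Set.mem_iUnion.2 ⟨n, (mem_range_grIncl m n W).2 ?_⟩
    rw [← hs, Submodule.span_le]
    exact fun x hx => hn x hx

end PiecewiseVar

open PiecewiseVar

/-! Both spaces split into pieces indexed by the weakly decreasing `κ : Fin m → ℕ`. In the
Grassmannian the piece is a Schubert cell: its subspaces have a unique reduced echelon basis, whose
free entries form the affine space `Filling κ` of arrays with `κ i` entries in row `i`. In the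
symmetric power the piece consists of the tuples of points whose last nonzero coordinates stand at
the positions `κ i`. Normalizing these coordinates to 1 leaves an array in `Filling κ`, determined
up to permuting rows of equal length. So the affine space `Filling κ` has to be compared with its
own quotient by `rowStab κ`, a product of symmetric powers of affine spaces.

The bridge is an explicit map `encode`, built column by column. Given the first `t` columns, the
rows fall into classes (equal length, equal first `t` entries). Up to the remaining symmetry, column
`t` is one multiset for each class, recorded by its elementary symmetric functions: altogether as
many numbers as there are rows reaching column `t`. Hermite interpolation packs them, as Taylor
coefficients at distinct points attached to the classes, into one polynomial with that many
coefficients. By `encode_surjective` and `encode_eq_iff`, `encode` induces a bijection from the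
quotient onto `Filling κ`.

This bijection is not a morphism, but it is constructible in both directions. Constructibility is
expressed through algebras of functions closed under pointwise inversion with `0⁻¹ = 0`. The
coordinate algebra of the quotient, carried over by `encode`, is `encodedFun`; `encodedFun_le` and
`polyFun_le` say that it and `polyFun κ` lie in the inversion closures of each other. By
`exists_finite_partition` there is then a finite partition of `Filling κ` on whose members the
functions of each algebra are quotients of functions of the other, and `IsEmb.isomorphic` turns
these members into isomorphic strata.

The algebraic core is the compatibility of inversion with symmetry. An integral extension of an
inversion-closed algebra is again inversion-closed (`invClosed_of_invariants_le`). Hence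
non-symmetric coordinates may be adjoined, used freely in definitions and inversions, and removed by
averaging over the group. This is used in `mem_invClosure_invPolyFun` and in `sum_rowMonomials_mem`,
which recovers the invariant polynomials from the encoding. -/

namespace PiecewiseVar

open scoped Topology

/-! ### Inversion-closed algebras and piecewise quotients -/

/-- A subalgebra of functions closed under pointwise inversion (with `0⁻¹ = 0`). -/
def InvClosed {D : Type} (A : Subalgebra ℂ (D → ℂ)) : Prop :=
  ∀ f ∈ A, f⁻¹ ∈ A

/-- The smallest algebra of functions containing `R` and closed under pointwise inversion. -/
def invClosure {D : Type} (R : Set (D → ℂ)) : Subalgebra ℂ (D → ℂ) :=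
  sInf {B | R ⊆ B ∧ InvClosed B}

theorem subset_invClosure {D : Type} (R : Set (D → ℂ)) : R ⊆ invClosure R := by
  intro f hf
  rw [invClosure, SetLike.mem_coe, Algebra.mem_sInf]
  exact fun B hB => hB.1 hf

theorem invClosed_invClosure {D : Type} (R : Set (D → ℂ)) : InvClosed (invClosure R) := by
  intro f hf
  rw [invClosure, Algebra.mem_sInf] at hf ⊢
  exact fun B hB => hB.2 f (hf B hB)

theorem invClosure_le {D : Type} {R : Set (D → ℂ)} {B : Subalgebra ℂ (D → ℂ)} (h : R ⊆ B)
    (hB : InvClosed B) : invClosure R ≤ B := by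
  intro f hf
  rw [invClosure, Algebra.mem_sInf] at hf
  exact hf B ⟨h, hB⟩

/-- The points at which the functions in `S` that vanish are exactly those in `T`. -/
def signCell {D : Type} (S : Finset (D → ℂ)) (T : Set (D → ℂ)) : Set D :=
  {x | ∀ s ∈ S, s x = 0 ↔ s ∈ T}

theorem signCell_anti {D : Type} {S S' : Finset (D → ℂ)} (h : S ⊆ S') (T : Set (D → ℂ)) :
    signCell S' T ⊆ signCell S T :=
  fun _ hx s hs => hx s (h hs)

/-- On `P`, the function `f` is a quotient of functions in `A`. -/
def QuotOn {D : Type} (A : Subalgebra ℂ (D → ℂ)) (P : Set D) (f : D → ℂ) : Prop :=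
  ∃ p ∈ A, ∃ q ∈ A, ∀ x ∈ P, q x ≠ 0 ∧ f x = p x / q x

section QuotOn
variable {D : Type} {A : Subalgebra ℂ (D → ℂ)} {P : Set D} {f g : D → ℂ}

theorem QuotOn.mono {P' : Set D} (h : QuotOn A P f) (hP : P' ⊆ P) : QuotOn A P' f := by
  obtain ⟨p, hp, q, hq, h⟩ := h
  exact ⟨p, hp, q, hq, fun x hx => h x (hP hx)⟩

theorem QuotOn.of_mem (h : f ∈ A) : QuotOn A P f :=
  ⟨f, h, 1, A.one_mem, fun x _ => by simp⟩

theorem QuotOn.add (hf : QuotOn A P f) (hg : QuotOn A P g) : QuotOn A P (f + g) := by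
  obtain ⟨p, hp, q, hq, h⟩ := hf
  obtain ⟨p', hp', q', hq', h'⟩ := hg
  refine ⟨p * q' + q * p', A.add_mem (A.mul_mem hp hq') (A.mul_mem hq hp'), q * q',
    A.mul_mem hq hq', fun x hx => ⟨mul_ne_zero (h x hx).1 (h' x hx).1, ?_⟩⟩
  simp only [Pi.add_apply, Pi.mul_apply]
  rw [(h x hx).2, (h' x hx).2, div_add_div _ _ (h x hx).1 (h' x hx).1]

theorem QuotOn.mul (hf : QuotOn A P f) (hg : QuotOn A P g) : QuotOn A P (f * g) := by
  obtain ⟨p, hp, q, hq, h⟩ := hf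
  obtain ⟨p', hp', q', hq', h'⟩ := hg
  refine ⟨p * p', A.mul_mem hp hp', q * q',
    A.mul_mem hq hq', fun x hx => ⟨mul_ne_zero (h x hx).1 (h' x hx).1, ?_⟩⟩
  simp only [Pi.mul_apply]
  rw [(h x hx).2, (h' x hx).2, div_mul_div_comm]

end QuotOn

/-- `f` is piecewise a quotient of functions in `A`. -/
def PiecewiseQuot {D : Type} (A : Subalgebra ℂ (D → ℂ)) (f : D → ℂ) : Prop :=
  ∃ S : Finset (D → ℂ), (∀ s ∈ S, s ∈ A) ∧ ∀ T, QuotOn A (signCell S T) f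

/-- The algebra of functions that are piecewise quotients. -/
def piecewiseQuotAlgebra {D : Type} (A : Subalgebra ℂ (D → ℂ)) : Subalgebra ℂ (D → ℂ) where
  carrier := {f | PiecewiseQuot A f}
  algebraMap_mem' c := ⟨∅, by simp, fun _ => QuotOn.of_mem (A.algebraMap_mem c)⟩
  add_mem' := by
    classical
    rintro f g ⟨S, hS, h⟩ ⟨S', hS', h'⟩
    refine ⟨S ∪ S', ?_, fun T => ?_⟩
    · intro s hs
      rcases Finset.mem_union.1 hs with hs | hs
      exacts [hS s hs, hS' s hs]
    · exact ((h T).mono (signCell_anti Finset.subset_union_left T)).add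
        ((h' T).mono (signCell_anti Finset.subset_union_right T))
  mul_mem' := by
    classical
    rintro f g ⟨S, hS, h⟩ ⟨S', hS', h'⟩
    refine ⟨S ∪ S', ?_, fun T => ?_⟩
    · intro s hs
      rcases Finset.mem_union.1 hs with hs | hs
      exacts [hS s hs, hS' s hs]
    · exact ((h T).mono (signCell_anti Finset.subset_union_left T)).mul
        ((h' T).mono (signCell_anti Finset.subset_union_right T))

/-- A quotient can be inverted as soon as the vanishing of its numerator is decided. Only finitely
many numerators occur, one for each subset of `S`, so they can be added to `S`. -/
theorem invClosed_piecewiseQuotAlgebra {D : Type} (A : Subalgebra ℂ (D → ℂ)) :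
    InvClosed (piecewiseQuotAlgebra A) := by
  classical
  rintro f ⟨S, hS, h⟩
  choose p hp q hq hpq using h
  have hsub : ∀ T, signCell S T = signCell S ((S.filter (· ∈ T) : Finset (D → ℂ)) : Set _) := by
    intro T
    ext x
    refine forall_congr' fun s => ?_
    by_cases hs : s ∈ S <;> simp [hs]
  let r : Finset (D → ℂ) → (D → ℂ) := fun T => p (T : Set (D → ℂ))
  refine ⟨S ∪ S.powerset.image r, ?_, fun T => ?_⟩
  · intro s hs
    rcases Finset.mem_union.1 hs with hs | hs
    · exact hS s hs
    · obtain ⟨T, -, rfl⟩ := Finset.mem_image.1 hs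
      exact hp _
  · set T' := S.filter (· ∈ T) with hT'
    have key : ∀ x ∈ signCell (S ∪ S.powerset.image r) T,
        q T' x ≠ 0 ∧ f x = p T' x / q T' x ∧ (p T' x = 0 ↔ p T' ∈ T) := by
      intro x hx
      have h1 := signCell_anti Finset.subset_union_left T hx
      rw [hsub] at h1
      refine ⟨(hpq _ x h1).1, (hpq _ x h1).2, hx (p T') ?_⟩
      refine Finset.mem_union_right _ (Finset.mem_image.2 ⟨T', ?_, rfl⟩)
      exact Finset.mem_powerset.2 (Finset.filter_subset _ _)
    by_cases hpT : p T' ∈ T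
    · refine ⟨0, A.zero_mem, 1, A.one_mem, fun x hx => ⟨by simp, ?_⟩⟩
      obtain ⟨_, h2, h3⟩ := key x hx
      simp [h2, h3.2 hpT]
    · refine ⟨q T', hq _, p T', hp _, fun x hx => ?_⟩
      obtain ⟨_, h2, h3⟩ := key x hx
      exact ⟨fun h0 => hpT (h3.1 h0), by rw [Pi.inv_apply, h2, inv_div]⟩

theorem piecewiseQuot_of_mem_invClosure {D : Type} {A : Subalgebra ℂ (D → ℂ)} {f : D → ℂ}
    (hf : f ∈ invClosure (A : Set (D → ℂ))) : PiecewiseQuot A f :=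
  invClosure_le (B := piecewiseQuotAlgebra A)
    (fun _ ha => ⟨∅, by simp, fun _ => QuotOn.of_mem ha⟩) (invClosed_piecewiseQuotAlgebra A) hf

/-- Cutting with the functions needed for finitely many generators suffices, because sums and
products of quotients are quotients on the same cell. -/
theorem exists_finset_quotOn {D : Type} {A A' : Subalgebra ℂ (D → ℂ)} (hfg : A.FG)
    (h : A ≤ invClosure (A' : Set (D → ℂ))) :
    ∃ S : Finset (D → ℂ), (∀ s ∈ S, s ∈ A') ∧ ∀ T, ∀ a ∈ A, QuotOn A' (signCell S T) a := by
  classical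
  obtain ⟨R, rfl⟩ := hfg
  have hR : ∀ r : R, PiecewiseQuot A' r.1 := fun r =>
    piecewiseQuot_of_mem_invClosure (h (Algebra.subset_adjoin r.2))
  choose S hS hq using hR
  refine ⟨Finset.univ.biUnion S, ?_, fun T a ha => ?_⟩
  · intro s hs
    obtain ⟨r, -, hr⟩ := Finset.mem_biUnion.1 hs
    exact hS r s hr
  · induction ha using Algebra.adjoin_induction with
    | mem r hr =>
      exact (hq ⟨r, hr⟩ T).mono (signCell_anti
        (Finset.subset_biUnion_of_mem S (Finset.mem_univ _)) T)
    | algebraMap c => exact QuotOn.of_mem (A'.algebraMap_mem c)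
    | add f g _ _ hf hg => exact hf.add hg
    | mul f g _ _ hf hg => exact hf.mul hg

/-! ### Cells and the common finite partition of two algebras -/

/-- The finite intersections of zero loci and nonvanishing loci of functions in `A`. -/
def IsCell {D : Type} (A : Subalgebra ℂ (D → ℂ)) (P : Set D) : Prop :=
  ∃ S T : Finset (D → ℂ), (∀ s ∈ S, s ∈ A) ∧ (∀ t ∈ T, t ∈ A) ∧
    P = {x | (∀ s ∈ S, s x = 0) ∧ ∀ t ∈ T, t x ≠ 0}

theorem IsCell.inter {D : Type} {A : Subalgebra ℂ (D → ℂ)} {P Q : Set D} (hP : IsCell A P)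
    (hQ : IsCell A Q) : IsCell A (P ∩ Q) := by
  classical
  obtain ⟨S, T, hS, hT, rfl⟩ := hP
  obtain ⟨S', T', hS', hT', rfl⟩ := hQ
  refine ⟨S ∪ S', T ∪ T', ?_, ?_, ?_⟩
  · intro s hs
    rcases Finset.mem_union.1 hs with hs | hs
    exacts [hS s hs, hS' s hs]
  · intro s hs
    rcases Finset.mem_union.1 hs with hs | hs
    exacts [hT s hs, hT' s hs]
  · ext x
    simp only [Set.mem_inter_iff, Set.mem_ofPred_eq, Finset.mem_union, or_imp, forall_and]
    tauto

theorem isCell_signCell {D : Type} {A : Subalgebra ℂ (D → ℂ)} {S : Finset (D → ℂ)}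
    (hS : ∀ s ∈ S, s ∈ A) (T : Set (D → ℂ)) : IsCell A (signCell S T) := by
  classical
  refine ⟨S.filter (· ∈ T), S.filter (· ∉ T), fun s hs => hS s (Finset.mem_filter.1 hs).1,
    fun s hs => hS s (Finset.mem_filter.1 hs).1, ?_⟩
  ext x
  simp only [Set.mem_ofPred_eq, Finset.mem_filter, signCell]
  constructor
  · exact fun h => ⟨fun s hs => (h s hs.1).2 hs.2, fun s hs h0 => hs.2 ((h s hs.1).1 h0)⟩
  · rintro ⟨h1, h2⟩ s hs
    by_cases hT : s ∈ T
    · simp [hT, h1 s ⟨hs, hT⟩]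
    · simp [hT, h2 s ⟨hs, hT⟩]

/-- A sign cell of functions in `A'` cuts a cell of `A` in a cell, if the functions in `A'` are
quotients of functions in `A` there. -/
theorem IsCell.inter_signCell {D : Type} {A A' : Subalgebra ℂ (D → ℂ)} {P : Set D}
    (hP : IsCell A P) (h : ∀ a ∈ A', QuotOn A P a) {S : Finset (D → ℂ)}
    (hS : ∀ s ∈ S, s ∈ A') (T : Set (D → ℂ)) : IsCell A (P ∩ signCell S T) := by
  classical
  choose! p hp q hq hpq using h
  have key : P ∩ signCell S T =
      P ∩ {x | (∀ s ∈ (S.filter (· ∈ T)).image p, s x = 0) ∧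
        ∀ s ∈ (S.filter (· ∉ T)).image p, s x ≠ 0} := by
    ext x
    refine and_congr_right fun hx => ?_
    have h0 : ∀ s ∈ S, (s x = 0 ↔ p s x = 0) := by
      intro s hs
      rw [(hpq s (hS s hs) x hx).2, div_eq_zero_iff]
      simp [(hpq s (hS s hs) x hx).1]
    simp only [Set.mem_ofPred_eq, signCell, Finset.forall_mem_image, Finset.mem_filter]
    constructor
    · exact fun h => ⟨fun s hs => (h0 s hs.1).1 ((h s hs.1).2 hs.2),
        fun s hs h' => hs.2 ((h s hs.1).1 ((h0 s hs.1).2 h'))⟩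
    · rintro ⟨h1, h2⟩ s hs
      by_cases hT : s ∈ T
      · simp [hT, h0 s hs, h1 ⟨hs, hT⟩]
      · simp [hT, h0 s hs, h2 ⟨hs, hT⟩]
  rw [key]
  refine hP.inter ⟨_, _, ?_, ?_, rfl⟩
  · intro s hs
    obtain ⟨t, ht, rfl⟩ := Finset.mem_image.1 hs
    exact hp t (hS t (Finset.mem_filter.1 ht).1)
  · intro s hs
    obtain ⟨t, ht, rfl⟩ := Finset.mem_image.1 hs
    exact hp t (hS t (Finset.mem_filter.1 ht).1)

/-- Two finitely generated algebras of functions with the same inversion closure agree up to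
denominators on the members of a finite partition into common cells. -/
theorem exists_finite_partition {D : Type} {A A' : Subalgebra ℂ (D → ℂ)} (hA : A.FG) (hA' : A'.FG)
    (h : A ≤ invClosure (A' : Set (D → ℂ))) (h' : A' ≤ invClosure (A : Set (D → ℂ))) :
    ∃ (n : ℕ) (P : Fin n → Set D), (∀ j, (P j).Nonempty) ∧
      (∀ j k, j ≠ k → Disjoint (P j) (P k)) ∧ (∀ x, ∃ j, x ∈ P j) ∧
      ∀ j, IsCell A (P j) ∧ IsCell A' (P j) ∧ (∀ a ∈ A, QuotOn A' (P j) a) ∧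
        ∀ a ∈ A', QuotOn A (P j) a := by
  classical
  obtain ⟨S', hS', hq⟩ := exists_finset_quotOn hA h
  obtain ⟨S, hS, hq'⟩ := exists_finset_quotOn hA' h'
  -- Only the sign patterns that occur at some point are kept, since strata have to be nonempty.
  let I := {T : Set S × Set S' //
    (signCell S (Subtype.val '' T.1) ∩ signCell S' (Subtype.val '' T.2)).Nonempty}
  let e := Fintype.equivFin I
  refine ⟨Fintype.card I, fun j => signCell S (Subtype.val '' (e.symm j).1.1) ∩
    signCell S' (Subtype.val '' (e.symm j).1.2), fun j => (e.symm j).2, ?_, ?_, ?_⟩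
  · intro j k hjk
    rw [Set.disjoint_left]
    rintro x ⟨hx1, hx2⟩ ⟨hx3, hx4⟩
    apply hjk
    apply e.symm.injective
    apply Subtype.ext
    refine Prod.ext ?_ ?_
    · ext s
      have h1 := hx1 s.1 s.2
      have h2 := hx3 s.1 s.2
      simp only [Subtype.val_injective.mem_set_image] at h1 h2
      exact h1.symm.trans h2
    · ext s
      have h1 := hx2 s.1 s.2
      have h2 := hx4 s.1 s.2
      simp only [Subtype.val_injective.mem_set_image] at h1 h2
      exact h1.symm.trans h2
  · intro x
    have hx : x ∈ signCell S (Subtype.val '' {s : S | s.1 x = 0}) ∩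
        signCell S' (Subtype.val '' {s : S' | s.1 x = 0}) := by
      constructor
      · intro s hs
        have := (Subtype.val_injective (p := (· ∈ S))).mem_set_image
          (s := {s : S | s.1 x = 0}) (a := ⟨s, hs⟩)
        exact this.symm
      · intro s hs
        have := (Subtype.val_injective (p := (· ∈ S'))).mem_set_image
          (s := {s : S' | s.1 x = 0}) (a := ⟨s, hs⟩)
        exact this.symm
    refine ⟨e ⟨({s : S | s.1 x = 0}, {s : S' | s.1 x = 0}), ⟨x, hx⟩⟩, ?_⟩
    simpa only [Equiv.symm_apply_apply] using hx
  · intro j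
    -- On a sign cell of `S` the functions of `A'` are quotients from `A`, so conditions on `S'`
    -- become conditions on numerators in `A`. Exchanging the roles gives the cell of `A'`.
    refine ⟨(isCell_signCell hS _).inter_signCell (fun a ha => hq' _ a ha) hS' _, ?_,
      fun a ha => (hq _ a ha).mono Set.inter_subset_right,
      fun a ha => (hq' _ a ha).mono Set.inter_subset_left⟩
    have := (isCell_signCell hS' (Subtype.val '' (e.symm j).1.2)).inter_signCell
      (fun a ha => hq _ a ha) hS (Subtype.val '' (e.symm j).1.1)
    rwa [Set.inter_comm] at this

/-! ### Embedded cells and the isomorphisms between them -/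

/-- An injection `η` of `D` onto a locally closed subset of `Y` for which the induced structure
on `D` is the one given by the algebra `A` of functions. -/
structure IsEmb {D Y : Type} (s : SpaceWithFunctions Y) (A : Subalgebra ℂ (D → ℂ))
    (η : D → Y) : Prop where
  injective : Function.Injective η
  isLocallyClosed : @IsLocallyClosed _ s.top (Set.range η)
  extend : ∀ a ∈ A, ∀ x, ∃ W, IsOpen[s.top] W ∧ η x ∈ W ∧ ∃ g, s.Regular W g ∧
    ∀ x', η x' ∈ W → g (η x') = a x'
  pullback : ∀ W, IsOpen[s.top] W → ∀ g, s.Regular W g → ∀ x, η x ∈ W →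
    ∃ p ∈ A, ∃ q ∈ A, q x ≠ 0 ∧ ∀ x', q x' ≠ 0 → η x' ∈ W ∧ g (η x') = p x' / q x'

/-- The function `a` extends to `Y` only locally; the nonvanishing loci of the local extensions are
united. -/
theorem IsEmb.exists_isOpen {D Y : Type} {s : SpaceWithFunctions Y} {A : Subalgebra ℂ (D → ℂ)}
    {η : D → Y} (h : IsEmb s A η) {a : D → ℂ} (ha : a ∈ A) :
    ∃ W, IsOpen[s.top] W ∧ ∀ x, η x ∈ W ↔ a x ≠ 0 := by
  choose W hW hxW g hg hgx using h.extend a ha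
  let _ := s.top
  refine ⟨⋃ x, {y | y ∈ W x ∧ g x y ≠ 0}, isOpen_iUnion fun x => s.isOpen_ne_zero (hW x) (hg x),
    fun x => ?_⟩
  rw [Set.mem_iUnion]
  constructor
  · rintro ⟨x', hx', hne⟩
    rwa [hgx x' x hx'] at hne
  · exact fun hne => ⟨x, hxW x, by rwa [hgx x x (hxW x)]⟩

theorem IsEmb.isLocallyClosed_image {D Y : Type} {s : SpaceWithFunctions Y}
    {A : Subalgebra ℂ (D → ℂ)} {η : D → Y} (h : IsEmb s A η) {P : Set D} (hP : IsCell A P) :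
    @IsLocallyClosed _ s.top (η '' P) := by
  classical
  obtain ⟨S, T, hS, hT, rfl⟩ := hP
  let _ := s.top
  have key : ∀ S : Finset (D → ℂ), (∀ s ∈ S, s ∈ A) → IsLocallyClosed (η '' {x | ∀ s ∈ S, s x = 0}) := by
    intro S
    induction S using Finset.induction_on with
    | empty => intro _; simpa using h.isLocallyClosed
    | insert a S _ ih =>
      intro hS
      obtain ⟨W, hW, hxW⟩ := h.exists_isOpen (hS a (Finset.mem_insert_self _ _))
      have : η '' {x | ∀ s ∈ insert a S, s x = 0} = Wᶜ ∩ η '' {x | ∀ s ∈ S, s x = 0} := by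
        ext y
        constructor
        · rintro ⟨x, hx, rfl⟩
          refine ⟨fun hy => (hxW x).1 hy (hx a (Finset.mem_insert_self _ _)),
            x, fun s hs => hx s (Finset.mem_insert_of_mem hs), rfl⟩
        · rintro ⟨hy, x, hx, rfl⟩
          refine ⟨x, fun s hs => ?_, rfl⟩
          rcases Finset.mem_insert.1 hs with rfl | hs
          · by_contra h0
            exact hy ((hxW x).2 h0)
          · exact hx s hs
      rw [this]
      exact hW.isClosed_compl.isLocallyClosed.inter
        (ih fun s hs => hS s (Finset.mem_insert_of_mem hs))
  induction T using Finset.induction_on with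
  | empty => simpa using key S hS
  | insert a T _ ih =>
    obtain ⟨W, hW, hxW⟩ := h.exists_isOpen (hT a (Finset.mem_insert_self _ _))
    have : η '' {x | (∀ s ∈ S, s x = 0) ∧ ∀ t ∈ insert a T, t x ≠ 0} =
        W ∩ η '' {x | (∀ s ∈ S, s x = 0) ∧ ∀ t ∈ T, t x ≠ 0} := by
      ext y
      constructor
      · rintro ⟨x, ⟨hx0, hx⟩, rfl⟩
        exact ⟨(hxW x).2 (hx a (Finset.mem_insert_self _ _)),
          x, ⟨hx0, fun s hs => hx s (Finset.mem_insert_of_mem hs)⟩, rfl⟩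
      · rintro ⟨hy, x, ⟨hx0, hx⟩, rfl⟩
        refine ⟨x, ⟨hx0, fun s hs => ?_⟩, rfl⟩
        rcases Finset.mem_insert.1 hs with rfl | hs
        · exact (hxW x).1 hy
        · exact hx s hs
    rw [this]
    exact hW.isLocallyClosed.inter (ih fun s hs => hT s (Finset.mem_insert_of_mem hs))

/-- A regular function on the target is locally a quotient from `A'`, which on `P` is a quotient
from `A`, and the functions of `A` extend locally to regular functions on the source. -/
theorem IsEmb.isMorphism {D Y Y' : Type} {s : SpaceWithFunctions Y} {s' : SpaceWithFunctions Y'}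
    {A A' : Subalgebra ℂ (D → ℂ)} {η : D → Y} {η' : D → Y'} (h : IsEmb s A η)
    (h' : IsEmb s' A' η') {P : Set D} (hP : ∀ a ∈ A', QuotOn A P a)
    (φ : (η '' P : Set Y) → (η' '' P : Set Y'))
    (hφ : ∀ x (hx : x ∈ P), (φ ⟨η x, x, hx, rfl⟩ : Y') = η' x) :
    IsMorphism (s.restrict (η '' P)) (s'.restrict (η' '' P)) φ := by
  rintro _ ⟨W', hW', rfl⟩
  have key : ∀ a ∈ A', ∀ x ∈ P, ∃ W, IsOpen[s.top] W ∧ η x ∈ W ∧ ∃ g, s.Regular W g ∧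
      ∀ x' ∈ P, η x' ∈ W → g (η x') = a x' := by
    intro a ha x hx
    obtain ⟨p, hp, q, hq, hpq⟩ := hP a ha
    obtain ⟨W₁, hW₁, hxW₁, g₁, hg₁, hgx₁⟩ := h.extend p hp x
    obtain ⟨W₂, hW₂, hxW₂, g₂, hg₂, hgx₂⟩ := h.extend q hq x
    have hO := s.isOpen_ne_zero hW₂ hg₂
    have hO' := s.top.isOpen_inter _ _ hW₁ hO
    refine ⟨_, hO', ⟨hxW₁, hxW₂, by rw [hgx₂ x hxW₂]; exact (hpq x hx).1⟩,
      fun y => g₁ y * (g₂ y)⁻¹,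
      s.regular_mul hO' (s.regular_mono hW₁ hO' Set.inter_subset_left hg₁)
        (s.regular_mono hO hO' Set.inter_subset_right (s.regular_inv hW₂ hg₂)), ?_⟩
    rintro x' hx' ⟨h1, h2, -⟩
    beta_reduce
    rw [hgx₁ x' h1, hgx₂ x' h2, (hpq x' hx').2, div_eq_mul_inv]
  constructor
  · let _ := s.top
    let _ : TopologicalSpace (η '' P : Set Y) := s.top.induced Subtype.val
    refine isOpen_iff_forall_mem_open.2 ?_
    rintro ⟨_, x, hx, rfl⟩ hxW
    rw [Set.mem_preimage, Set.mem_preimage, hφ x hx] at hxW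
    -- Applied to the zero function, `pullback` provides a basic neighbourhood `q ≠ 0` of `x` that
    -- is mapped into `W'`.
    obtain ⟨p, hp, q, hq, hqx, hqW⟩ := h'.pullback W' hW' (fun _ => 0)
      (s'.regular_const 0 hW') x hxW
    obtain ⟨W, hW, hxW, g, hg, hgq⟩ := key q hq x hx
    refine ⟨Subtype.val ⁻¹' {y | y ∈ W ∧ g y ≠ 0}, ?_, ⟨_, s.isOpen_ne_zero hW hg, rfl⟩,
      hxW, by rwa [hgq x hx hxW]⟩
    rintro ⟨_, x', hx', rfl⟩ ⟨h1, h2⟩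
    rw [Set.mem_preimage, Set.mem_preimage, hφ x' hx']
    dsimp only at h1 h2
    rw [hgq x' hx' h1] at h2
    exact (hqW x' h2).1
  · rintro f hf ⟨_, x, hx, rfl⟩ hxW
    obtain ⟨W'', hW'', hxW'', g', hg', hfg⟩ := hf _ hxW
    rw [hφ x hx] at hxW''
    obtain ⟨p, hp, q, hq, hqx, hqW⟩ := h'.pullback W'' hW'' g' hg' x hxW''
    obtain ⟨W₁, hW₁, hxW₁, g₁, hg₁, hgx₁⟩ := key p hp x hx
    obtain ⟨W₂, hW₂, hxW₂, g₂, hg₂, hgx₂⟩ := key q hq x hx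
    have hO := s.isOpen_ne_zero hW₂ hg₂
    have hO' := s.top.isOpen_inter _ _ hW₁ hO
    refine ⟨_, hO', ⟨hxW₁, hxW₂, by rwa [hgx₂ x hx hxW₂]⟩,
      fun y => g₁ y * (g₂ y)⁻¹,
      s.regular_mul hO' (s.regular_mono hW₁ hO' Set.inter_subset_left hg₁)
        (s.regular_mono hO hO' Set.inter_subset_right (s.regular_inv hW₂ hg₂)), ?_⟩
    rintro ⟨_, x', hx', rfl⟩ hU ⟨h1, h2, h3⟩
    dsimp only at h1 h2 h3
    rw [hgx₂ x' hx' h2] at h3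
    have hW3 := hqW x' h3
    have := hfg _ hU (by rw [hφ x' hx']; exact hW3.1)
    rw [hφ x' hx'] at this
    rw [Function.comp_apply, this, hW3.2]
    dsimp only
    rw [hgx₁ x' hx' h1, hgx₂ x' hx' h2, div_eq_mul_inv]

theorem IsEmb.isomorphic {D Y Y' : Type} {s : SpaceWithFunctions Y} {s' : SpaceWithFunctions Y'}
    {A A' : Subalgebra ℂ (D → ℂ)} {η : D → Y} {η' : D → Y'} (h : IsEmb s A η)
    (h' : IsEmb s' A' η') {P : Set D} (hP : ∀ a ∈ A', QuotOn A P a)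
    (hP' : ∀ a ∈ A, QuotOn A' P a) :
    Isomorphic (s.restrict (η '' P)) (s'.restrict (η' '' P)) := by
  let e₁ := Equiv.Set.image η P h.injective
  let e₂ := Equiv.Set.image η' P h'.injective
  refine ⟨e₁.symm.trans e₂, h.isMorphism h' hP _ fun x hx => ?_,
    h'.isMorphism h hP' _ fun x hx => ?_⟩
  · have : e₁.symm ⟨η x, x, hx, rfl⟩ = ⟨x, hx⟩ := (Equiv.symm_apply_eq _).2 rfl
    rw [Equiv.trans_apply, this]
    rfl
  · have : e₂.symm ⟨η' x, x, hx, rfl⟩ = ⟨x, hx⟩ := (Equiv.symm_apply_eq _).2 rfl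
    change (e₁ (e₂.symm _) : Y) = _
    rw [this]
    rfl

/-! ### Cell families and the reduction to algebras on the parameter spaces -/

/-- A decomposition of a filtered space into embedded cells, each of them contained in or disjoint
from any level. -/
structure IsCellFamily {X K : Type} (F : FilteredSpace X) (D : K → Type)
    (A : ∀ k, Subalgebra ℂ (D k → ℂ)) (ξ : ∀ k, D k → X) (level : K → ℕ) : Prop where
  index_eq : ∀ k k' x x', ξ k x = ξ k' x' → k = k'
  cover : ∀ z, ∃ k x, ξ k x = z
  exists_lift : ∀ k N, level k ≤ N → ∃ η : D k → F.level N,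
    (∀ x, F.incl N (η x) = ξ k x) ∧ IsEmb (F.str N) (A k) η
  level_le : ∀ k N x, ξ k x ∈ Set.range (F.incl N) → level k ≤ N

section CellFamily
variable {X K : Type} {F : FilteredSpace X} {D : K → Type} {A : ∀ k, Subalgebra ℂ (D k → ℂ)}
  {ξ : ∀ k, D k → X} {level : K → ℕ}

theorem IsCellFamily.injective (h : IsCellFamily F D A ξ level) (k : K) :
    Function.Injective (ξ k) := by
  obtain ⟨η, hη, he⟩ := h.exists_lift k _ le_rfl
  intro x x' hx
  rw [← hη, ← hη] at hx
  exact he.injective (F.incl_injective _ hx)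

theorem preimage_incl_image {N : ℕ} {k : K} {η : D k → F.level N}
    (hη : ∀ x, F.incl N (η x) = ξ k x) (P : Set (D k)) :
    F.incl N ⁻¹' (ξ k '' P) = η '' P := by
  ext y
  constructor
  · rintro ⟨x, hx, hxy⟩
    exact ⟨x, hx, F.incl_injective N (by rw [hη, hxy])⟩
  · rintro ⟨x, hx, rfl⟩
    exact ⟨x, hx, (hη x).symm⟩

theorem IsCellFamily.level_le_of_subset (h : IsCellFamily F D A ξ level) {k : K} {N : ℕ}
    {P : Set (D k)} (hne : P.Nonempty) (hP : ξ k '' P ⊆ Set.range (F.incl N)) : level k ≤ N := by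
  obtain ⟨x, hx⟩ := hne
  exact h.level_le k N x (hP ⟨x, hx, rfl⟩)

theorem IsCellFamily.isCompatiblePartition [Countable K] (h : IsCellFamily F D A ξ level)
    {n : K → ℕ} {P : ∀ k, Fin (n k) → Set (D k)} (hne : ∀ k j, (P k j).Nonempty)
    (hdisj : ∀ k i j, i ≠ j → Disjoint (P k i) (P k j)) (hcover : ∀ k x, ∃ j, x ∈ P k j)
    (hcell : ∀ k j, IsCell (A k) (P k j))
    (hqp : ∀ k j N (η : D k → F.level N), IsEmb (F.str N) (A k) η →
      IsQuasiProjective ((F.str N).restrict (η '' P k j))) :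
    IsCompatiblePartition F (fun j : Σ k, Fin (n k) => ξ j.1 '' P j.1 j.2) where
  countable := inferInstance
  nonempty := fun j => (hne _ _).image _
  disjoint := by
    rintro ⟨k, i⟩ ⟨k', i'⟩ hne
    rw [Set.disjoint_left]
    rintro _ ⟨x, hx, rfl⟩ ⟨x', hx', hxx⟩
    obtain rfl := h.index_eq _ _ _ _ hxx
    obtain rfl := h.injective _ hxx
    exact Set.disjoint_left.1 (hdisj _ i i' fun h0 => hne (by rw [h0])) hx hx'
  iUnion_eq := by
    refine Set.eq_univ_of_forall fun z => ?_
    obtain ⟨k, x, rfl⟩ := h.cover z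
    obtain ⟨j, hj⟩ := hcover k x
    exact Set.mem_iUnion.2 ⟨⟨k, j⟩, x, hj, rfl⟩
  level_eq := by
    intro N
    refine ⟨{j | level j.1 ≤ N}, ?_⟩
    ext z
    simp only [Set.mem_iUnion]
    constructor
    · intro hz
      obtain ⟨k, x, rfl⟩ := h.cover z
      obtain ⟨j, hj⟩ := hcover k x
      exact ⟨⟨k, j⟩, h.level_le k N x hz, x, hj, rfl⟩
    · rintro ⟨⟨k, j⟩, hk, x, -, rfl⟩
      obtain ⟨η, hη, -⟩ := h.exists_lift k N hk
      exact ⟨η x, hη x⟩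
  exists_level := by
    rintro ⟨k, j⟩
    obtain ⟨η, hη, -⟩ := h.exists_lift k _ le_rfl
    refine ⟨level k, ?_⟩
    rintro _ ⟨x, -, rfl⟩
    exact ⟨η x, hη x⟩
  isLocallyClosed := by
    rintro ⟨k, j⟩ N hN
    obtain ⟨η, hη, he⟩ := h.exists_lift k N (h.level_le_of_subset (hne k j) hN)
    rw [preimage_incl_image hη]
    exact he.isLocallyClosed_image (hcell k j)
  isQuasiProjective := by
    rintro ⟨k, j⟩ N hN
    obtain ⟨η, hη, he⟩ := h.exists_lift k N (h.level_le_of_subset (hne k j) hN)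
    rw [FilteredSpace.stratum, preimage_incl_image hη]
    exact hqp k j N η he

end CellFamily

/-- The two families share the parameter sets `D k`, so one partition of `D k` into common cells
serves both spaces. A projective embedding of `D k` for the algebra `A' k` makes the strata of both
sides quasi-projective, as the induced structures agree on common cells. -/
theorem exists_partitions {X X' K : Type} [Countable K] {F : FilteredSpace X}
    {F' : FilteredSpace X'} {D : K → Type} {A A' : ∀ k, Subalgebra ℂ (D k → ℂ)}
    {ξ : ∀ k, D k → X} {ξ' : ∀ k, D k → X'} {level level' : K → ℕ}
    (h : IsCellFamily F D A ξ level) (h' : IsCellFamily F' D A' ξ' level')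
    (hA : ∀ k, (A k).FG) (hA' : ∀ k, (A' k).FG)
    (hAA' : ∀ k, A k ≤ invClosure (A' k : Set (D k → ℂ)))
    (hA'A : ∀ k, A' k ≤ invClosure (A k : Set (D k → ℂ)))
    (hqp : ∀ k, ∃ n, ∃ η : D k → Proj (Fin (n + 1) → ℂ), IsEmb (projectiveSpace n) (A' k) η) :
    ∃ (J : Type) (U : J → Set X) (V : J → Set X'),
      IsCompatiblePartition F U ∧ IsCompatiblePartition F' V ∧
      ∀ (j : J) (N M : ℕ), U j ⊆ Set.range (F.incl N) → V j ⊆ Set.range (F'.incl M) →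
        Isomorphic (F.stratum N (U j)) (F'.stratum M (V j)) := by
  choose n P hne hdisj hcover hcell hcell' hq hq' using fun k =>
    (fun ⟨n, P, h1, h2, h3, h4⟩ => ⟨n, P, h1, h2, h3, fun j => (h4 j).1, fun j => (h4 j).2.1,
      fun j => (h4 j).2.2.1, fun j => (h4 j).2.2.2⟩ : _ → ∃ (n : ℕ) (P : Fin n → Set (D k)),
        (∀ j, (P j).Nonempty) ∧ (∀ j k, j ≠ k → Disjoint (P j) (P k)) ∧ (∀ x, ∃ j, x ∈ P j) ∧
        (∀ j, IsCell (A k) (P j)) ∧ (∀ j, IsCell (A' k) (P j)) ∧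
        (∀ j, ∀ a ∈ A k, QuotOn (A' k) (P j) a) ∧ ∀ j, ∀ a ∈ A' k, QuotOn (A k) (P j) a)
      (exists_finite_partition (hA k) (hA' k) (hAA' k) (hA'A k))
  refine ⟨Σ k, Fin (n k), fun j => ξ j.1 '' P j.1 j.2, fun j => ξ' j.1 '' P j.1 j.2,
    h.isCompatiblePartition hne hdisj hcover hcell ?_,
    h'.isCompatiblePartition hne hdisj hcover hcell' ?_, ?_⟩
  · intro k j N η he
    obtain ⟨d, ι, hι⟩ := hqp k
    exact ⟨d, ι '' P k j, hι.isLocallyClosed_image (hcell' k j),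
      he.isomorphic hι (hq' k j) (hq k j)⟩
  · intro k j N η he
    obtain ⟨d, ι, hι⟩ := hqp k
    exact ⟨d, ι '' P k j, hι.isLocallyClosed_image (hcell' k j),
      he.isomorphic hι (fun _ ha => QuotOn.of_mem ha) (fun _ ha => QuotOn.of_mem ha)⟩
  · rintro ⟨k, j⟩ N M hN hM
    obtain ⟨η, hη, he⟩ := h.exists_lift k N (h.level_le_of_subset (hne k j) hN)
    obtain ⟨η', hη', he'⟩ := h'.exists_lift k M (h'.level_le_of_subset (hne k j) hM)
    rw [FilteredSpace.stratum, FilteredSpace.stratum, preimage_incl_image hη,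
      preimage_incl_image hη']
    exact he.isomorphic he' (hq' k j) (hq k j)

/-! ### Inversion in integral extensions -/

section Integral

open Polynomial

variable {D : Type} {E B : Subalgebra ℂ (D → ℂ)}

/-- Write `p = q X + c`. Where `c ≠ 0` and `e h ≠ 0`, the relation says that `-c⁻¹ q(h)` is inverse
to `h`. Where `c = 0`, a factor `h` cancels pointwise and the induction applies to `q`; the factor
`e` records this restriction. The idempotent `c c⁻¹` of `E` glues the two solutions. -/
theorem exists_sq_mul_eq (hE : InvClosed E) (hEB : E ≤ B) {h : D → ℂ} (hh : h ∈ B) (n : ℕ) :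
    ∀ (p : E[X]) (e : D → ℂ), e ∈ E → p.Monic → p.natDegree = n → e * h * aeval h p = 0 →
      ∃ b ∈ B, e * h ^ 2 * b = e * h := by
  have hpB : ∀ p : E[X], aeval h p ∈ B := by
    intro p
    rw [aeval_eq_sum_range]
    refine B.sum_mem fun i _ => ?_
    rw [Algebra.smul_def]
    exact B.mul_mem (hEB (p.coeff i).2) (B.pow_mem hh i)
  induction n with
  | zero =>
    intro p e _ hp hn h0
    rw [(Monic.natDegree_eq_zero hp).1 hn, map_one, mul_one] at h0
    exact ⟨0, B.zero_mem, by rw [mul_zero, h0]⟩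
  | succ n ih =>
    intro p e he hp hn h0
    set c : D → ℂ := Subtype.val (p.coeff 0) with hc
    have hcE : c ∈ E := (p.coeff 0).2
    set q := p.divX with hq
    have hqn : q.natDegree = n := by rw [hq, natDegree_divX_eq_natDegree_tsub_one, hn]; rfl
    have hqm : q.Monic := by
      rw [Monic, leadingCoeff, hqn, hq, coeff_divX, ← hn]
      exact hp
    have hpq : aeval h p = aeval h q * h + c := by
      conv_lhs => rw [← divX_mul_X_add p]
      rw [map_add, map_mul, aeval_X, aeval_C]
      rfl
    have hx : ∀ x, e x * h x * (aeval h q x * h x + c x) = 0 := by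
      intro x
      have := congrFun h0 x
      rwa [hpq] at this
    obtain ⟨b, hb, hbe⟩ := ih q (e * (1 - c * c⁻¹))
      (E.mul_mem he (E.sub_mem E.one_mem (E.mul_mem hcE (hE c hcE)))) hqm hqn (by
        ext x
        have := hx x
        simp only [Pi.mul_apply, Pi.sub_apply, Pi.one_apply, Pi.inv_apply, Pi.zero_apply]
        by_cases hcx : c x = 0
        · rw [hcx] at this ⊢
          by_cases h' : h x = 0
          · simp [h']
          · have : e x * h x * aeval h q x * h x = 0 := by linear_combination this
            rcases mul_eq_zero.1 this with h1 | h1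
            · simpa using h1
            · exact absurd h1 h'
        · simp [hcx])
    refine ⟨c * c⁻¹ * (-c⁻¹ * aeval h q) + (1 - c * c⁻¹) * b, ?_, ?_⟩
    · have h1 := hEB hcE
      have h2 := hEB (hE c hcE)
      exact B.add_mem (B.mul_mem (B.mul_mem h1 h2) (B.mul_mem (B.neg_mem h2) (hpB q)))
        (B.mul_mem (B.sub_mem B.one_mem (B.mul_mem h1 h2)) hb)
    · ext x
      have h1 := hx x
      have h2 := congrFun hbe x
      simp only [Pi.mul_apply, Pi.sub_apply, Pi.one_apply, Pi.inv_apply, Pi.add_apply,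
        Pi.neg_apply, Pi.pow_apply] at h2 ⊢
      by_cases hcx : c x = 0
      · rw [hcx] at h2 ⊢
        simpa using h2
      · rw [mul_inv_cancel₀ hcx]
        field_simp
        linear_combination -h1

variable {G : Type} [Group G] [Fintype G] [MulAction G D]

/-- If the invariants of a `G`-stable algebra `B` of functions lie in `E`, then `B` is integral
over `E`. -/
theorem isIntegral_of_invariants_le
    (hG : ∀ f ∈ B, ∀ g : G, (fun x => f (g • x)) ∈ B)
    (hinv : ∀ f ∈ B, (∀ (g : G) x, f (g • x) = f x) → f ∈ E) {h : D → ℂ} (hh : h ∈ B) :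
    IsIntegral E h := by
  let hB : G → B := fun g => ⟨fun x => h (g • x), hG h hh g⟩
  -- The orbit polynomial of `h`: its coefficients are invariants in `B`, hence lie in `E`.
  let P : (D → ℂ)[X] := ∏ g : G, (X - C (hB g : D → ℂ))
  have hPm : P.Monic := monic_prod_of_monic _ _ fun g _ => monic_X_sub_C _
  have hPB : P = (∏ g : G, (X - C (hB g))).map (algebraMap B (D → ℂ)) := by
    rw [Polynomial.map_prod]
    refine Finset.prod_congr rfl fun g _ => ?_
    rw [Polynomial.map_sub, map_X, map_C]
    rfl
  have hPE : ∀ n, P.coeff n ∈ E := by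
    intro n
    refine hinv _ ?_ fun g x => ?_
    · rw [hPB, coeff_map]
      exact Subtype.property _
    · let ρ : (D → ℂ) →+* (D → ℂ) := RingHom.pi fun x => Pi.evalRingHom _ (g • x)
      have hρ : P.map ρ = P := by
        rw [Polynomial.map_prod]
        refine Fintype.prod_equiv (Equiv.mulRight g) _ _ fun g' => ?_
        rw [Polynomial.map_sub, map_X, map_C]
        congr 2
        ext x
        change h (g' • g • x) = h ((g' * g) • x)
        rw [mul_smul]
      conv_rhs => rw [← hρ, coeff_map]
      rfl
  have hl : P ∈ lifts (algebraMap E (D → ℂ)) := by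
    rw [lifts_iff_coeff_lifts]
    exact fun n => ⟨⟨_, hPE n⟩, rfl⟩
  obtain ⟨p, hp, -, hpm⟩ := lifts_and_natDegree_eq_and_monic hl hPm
  refine ⟨p, hpm, ?_⟩
  rw [← eval_map, hp, eval_prod]
  refine Finset.prod_eq_zero (Finset.mem_univ 1) ?_
  rw [eval_sub, eval_X, eval_C, sub_eq_zero]
  ext x
  change h x = h ((1 : G) • x)
  rw [one_smul]

/-- If the invariants of a `G`-stable algebra `B` of functions lie in an algebra `E ≤ B` closed
under inversion, then `B`, being integral over `E`, is closed under inversion. -/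
theorem invClosed_of_invariants_le (hE : InvClosed E) (hEB : E ≤ B)
    (hG : ∀ f ∈ B, ∀ g : G, (fun x => f (g • x)) ∈ B)
    (hinv : ∀ f ∈ B, (∀ (g : G) x, f (g • x) = f x) → f ∈ E) : InvClosed B := by
  intro h hh
  obtain ⟨p, hpm, hev⟩ := isIntegral_of_invariants_le hG hinv hh
  rw [← aeval_def] at hev
  obtain ⟨b, hb, hbh⟩ := exists_sq_mul_eq hE hEB hh _ p 1 E.one_mem hpm rfl (by rw [hev, mul_zero])
  -- From `h² b = h` it follows that `h b = 1` where `h ≠ 0`; where `h = 0` both sides vanish,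
  -- whatever `b` is.
  have : h⁻¹ = h * b ^ 2 := by
    ext x
    have hx := congrFun hbh x
    simp only [Pi.mul_apply, Pi.one_apply, Pi.pow_apply, Pi.inv_apply, one_mul] at hx ⊢
    by_cases h0 : h x = 0
    · simp [h0]
    · have : h x * b x = 1 := mul_left_cancel₀ h0 (by linear_combination hx)
      rw [eq_inv_of_mul_eq_one_right this]
      field_simp
  rw [this]
  exact B.mul_mem hh (B.pow_mem hb 2)

end Integral

/-! ### Symmetrized products and power sums -/

section PowerSums

variable {ι R : Type} [Fintype ι] [CommRing R]

/-- Symmetrized products of families are polynomials in power sums. -/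
theorem sum_embedding_prod_mem (E : Subring R) (Φ : Set (ι → R))
    (hmul : ∀ φ ∈ Φ, ∀ ψ ∈ Φ, φ * ψ ∈ Φ) (hsum : ∀ φ ∈ Φ, ∑ i, φ i ∈ E) (r : ℕ) :
    ∀ φ : Fin r → ι → R, (∀ k, φ k ∈ Φ) → ∑ f : Fin r ↪ ι, ∏ k, φ k (f k) ∈ E := by
  classical
  induction r with
  | zero =>
    intro φ _
    simp only [Finset.univ_eq_empty, Finset.prod_empty]
    exact E.sum_mem fun _ _ => E.one_mem
  | succ r ih =>
    intro φ hφ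
    -- The value at `0` is first left free and its collisions with the other values are subtracted.
    -- A collision with the value at `l.succ` merges `φ 0` into the factor `φ l.succ`, which stays
    -- in `Φ`.
    have key : ∑ f : Fin (r + 1) ↪ ι, ∏ k, φ k (f k) =
        (∑ f : Fin r ↪ ι, ∏ k, φ k.succ (f k)) * (∑ i, φ 0 i) -
          ∑ l : Fin r, ∑ f : Fin r ↪ ι, ∏ k, Function.update (fun k => φ k.succ) l
            (φ l.succ * φ 0) k (f k) := by
      rw [← Equiv.sum_comp (Equiv.embeddingFinSucc r ι).symm, Fintype.sum_sigma, Finset.sum_comm,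
        Finset.sum_mul, ← Finset.sum_sub_distrib]
      refine Finset.sum_congr rfl fun f _ => ?_
      have h1 : ∀ i : {i // i ∉ Set.range f},
          ∏ k, φ k ((Equiv.embeddingFinSucc r ι).symm ⟨f, i⟩ k) =
            φ 0 i * ∏ k, φ k.succ (f k) := by
        intro i
        rw [Fin.prod_univ_succ, Equiv.coe_embeddingFinSucc_symm]
        simp
      have h2 : ∀ l : Fin r, ∏ k, Function.update (fun k => φ k.succ) l (φ l.succ * φ 0) k (f k) =
          (∏ k, φ k.succ (f k)) * φ 0 (f l) := by
        intro l
        rw [← Finset.mul_prod_erase _ _ (Finset.mem_univ l),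
          ← Finset.mul_prod_erase _ (fun k => φ k.succ (f k)) (Finset.mem_univ l),
          Function.update_self, Pi.mul_apply]
        rw [Finset.prod_congr rfl fun k hk => by
          rw [Function.update_of_ne (Finset.ne_of_mem_erase hk)]]
        ring
      simp only [h1, h2]
      rw [← Finset.sum_mul, ← Finset.mul_sum]
      have h3 : ∑ i, φ 0 i = ∑ i : {i // i ∉ Set.range f}, φ 0 i + ∑ l, φ 0 (f l) := by
        rw [← Finset.sum_add_sum_compl (Finset.univ.map f) (φ 0), Finset.sum_map, add_comm]
        congr 1
        refine (Finset.sum_subtype _ (fun i => ?_) _)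
        simp
      rw [h3]
      ring
    rw [key]
    refine E.sub_mem (E.mul_mem (ih _ fun k => hφ _) (hsum _ (hφ 0)))
      (E.sum_mem fun l _ => ih _ fun k => ?_)
    rcases eq_or_ne k l with rfl | hk
    · rw [Function.update_self]
      exact hmul _ (hφ _) _ (hφ _)
    · rw [Function.update_of_ne hk]
      exact hφ _

theorem sum_perm_prod_mem {m : ℕ} (E : Subring R) (Φ : Set (Fin m → R))
    (hmul : ∀ φ ∈ Φ, ∀ ψ ∈ Φ, φ * ψ ∈ Φ) (hsum : ∀ φ ∈ Φ, ∑ i, φ i ∈ E)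
    (φ : Fin m → Fin m → R) (hφ : ∀ k, φ k ∈ Φ) :
    ∑ σ : Equiv.Perm (Fin m), ∏ k, φ k (σ k) ∈ E := by
  classical
  refine (Fintype.sum_bijective (fun σ : Equiv.Perm (Fin m) => σ.toEmbedding)
    ⟨fun σ τ h => ?_, fun f => ?_⟩ (fun σ => ∏ k, φ k (σ k))
    (fun f => ∏ k, φ k (f k)) fun _ => rfl) ▸ sum_embedding_prod_mem E Φ hmul hsum m φ hφ
  · exact Equiv.ext fun k => DFunLike.congr_fun h k
  · exact ⟨f.equivOfFiniteSelfEmbedding, f.toEmbedding_equivOfFiniteSelfEmbedding⟩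

end PowerSums

/-! ### Definable predicates and functions -/

section Definable

variable {D : Type} {E : Subalgebra ℂ (D → ℂ)}

open Classical in
/-- A predicate whose indicator function lies in the algebra `E`. -/
def DefinableIn (E : Subalgebra ℂ (D → ℂ)) (P : D → Prop) : Prop :=
  (fun x => if P x then (1 : ℂ) else 0) ∈ E

theorem DefinableIn.congr {P Q : D → Prop} (h : DefinableIn E P) (hPQ : ∀ x, P x ↔ Q x) :
    DefinableIn E Q := by
  obtain rfl : P = Q := funext fun x => propext (hPQ x)
  exact h

/-- Since `0⁻¹ = 0`, the function `(f - g) * (f - g)⁻¹` is the indicator of `f ≠ g`. -/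
theorem DefinableIn.eq (hE : InvClosed E) {f g : D → ℂ} (hf : f ∈ E) (hg : g ∈ E) :
    DefinableIn E (fun x => f x = g x) := by
  classical
  have h : (1 - (f - g) * (f - g)⁻¹ : D → ℂ) ∈ E :=
    E.sub_mem E.one_mem (E.mul_mem (E.sub_mem hf hg) (hE _ (E.sub_mem hf hg)))
  rw [DefinableIn]
  convert h using 1
  ext x
  by_cases hx : f x = g x
  · simp [hx]
  · simp [hx, sub_ne_zero.2 hx]

theorem DefinableIn.ite {P : D → Prop} [DecidablePred P] (hP : DefinableIn E P) {f g : D → ℂ}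
    (hf : f ∈ E) (hg : g ∈ E) : (fun x => if P x then f x else g x) ∈ E := by
  classical
  have h := E.add_mem (E.mul_mem hP hf) (E.mul_mem (E.sub_mem E.one_mem hP) hg)
  convert h using 1
  ext x
  by_cases hx : P x <;> simp [hx]

theorem const_mem (c : ℂ) : (fun _ => c) ∈ E :=
  E.algebraMap_mem c

theorem definableIn_const (p : Prop) : DefinableIn E (fun _ => p) := by
  classical
  by_cases hp : p
  · simp only [DefinableIn, hp, if_true]
    exact const_mem 1
  · simp only [DefinableIn, hp, if_false]
    exact const_mem 0

theorem DefinableIn.not {P : D → Prop} (hP : DefinableIn E P) : DefinableIn E (fun x => ¬ P x) := by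
  classical
  have h := hP.ite E.zero_mem E.one_mem
  rw [DefinableIn]
  convert h using 1
  ext x
  by_cases hx : P x <;> simp [hx]

theorem DefinableIn.and {P Q : D → Prop} (hP : DefinableIn E P) (hQ : DefinableIn E Q) :
    DefinableIn E (fun x => P x ∧ Q x) := by
  classical
  have h := E.mul_mem hP hQ
  rw [DefinableIn]
  convert h using 1
  ext x
  by_cases hx : P x <;> simp [hx]

theorem DefinableIn.imp {P Q : D → Prop} (hP : DefinableIn E P) (hQ : DefinableIn E Q) :
    DefinableIn E (fun x => P x → Q x) :=
  (hP.and hQ.not).not.congr fun x => by tauto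

theorem DefinableIn.forall_mem {ι : Type} (s : Finset ι) {P : ι → D → Prop}
    (hP : ∀ i ∈ s, DefinableIn E (P i)) : DefinableIn E (fun x => ∀ i ∈ s, P i x) := by
  classical
  induction s using Finset.induction_on with
  | empty => exact (definableIn_const True).congr (by simp)
  | insert a s _ ih =>
    exact ((hP a (Finset.mem_insert_self _ _)).and
      (ih fun i hi => hP i (Finset.mem_insert_of_mem hi))).congr (by simp)

theorem DefinableIn.forall {ι : Type} [Fintype ι] {P : ι → D → Prop}
    (hP : ∀ i, DefinableIn E (P i)) : DefinableIn E (fun x => ∀ i, P i x) :=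
  (DefinableIn.forall_mem Finset.univ fun i _ => hP i).congr (by simp)

theorem sum_mem_apply {ι : Type} {s : Finset ι} {f : ι → D → ℂ} (h : ∀ i ∈ s, f i ∈ E) :
    (fun x => ∑ i ∈ s, f i x) ∈ E := by
  convert E.sum_mem h using 1
  ext x
  simp

theorem prod_mem_apply {ι : Type} {s : Finset ι} {f : ι → D → ℂ} (h : ∀ i ∈ s, f i ∈ E) :
    (fun x => ∏ i ∈ s, f i x) ∈ E := by
  convert E.prod_mem h using 1
  ext x
  simp

theorem card_filter_mem {ι : Type} [Fintype ι] {P : ι → D → Prop} [∀ x, DecidablePred (P · x)]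
    (hP : ∀ i, DefinableIn E (P i)) :
    (fun x => ((Finset.univ.filter (P · x)).card : ℂ)) ∈ E := by
  have h : (fun x => ∑ i, if P i x then (1 : ℂ) else 0) ∈ E :=
    sum_mem_apply fun i _ => (hP i).ite (const_mem 1) (const_mem 0)
  convert h using 1
  ext x
  simp

theorem definableIn_natCast (hE : InvClosed E) {N : D → ℕ} (h : (fun x => (N x : ℂ)) ∈ E) (r : ℕ) :
    DefinableIn E (fun x => N x = r) :=
  (DefinableIn.eq hE h (const_mem (r : ℂ))).congr fun x => by simp

/-- Substitution of a bounded definable natural number. -/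
theorem comp_nat_mem {N : D → ℕ} (hN : ∀ r, DefinableIn E (fun x => N x = r)) {K : ℕ}
    (hK : ∀ x, N x ≤ K) {φ : ℕ → D → ℂ} (hφ : ∀ r, φ r ∈ E) : (fun x => φ (N x) x) ∈ E := by
  classical
  have h : (fun x => ∑ r ∈ Finset.range (K + 1), if N x = r then φ r x else 0) ∈ E :=
    sum_mem_apply fun r _ => (hN r).ite (hφ r) (const_mem 0)
  convert h using 1
  ext x
  rw [Finset.sum_ite_eq, if_pos (Finset.mem_range.2 (Nat.lt_succ_of_le (hK x)))]

theorem det_mem {n : Type} [Fintype n] [DecidableEq n] {M : D → Matrix n n ℂ}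
    (h : ∀ i j, (fun x => M x i j) ∈ E) : (fun x => (M x).det) ∈ E := by
  simp only [Matrix.det_apply]
  refine sum_mem_apply fun σ _ => ?_
  have : (fun x => ∏ i, M x (σ i) i) ∈ E := prod_mem_apply fun i _ => h _ _
  exact E.zsmul_mem this _

/-- The inverse matrix is the adjugate times the inverted determinant; where the determinant
vanishes both conventions give zero, so no case distinction is needed. -/
theorem inv_mulVec_mem (hE : InvClosed E) {n : Type} [Fintype n] [DecidableEq n]
    {M : D → Matrix n n ℂ} {a : D → n → ℂ} (h : ∀ i j, (fun x => M x i j) ∈ E)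
    (ha : ∀ i, (fun x => a x i) ∈ E) (i : n) : (fun x => ((M x)⁻¹.mulVec (a x)) i) ∈ E := by
  have hdet := hE _ (det_mem h)
  simp only [Matrix.inv_def, Ring.inverse_eq_inv', Matrix.smul_mulVec, Pi.smul_apply, smul_eq_mul]
  refine E.mul_mem hdet ?_
  simp only [Matrix.mulVec, dotProduct]
  refine sum_mem_apply fun j _ => E.mul_mem ?_ (ha j)
  simp only [Matrix.adjugate_apply]
  refine det_mem fun k l => ?_
  by_cases hk : k = j
  · subst hk
    simpa only [Matrix.updateRow_self] using const_mem _
  · simpa only [Matrix.updateRow_ne hk] using h k l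

end Definable

/-! ### Arrays, row classes and the separating function -/

section Filling

variable {m : ℕ}

/-- The arrays of complex numbers with rows of lengths `κ i`, extended by zero. -/
def Filling (κ : Fin m → ℕ) : Type :=
  {x : Fin m → ℕ → ℂ // ∀ i s, κ i ≤ s → x i s = 0}

/-- The permutations preserving the row lengths. -/
def rowStab (κ : Fin m → ℕ) : Subgroup (Equiv.Perm (Fin m)) where
  carrier := {σ | ∀ i, κ (σ i) = κ i}
  mul_mem' := by
    intro σ τ hσ hτ i
    rw [Equiv.Perm.mul_apply, hσ, hτ]
  one_mem' := fun _ => rfl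
  inv_mem' := by
    intro σ hσ i
    rw [← hσ]
    exact congrArg κ (σ.apply_symm_apply i)

theorem mem_rowStab {κ : Fin m → ℕ} {σ : Equiv.Perm (Fin m)} :
    σ ∈ rowStab κ ↔ ∀ i, κ (σ i) = κ i :=
  Iff.rfl

noncomputable instance (κ : Fin m → ℕ) : Fintype (rowStab κ) :=
  Fintype.ofFinite _

instance (κ : Fin m → ℕ) : MulAction (rowStab κ) (Filling κ) where
  smul σ x := ⟨fun i => x.1 (σ⁻¹.1 i), fun i s hs => x.2 _ s (by rwa [σ⁻¹.2])⟩
  one_smul _ := rfl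
  mul_smul σ τ x := by
    apply Subtype.ext
    funext i
    change x.1 ((σ * τ)⁻¹.1 i) = x.1 (τ⁻¹.1 (σ⁻¹.1 i))
    rw [mul_inv_rev]
    rfl

theorem smul_filling_apply {κ : Fin m → ℕ} (σ : rowStab κ) (x : Filling κ) (i : Fin m) :
    (σ • x).1 i = x.1 (σ⁻¹.1 i) :=
  rfl

/-- The coordinate functions. -/
def fillingCoord (κ : Fin m → ℕ) (i : Fin m) (s : ℕ) : Filling κ → ℂ :=
  fun x => x.1 i s

/-- Two rows have the same length and agree in the first `t` columns. -/
def RowRel (κ : Fin m → ℕ) (t : ℕ) (x : Fin m → ℕ → ℂ) (i j : Fin m) : Prop :=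
  κ i = κ j ∧ ∀ s < t, x i s = x j s

section RowRel
variable {κ : Fin m → ℕ} {t : ℕ} {x : Fin m → ℕ → ℂ} {i j k : Fin m}

theorem RowRel.refl (i : Fin m) : RowRel κ t x i i := ⟨rfl, fun _ _ => rfl⟩

theorem RowRel.symm (h : RowRel κ t x i j) : RowRel κ t x j i :=
  ⟨h.1.symm, fun s hs => (h.2 s hs).symm⟩

theorem RowRel.trans (h : RowRel κ t x i j) (h' : RowRel κ t x j k) : RowRel κ t x i k :=
  ⟨h.1.trans h'.1, fun s hs => (h.2 s hs).trans (h'.2 s hs)⟩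

end RowRel

/-- The values of a separating function for `RowRel`, given one for the first `t` columns. -/
def SepStep (κ : Fin m → ℕ) (t : ℕ) (f : Fin m → ℂ) (x : Fin m → ℕ → ℂ) (u : ℕ) : Prop :=
  ∀ i j, f i + u * x i t = f j + u * x j t → RowRel κ (t + 1) x i j

/-- A function on the rows whose values at two rows agree exactly if the rows have the same length
and agree in the first `t` columns. -/
noncomputable def rowSep (κ : Fin m → ℕ) : ℕ → (Fin m → ℕ → ℂ) → Fin m → ℂ
  | 0, _, i => κ i
  | t + 1, x, i => rowSep κ t x i +
      ((sInf {u | SepStep κ t (rowSep κ t x) x u} : ℕ) : ℂ) * x i t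

/-- A pair of rows with different entries in column `t` is confused by at most one `u`, and a pair
with equal entries there is already handled by `f`. There are `m * m` pairs, so one of `0, …, m * m`
works. The bound keeps the choice of the least `u` definable by finitely many cases. -/
theorem exists_sepStep {κ : Fin m → ℕ} {t : ℕ} {f : Fin m → ℂ} {x : Fin m → ℕ → ℂ}
    (hf : ∀ i j, f i = f j → RowRel κ t x i j) : ∃ u ≤ m * m, SepStep κ t f x u := by
  classical
  let bad : Fin m × Fin m → Finset ℕ := fun p =>
    if h : ∃ u : ℕ, f p.1 + u * x p.1 t = f p.2 + u * x p.2 t ∧ ¬ RowRel κ (t + 1) x p.1 p.2 then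
      {h.choose} else ∅
  have hcard : (Finset.univ.biUnion bad).card < (Finset.range (m * m + 1)).card := by
    rw [Finset.card_range, Nat.lt_succ_iff]
    refine Finset.card_biUnion_le.trans ?_
    refine (Finset.sum_le_card_nsmul _ _ 1 fun p _ => ?_).trans (by simp)
    dsimp only [bad]
    split_ifs <;> simp
  obtain ⟨u, hu, hub⟩ := Finset.exists_mem_notMem_of_card_lt_card hcard
  refine ⟨u, Nat.lt_succ_iff.1 (Finset.mem_range.1 hu), fun i j hij => ?_⟩
  by_contra hne
  refine hub (Finset.mem_biUnion.2 ⟨(i, j), Finset.mem_univ _, ?_⟩)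
  have h : ∃ u : ℕ, f i + u * x i t = f j + u * x j t ∧ ¬ RowRel κ (t + 1) x i j := ⟨u, hij, hne⟩
  dsimp only [bad]
  rw [dif_pos h, Finset.mem_singleton]
  have h' := h.choose_spec.1
  by_cases hx : x i t = x j t
  · exfalso
    rw [hx, add_left_inj] at hij
    have := hf i j hij
    exact hne ⟨this.1, fun s hs => (Nat.lt_succ_iff_lt_or_eq.1 hs).elim (this.2 s) fun h => h ▸ hx⟩
  · have h0 : ((u : ℂ) - (h.choose : ℂ)) * (x i t - x j t) = 0 := by linear_combination hij - h'
    rcases mul_eq_zero.1 h0 with h1 | h1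
    · exact_mod_cast sub_eq_zero.1 h1
    · exact absurd (sub_eq_zero.1 h1) hx

theorem rowSep_eq_iff {κ : Fin m → ℕ} {t : ℕ} {x : Fin m → ℕ → ℂ} {i j : Fin m} :
    rowSep κ t x i = rowSep κ t x j ↔ RowRel κ t x i j := by
  induction t generalizing i j with
  | zero => simp [rowSep, RowRel]
  | succ t ih =>
    constructor
    · obtain ⟨u, -, hu⟩ := exists_sepStep (fun i j => (ih (i := i) (j := j)).1)
      exact Nat.sInf_mem (s := {u | SepStep κ t (rowSep κ t x) x u}) ⟨u, hu⟩ i j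
    · intro h
      have h' : RowRel κ t x i j := ⟨h.1, fun s hs => h.2 s (Nat.lt_succ_of_lt hs)⟩
      rw [rowSep, rowSep, ih.2 h', h.2 t (Nat.lt_succ_self t)]

theorem RowRel_comp {κ : Fin m → ℕ} {σ : Equiv.Perm (Fin m)} (hσ : ∀ i, κ (σ i) = κ i) {t : ℕ}
    {x : Fin m → ℕ → ℂ} {i j : Fin m} :
    RowRel κ t (fun i => x (σ i)) i j ↔ RowRel κ t x (σ i) (σ j) := by
  rw [RowRel, RowRel, hσ, hσ]

/-- The multiplier is the least number satisfying a condition on all pairs of rows, so it does not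
depend on their order. This is why the interpolation points can be attached to the classes without
breaking the symmetry. -/
theorem rowSep_comp {κ : Fin m → ℕ} {σ : Equiv.Perm (Fin m)} (hσ : ∀ i, κ (σ i) = κ i) (t : ℕ)
    (x : Fin m → ℕ → ℂ) (i : Fin m) :
    rowSep κ t (fun i => x (σ i)) i = rowSep κ t x (σ i) := by
  induction t generalizing i with
  | zero => simp [rowSep, hσ]
  | succ t ih =>
    have h : {u | SepStep κ t (rowSep κ t fun i => x (σ i)) (fun i => x (σ i)) u} =
        {u | SepStep κ t (rowSep κ t x) x u} := by
      ext u
      simp only [Set.mem_ofPred_eq, SepStep, ih, RowRel_comp hσ]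
      constructor
      · intro h i j
        have := h (σ.symm i) (σ.symm j)
        simpa using this
      · exact fun h i j => h _ _
    rw [rowSep, rowSep, ih, h]

/-- The functions of the first `t` columns. -/
def columnFun (κ : Fin m → ℕ) (t : ℕ) : Set (Filling κ → ℂ) :=
  {f | ∃ i, ∃ s < t, f = fillingCoord κ i s}

theorem columnFun_mono {κ : Fin m → ℕ} {t t' : ℕ} (h : t ≤ t') :
    columnFun κ t ⊆ columnFun κ t' := by
  rintro _ ⟨i, s, hs, rfl⟩
  exact ⟨i, s, hs.trans_le h, rfl⟩

section definability
variable {κ : Fin m → ℕ} {t : ℕ} {E : Subalgebra ℂ (Filling κ → ℂ)}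

theorem definableIn_rowRel (hE : InvClosed E) (ht : columnFun κ t ⊆ E) (i j : Fin m) :
    DefinableIn E (fun x => RowRel κ t x.1 i j) := by
  refine (definableIn_const _).and ?_
  refine (DefinableIn.forall_mem (Finset.range t) (P := fun s x => x.1 i s = x.1 j s)
    fun s hs => ?_).congr (by simp)
  exact DefinableIn.eq hE (ht ⟨i, s, Finset.mem_range.1 hs, rfl⟩)
    (ht ⟨j, s, Finset.mem_range.1 hs, rfl⟩)

theorem rowSep_mem (hE : InvClosed E) (ht : columnFun κ t ⊆ E) (i : Fin m) :
    (fun x : Filling κ => rowSep κ t x.1 i) ∈ E := by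
  induction t generalizing i with
  | zero => exact const_mem _
  | succ t ih =>
    have ih' := fun i => ih ((columnFun_mono (Nat.le_succ t)).trans ht) i
    have hc : ∀ i, (fun x : Filling κ => x.1 i t) ∈ E := fun i =>
      ht ⟨i, t, Nat.lt_succ_self t, rfl⟩
    have hstep : ∀ u, DefinableIn E (fun x => SepStep κ t (rowSep κ t x.1) x.1 u) := fun u =>
      DefinableIn.forall fun i => DefinableIn.forall fun j =>
        (DefinableIn.eq hE (E.add_mem (ih' i) (E.mul_mem (const_mem (u : ℂ)) (hc i)))
          (E.add_mem (ih' j) (E.mul_mem (const_mem (u : ℂ)) (hc j)))).imp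
          (definableIn_rowRel hE ht i j)
    have hex : ∀ x : Filling κ, ∃ u ≤ m * m, SepStep κ t (rowSep κ t x.1) x.1 u := fun x =>
      exists_sepStep fun i j => rowSep_eq_iff.1
    have hinf : ∀ u, DefinableIn E
        (fun x => sInf {u | SepStep κ t (rowSep κ t x.1) x.1 u} = u) := by
      intro u
      refine ((hstep u).and (DefinableIn.forall_mem (Finset.range u)
        fun v _ => (hstep v).not)).congr fun x => ?_
      obtain ⟨w, -, hw⟩ := hex x
      constructor
      · rintro ⟨h1, h2⟩
        refine le_antisymm (Nat.sInf_le h1) (le_of_not_gt fun h => ?_)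
        exact h2 _ (Finset.mem_range.2 h)
          (Nat.sInf_mem (s := {u | SepStep κ t (rowSep κ t x.1) x.1 u}) ⟨w, hw⟩)
      · rintro rfl
        exact ⟨Nat.sInf_mem (s := {u | SepStep κ t (rowSep κ t x.1) x.1 u}) ⟨w, hw⟩,
          fun v hv => Nat.notMem_of_lt_sInf (Finset.mem_range.1 hv)⟩
    have hle : ∀ x : Filling κ, sInf {u | SepStep κ t (rowSep κ t x.1) x.1 u} ≤ m * m := by
      intro x
      obtain ⟨u, hu, hu'⟩ := hex x
      exact (Nat.sInf_le hu').trans hu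
    exact E.add_mem (ih' i) (E.mul_mem
      (comp_nat_mem hinf hle (φ := fun u _ => (u : ℂ)) fun u => const_mem _) (hc i))

end definability

end Filling

/-! ### Encoding the columns by Hermite interpolation -/

section Hermite

open Polynomial

variable {m : ℕ}

open Classical in
/-- The rows related to the row `i`. -/
noncomputable def rowClass (κ : Fin m → ℕ) (t : ℕ) (x : Fin m → ℕ → ℂ) (i : Fin m) :
    Finset (Fin m) :=
  Finset.univ.filter (RowRel κ t x i)

theorem mem_rowClass {κ : Fin m → ℕ} {t : ℕ} {x : Fin m → ℕ → ℂ} {i j : Fin m} :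
    j ∈ rowClass κ t x i ↔ RowRel κ t x i j := by
  simp [rowClass]

theorem rowClass_eq {κ : Fin m → ℕ} {t : ℕ} {x : Fin m → ℕ → ℂ} {i j : Fin m}
    (h : j ∈ rowClass κ t x i) : rowClass κ t x j = rowClass κ t x i := by
  ext k
  rw [mem_rowClass, mem_rowClass]
  rw [mem_rowClass] at h
  exact ⟨h.trans, h.symm.trans⟩

/-- The position of a row in its class. -/
noncomputable def rowRank (κ : Fin m → ℕ) (t : ℕ) (x : Fin m → ℕ → ℂ) (i : Fin m) : ℕ :=
  ((rowClass κ t x i).filter (· < i)).card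

/-- Needed so that each Taylor coefficient prescribed at the point of a class is assigned to exactly
one row of the class. -/
theorem rowRank_bijOn (κ : Fin m → ℕ) (t : ℕ) (x : Fin m → ℕ → ℂ) (i : Fin m) :
    Set.BijOn (rowRank κ t x) (rowClass κ t x i) (Finset.range (rowClass κ t x i).card) := by
  have hinj : Set.InjOn (rowRank κ t x) (rowClass κ t x i) := by
    have key : ∀ j ∈ rowClass κ t x i, ∀ k ∈ rowClass κ t x i, j < k →
        rowRank κ t x j < rowRank κ t x k := by
      intro j hj k hk hjk
      rw [rowRank, rowRank, rowClass_eq hj, rowClass_eq hk]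
      refine Finset.card_lt_card (Finset.ssubset_iff_of_subset ?_ |>.2 ⟨j, ?_, ?_⟩)
      · exact Finset.monotone_filter_right _ fun l _ hl => lt_trans hl hjk
      · exact Finset.mem_filter.2 ⟨hj, hjk⟩
      · simp
    intro j hj k hk hjk
    rcases lt_trichotomy j k with h | h | h
    · exact absurd hjk (key j hj k hk h).ne
    · exact h
    · exact absurd hjk (key k hk j hj h).ne'
  have hmaps : Set.MapsTo (rowRank κ t x) (rowClass κ t x i)
      (Finset.range (rowClass κ t x i).card) := by
    intro j hj
    rw [Finset.mem_coe, Finset.mem_range, rowRank, rowClass_eq hj]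
    exact Finset.card_lt_card (Finset.filter_ssubset.2 ⟨j, hj, lt_irrefl j⟩)
  refine ⟨hmaps, hinj, ?_⟩
  exact Finset.surjOn_of_injOn_of_card_le _ hmaps hinj (by simp)

/-- The elementary symmetric functions of the entries of column `t` in the class of a row. -/
noncomputable def classEsymm (κ : Fin m → ℕ) (t : ℕ) (x : Fin m → ℕ → ℂ) (i : Fin m) (k : ℕ) : ℂ :=
  ((rowClass κ t x i).val.map fun j => x j t).esymm k

/-- The polynomials whose exponents are indices of rows reaching column `t`. -/
def SupportedOn (κ : Fin m → ℕ) (t : ℕ) (b : ℂ[X]) : Prop :=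
  ∀ k, b.coeff k ≠ 0 → ∃ i : Fin m, (i : ℕ) = k ∧ t < κ i

/-- As `κ` is antitone, the rows reaching column `t` form an initial segment, so the degree of `b`
is less than their number. Each class contributes a zero of multiplicity its size, and together
these zeros are as many as the rows: too many unless `b = 0`. -/
theorem eq_zero_of_taylor_coeff_eq_zero {κ : Fin m → ℕ} (hκ : Antitone κ) {t : ℕ}
    {x : Fin m → ℕ → ℂ} {b : ℂ[X]} (hb : SupportedOn κ t b)
    (h : ∀ i, t < κ i → ∀ j < (rowClass κ t x i).card,
      (taylor (rowSep κ t x i) b).coeff j = 0) : b = 0 := by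
  classical
  by_contra hb0
  set act : Finset (Fin m) := Finset.univ.filter fun i => t < κ i with hact
  have hdeg : b.natDegree < act.card := by
    obtain ⟨i, hi, hti⟩ := hb b.natDegree (by simpa using hb0)
    have : Finset.Iic i ⊆ act := by
      intro j hj
      exact Finset.mem_filter.2 ⟨Finset.mem_univ _, hti.trans_le (hκ (Finset.mem_Iic.1 hj))⟩
    have := Finset.card_le_card this
    rw [Fin.card_Iic] at this
    omega
  have hroots : act.val.map (rowSep κ t x) ≤ b.roots := by
    rw [Multiset.le_iff_count]
    intro z
    rw [count_roots, Multiset.count_map]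
    by_cases hz : ∃ i ∈ act, z = rowSep κ t x i
    · obtain ⟨i, hi, rfl⟩ := hz
      have hi' := (Finset.mem_filter.1 hi).2
      refine le_trans ?_ ((le_rootMultiplicity_iff hb0 (n := (rowClass κ t x i).card)).2 ?_)
      · refine Finset.card_le_card (s := act.filter fun j => rowSep κ t x i = rowSep κ t x j) ?_
        intro j hj
        exact mem_rowClass.2 (rowSep_eq_iff.1 (Finset.mem_filter.1 hj).2)
      · rw [X_sub_C_pow_dvd_iff, ← taylor_apply, X_pow_dvd_iff]
        exact h i hi'
    · rw [Multiset.filter_eq_nil.2]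
      · simp
      · exact fun i hi hzi => hz ⟨i, hi, hzi⟩
  have h1 := Multiset.card_le_card hroots
  rw [Multiset.card_map, Finset.card_val] at h1
  have h2 := card_roots' b
  omega

/-- The matrix of the Hermite interpolation problem for the column `t`. -/
noncomputable def hermiteMatrix (κ : Fin m → ℕ) (t : ℕ) (x : Fin m → ℕ → ℂ) :
    Matrix (Fin m) (Fin m) ℂ :=
  Matrix.of fun i e => if t < κ i then
    ((e : ℕ).choose (rowRank κ t x i) : ℂ) * rowSep κ t x i ^ ((e : ℕ) - rowRank κ t x i)
  else if i = e then 1 else 0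

/-- The polynomial with given coefficients. -/
noncomputable def polyOfCoeff (v : Fin m → ℂ) : ℂ[X] := ∑ e : Fin m, C (v e) * X ^ (e : ℕ)

theorem coeff_polyOfCoeff (v : Fin m → ℂ) (e : Fin m) : (polyOfCoeff v).coeff e = v e := by
  rw [polyOfCoeff, finsetSum_coeff, Finset.sum_eq_single e]
  · simp
  · intro e' _ h
    rw [coeff_C_mul_X_pow, if_neg]
    exact fun h' => h (Fin.ext h'.symm)
  · simp

theorem supportedOn_polyOfCoeff {κ : Fin m → ℕ} {t : ℕ} {v : Fin m → ℂ}
    (hv : ∀ i, κ i ≤ t → v i = 0) : SupportedOn κ t (polyOfCoeff v) := by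
  intro k hk
  rw [polyOfCoeff, finsetSum_coeff] at hk
  obtain ⟨e, -, he⟩ := Finset.exists_ne_zero_of_sum_ne_zero hk
  rw [coeff_C_mul_X_pow] at he
  obtain ⟨rfl, he⟩ := ite_ne_right_iff.1 he
  exact ⟨e, rfl, not_le.1 fun h => he (by rw [if_pos rfl, hv e h])⟩

theorem taylor_coeff_polyOfCoeff (v : Fin m → ℂ) (z : ℂ) (j : ℕ) :
    (taylor z (polyOfCoeff v)).coeff j =
      ∑ e : Fin m, ((e : ℕ).choose j : ℂ) * z ^ ((e : ℕ) - j) * v e := by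
  rw [polyOfCoeff, taylor_coeff, map_sum, eval_finsetSum]
  refine Finset.sum_congr rfl fun e _ => ?_
  rw [C_mul_X_pow_eq_monomial, hasseDeriv_monomial, eval_monomial]
  ring

theorem hermiteMatrix_mulVec {κ : Fin m → ℕ} {t : ℕ} {x : Fin m → ℕ → ℂ} (v : Fin m → ℂ)
    (i : Fin m) : (hermiteMatrix κ t x).mulVec v i = if t < κ i then
      (taylor (rowSep κ t x i) (polyOfCoeff v)).coeff (rowRank κ t x i) else v i := by
  rw [Matrix.mulVec, dotProduct]
  split_ifs with h
  · rw [taylor_coeff_polyOfCoeff]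
    simp [hermiteMatrix, h]
  · simp [hermiteMatrix, h]

theorem hermiteMatrix_det_ne_zero {κ : Fin m → ℕ} (hκ : Antitone κ) (t : ℕ) (x : Fin m → ℕ → ℂ) :
    (hermiteMatrix κ t x).det ≠ 0 := by
  intro h0
  obtain ⟨v, hv0, hv⟩ := Matrix.exists_mulVec_eq_zero_iff.2 h0
  have hvi : ∀ i, κ i ≤ t → v i = 0 := by
    intro i hi
    have := congrFun hv i
    rwa [hermiteMatrix_mulVec, if_neg (not_lt.2 hi)] at this
  have hb : polyOfCoeff v = 0 := by
    refine eq_zero_of_taylor_coeff_eq_zero hκ (x := x) (supportedOn_polyOfCoeff hvi) ?_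
    intro i hi j hj
    obtain ⟨k, hk, rfl⟩ := (rowRank_bijOn κ t x i).2.2 (Finset.mem_coe.2 (Finset.mem_range.2 hj))
    have hik := mem_rowClass.1 hk
    have := congrFun hv k
    rwa [hermiteMatrix_mulVec, if_pos (by rwa [← hik.1]), ← rowSep_eq_iff.2 hik] at this
  apply hv0
  ext e
  rw [← coeff_polyOfCoeff v e, hb]
  simp

/-- The right hand side of the Hermite interpolation problem for the column `t`. -/
noncomputable def hermiteData (κ : Fin m → ℕ) (t : ℕ) (x : Fin m → ℕ → ℂ) (i : Fin m) : ℂ :=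
  if t < κ i then classEsymm κ t x i (rowRank κ t x i + 1) else 0

/-- The coefficients of the interpolation polynomial for the column `t`. -/
noncomputable def hermiteCoeff (κ : Fin m → ℕ) (t : ℕ) (x : Fin m → ℕ → ℂ) : Fin m → ℂ :=
  (hermiteMatrix κ t x)⁻¹.mulVec (hermiteData κ t x)

/-- The polynomial with coefficients `v` encodes the column `t` of `x`: its Taylor expansions
at the values of the separating function start with the elementary symmetric functions of
the classes. -/
def Encodes (κ : Fin m → ℕ) (t : ℕ) (x : Fin m → ℕ → ℂ) (v : Fin m → ℂ) : Prop :=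
  (∀ i, κ i ≤ t → v i = 0) ∧ ∀ i, t < κ i → ∀ j < (rowClass κ t x i).card,
    (taylor (rowSep κ t x i) (polyOfCoeff v)).coeff j = classEsymm κ t x i (j + 1)

theorem polyOfCoeff_sub (v w : Fin m → ℂ) :
    polyOfCoeff (v - w) = polyOfCoeff v - polyOfCoeff w := by
  simp [polyOfCoeff, sub_mul]

theorem Encodes.unique {κ : Fin m → ℕ} (hκ : Antitone κ) {t : ℕ} {x : Fin m → ℕ → ℂ}
    {v w : Fin m → ℂ} (hv : Encodes κ t x v) (hw : Encodes κ t x w) : v = w := by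
  have h0 : ∀ i, κ i ≤ t → (v - w) i = 0 := fun i hi => by
    rw [Pi.sub_apply, hv.1 i hi, hw.1 i hi, sub_zero]
  have := eq_zero_of_taylor_coeff_eq_zero hκ (x := x) (supportedOn_polyOfCoeff h0) (by
    intro i hi j hj
    rw [polyOfCoeff_sub, map_sub, coeff_sub, hv.2 i hi j hj, hw.2 i hi j hj, sub_self])
  ext e
  rw [← sub_eq_zero, ← Pi.sub_apply, ← coeff_polyOfCoeff (v - w) e, this, coeff_zero]

theorem encodes_hermiteCoeff {κ : Fin m → ℕ} (hκ : Antitone κ) (t : ℕ) (x : Fin m → ℕ → ℂ) :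
    Encodes κ t x (hermiteCoeff κ t x) := by
  have h : (hermiteMatrix κ t x).mulVec (hermiteCoeff κ t x) = hermiteData κ t x := by
    rw [hermiteCoeff, Matrix.mulVec_mulVec, Matrix.mul_nonsing_inv _
      (isUnit_iff_ne_zero.2 (hermiteMatrix_det_ne_zero hκ t x)), Matrix.one_mulVec]
  constructor
  · intro i hi
    have := congrFun h i
    rwa [hermiteMatrix_mulVec, hermiteData, if_neg (not_lt.2 hi), if_neg (not_lt.2 hi)] at this
  · intro i hi j hj
    obtain ⟨k, hk, rfl⟩ := (rowRank_bijOn κ t x i).2.2 (Finset.mem_coe.2 (Finset.mem_range.2 hj))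
    have hik := mem_rowClass.1 hk
    have := congrFun h k
    have hk' : t < κ k := by rwa [← hik.1]
    rw [hermiteMatrix_mulVec, hermiteData, if_pos hk', if_pos hk', ← rowSep_eq_iff.2 hik] at this
    rw [this, classEsymm, classEsymm, rowClass_eq hk]

theorem rowClass_comp {κ : Fin m → ℕ} {σ : Equiv.Perm (Fin m)} (hσ : ∀ i, κ (σ i) = κ i) (t : ℕ)
    (x : Fin m → ℕ → ℂ) (i : Fin m) :
    (rowClass κ t (fun i => x (σ i)) i).map σ.toEmbedding = rowClass κ t x (σ i) := by
  ext j
  rw [Finset.mem_map_equiv, mem_rowClass, mem_rowClass, RowRel_comp hσ, Equiv.apply_symm_apply]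

theorem classEsymm_comp {κ : Fin m → ℕ} {σ : Equiv.Perm (Fin m)} (hσ : ∀ i, κ (σ i) = κ i) (t : ℕ)
    (x : Fin m → ℕ → ℂ) (i : Fin m) :
    classEsymm κ t (fun i => x (σ i)) i = classEsymm κ t x (σ i) := by
  ext k
  rw [classEsymm, classEsymm, ← rowClass_comp hσ, Finset.map_val, Multiset.map_map]
  rfl

/-- The matrix depends on the order of the rows through `rowRank`, but the condition `Encodes` does
not, and it determines the coefficients. -/
theorem hermiteCoeff_comp {κ : Fin m → ℕ} (hκ : Antitone κ) {σ : Equiv.Perm (Fin m)}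
    (hσ : ∀ i, κ (σ i) = κ i) (t : ℕ) (x : Fin m → ℕ → ℂ) :
    hermiteCoeff κ t (fun i => x (σ i)) = hermiteCoeff κ t x := by
  refine (encodes_hermiteCoeff hκ t _).unique hκ ⟨(encodes_hermiteCoeff hκ t x).1, ?_⟩
  intro i hi j hj
  rw [rowSep_comp hσ, classEsymm_comp hσ]
  refine (encodes_hermiteCoeff hκ t x).2 (σ i) (by rwa [hσ]) j ?_
  rwa [← rowClass_comp hσ, Finset.card_map]

theorem rowClass_congr {κ : Fin m → ℕ} {t : ℕ} {x y : Fin m → ℕ → ℂ}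
    (h : ∀ i, ∀ s < t, x i s = y i s) (i : Fin m) : rowClass κ t x i = rowClass κ t y i := by
  ext j
  rw [mem_rowClass, mem_rowClass, RowRel, RowRel]
  refine and_congr_right fun _ => forall₂_congr fun s hs => ?_
  rw [h i s hs, h j s hs]

theorem rowSep_congr {κ : Fin m → ℕ} {t : ℕ} {x y : Fin m → ℕ → ℂ}
    (h : ∀ i, ∀ s < t, x i s = y i s) (i : Fin m) : rowSep κ t x i = rowSep κ t y i := by
  induction t generalizing i with
  | zero => rfl
  | succ t ih =>
    have ih' := funext (ih fun i s hs => h i s (Nat.lt_succ_of_lt hs))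
    have hS : {u | SepStep κ t (rowSep κ t x) x u} = {u | SepStep κ t (rowSep κ t y) y u} := by
      ext u
      simp only [Set.mem_ofPred_eq, SepStep, ih']
      refine forall₂_congr fun i j => ?_
      rw [h i t (Nat.lt_succ_self t), h j t (Nat.lt_succ_self t), ← mem_rowClass,
        ← mem_rowClass, rowClass_congr h]
    rw [rowSep, rowSep, hS, ih', h i t (Nat.lt_succ_self t)]

theorem Encodes.congr {κ : Fin m → ℕ} {t : ℕ} {x y : Fin m → ℕ → ℂ} {v : Fin m → ℂ}
    (h : ∀ i, ∀ s < t + 1, x i s = y i s) (hv : Encodes κ t x v) : Encodes κ t y v := by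
  have h' : ∀ i, ∀ s < t, x i s = y i s := fun i s hs => h i s (Nat.lt_succ_of_lt hs)
  refine ⟨hv.1, fun i hi j hj => ?_⟩
  rw [← rowClass_congr h'] at hj
  rw [← rowSep_congr h', hv.2 i hi j hj, classEsymm, classEsymm, rowClass_congr h']
  simp only [h _ t (Nat.lt_succ_self t)]

/-- Every vector encodes a column. -/
theorem exists_column {κ : Fin m → ℕ} (t : ℕ) (x : Filling κ) {v : Fin m → ℂ}
    (hv : ∀ i, κ i ≤ t → v i = 0) :
    ∃ y : Filling κ, (∀ i, ∀ s < t, x.1 i s = y.1 i s) ∧ Encodes κ t y.1 v := by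
  classical
  let τ : Fin m → ℕ → ℂ := fun i j => (taylor (rowSep κ t x.1 i) (polyOfCoeff v)).coeff j
  have hroots : ∀ i, ∃ s : Multiset ℂ, s.card = (rowClass κ t x.1 i).card ∧
      ∀ j < (rowClass κ t x.1 i).card, s.esymm (j + 1) = τ i j := by
    intro i
    set d := (rowClass κ t x.1 i).card with hd
    -- The prescribed Taylor coefficients, with signs, are the lower coefficients of a monic
    -- polynomial of degree `d`; its `d` roots have them as elementary symmetric functions.
    let q : ℂ[X] := ∑ j : Fin d, C ((-1) ^ (j + 1 : ℕ) * τ i j) * X ^ (d - 1 - j : ℕ)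
    have hqd : q.degree < d := by
      refine mem_degreeLT.1 (Submodule.sum_mem _ fun j _ => mem_degreeLT.2 ?_)
      refine (degree_C_mul_X_pow_le _ _).trans_lt ?_
      have := j.2
      exact_mod_cast (by omega : d - 1 - (j : ℕ) < d)
    have hm : (X ^ d + q).Monic := monic_X_pow_add hqd
    have hdeg : (X ^ d + q).natDegree = d := by
      rw [natDegree_add_eq_left_of_degree_lt (by rwa [degree_X_pow]), natDegree_X_pow]
    have hsplit := IsAlgClosed.splits (X ^ d + q)
    have hcard : Multiset.card (X ^ d + q).roots = d := by
      rw [← hsplit.natDegree_eq_card_roots, hdeg]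
    refine ⟨(X ^ d + q).roots, hcard, fun j hj => ?_⟩
    have hp := hsplit.eq_prod_roots_of_monic hm
    have h1 := Multiset.prod_X_sub_C_coeff (X ^ d + q).roots (k := d - 1 - j) (by omega)
    rw [← hp, hcard, show d - (d - 1 - j) = j + 1 by omega, coeff_add, coeff_X_pow,
      if_neg (by omega), zero_add, finsetSum_coeff, Finset.sum_eq_single ⟨j, hj⟩] at h1
    · rw [coeff_C_mul_X_pow, if_pos rfl] at h1
      exact (mul_left_cancel₀ (pow_ne_zero _ (by norm_num)) h1).symm
    · intro k _ hk
      rw [coeff_C_mul_X_pow, if_neg]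
      have := k.2
      intro h
      exact hk (Fin.ext (by dsimp only; omega))
    · simp
  choose S hScard hS using hroots
  have hτ : ∀ i j, j ∈ rowClass κ t x.1 i → τ j = τ i := by
    intro i j h
    funext k
    rw [mem_rowClass] at h
    simp only [τ, rowSep_eq_iff.2 h]
  obtain ⟨L, hL⟩ : ∃ L : Fin m → List ℂ, ∀ i, (∀ j ∈ rowClass κ t x.1 i, L j = L i) ∧
      (L i).length = (rowClass κ t x.1 i).card ∧
      ∀ j < (rowClass κ t x.1 i).card, Multiset.esymm (L i : Multiset ℂ) (j + 1) = τ i j := by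
    have hne : ∀ i, (rowClass κ t x.1 i).Nonempty := fun i => ⟨i, mem_rowClass.2 (RowRel.refl i)⟩
    -- A representative for each class, so that all rows of a class share one list of roots; each
    -- row then takes the root numbered by its rank.
    let r : Fin m → Fin m := fun i => (rowClass κ t x.1 i).min' (hne i)
    have hr : ∀ i, r i ∈ rowClass κ t x.1 i := fun i => Finset.min'_mem _ _
    refine ⟨fun i => (S (r i)).toList, fun i => ⟨fun j hj => ?_, ?_, fun j hj => ?_⟩⟩
    · have : r j = r i := by simp only [r, rowClass_eq hj]
      simp only [this]
    · rw [Multiset.length_toList, hScard, rowClass_eq (hr i)]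
    · rw [Multiset.coe_toList, hS _ _ (by rwa [rowClass_eq (hr i)]), hτ _ _ (hr i)]
  let y : Filling κ := ⟨fun i s => if s = t then
    (if t < κ i then (L i).getD (rowRank κ t x.1 i) 0 else 0) else x.1 i s, by
      intro i s hs
      dsimp only
      split_ifs with h1 h2
      · omega
      · rfl
      · exact x.2 i s hs⟩
  have hxy : ∀ i, ∀ s < t, x.1 i s = y.1 i s := by
    intro i s hs
    simp only [y, if_neg hs.ne]
  refine ⟨y, hxy, hv, fun i hi j hj => ?_⟩
  rw [← rowClass_congr hxy] at hj
  rw [← rowSep_congr hxy, classEsymm, ← rowClass_congr hxy]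
  have : (rowClass κ t x.1 i).val.map (fun k => y.1 k t) = (L i : Multiset ℂ) := by
    have h1 : (rowClass κ t x.1 i).val.map (fun k => y.1 k t) =
        ((rowClass κ t x.1 i).val.map (rowRank κ t x.1)).map fun k => (L i).getD k 0 := by
      rw [Multiset.map_map]
      refine Multiset.map_congr rfl fun k hk => ?_
      have hk' : k ∈ rowClass κ t x.1 i := hk
      have hκk : t < κ k := by rwa [← (mem_rowClass.1 hk').1]
      simp only [y, if_true, if_pos hκk, (hL i).1 k hk', Function.comp_apply]
    have hbij := rowRank_bijOn κ t x.1 i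
    have h2 : (rowClass κ t x.1 i).val.map (rowRank κ t x.1) =
        Multiset.range (rowClass κ t x.1 i).card := by
      have h3 : (rowClass κ t x.1 i).image (rowRank κ t x.1) =
          Finset.range (rowClass κ t x.1 i).card := by
        apply Finset.coe_injective
        rw [Finset.coe_image]
        exact hbij.image_eq
      rw [← Finset.range_val, ← h3, Finset.image_val_of_injOn hbij.2.1]
    rw [h1, h2, ← (hL i).2.1]
    have h4 : (L i) = (List.range (L i).length).map fun k => (L i).getD k 0 := by
      apply List.ext_getElem
      · simp
      · intro n h1 h2
        simp [h1]
    conv_rhs => rw [h4]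
    rfl
  rw [this, (hL i).2.2 j hj]

/-- The map recording the interpolation polynomials of all columns. -/
noncomputable def encode {κ : Fin m → ℕ} (hκ : Antitone κ) (x : Filling κ) : Filling κ :=
  ⟨fun i t => hermiteCoeff κ t x.1 i, fun i t => (encodes_hermiteCoeff hκ t x.1).1 i⟩

theorem encode_smul {κ : Fin m → ℕ} (hκ : Antitone κ) (σ : rowStab κ) (x : Filling κ) :
    encode hκ (σ • x) = encode hκ x := by
  apply Subtype.ext
  funext i t
  exact congrFun (hermiteCoeff_comp hκ (σ⁻¹).2 t x.1) i

/-- Columns are realized successively: `Encodes` for column `s` involves only the columns up to `s`,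
so prescribing a later column does not disturb it. -/
theorem encode_surjective {κ : Fin m → ℕ} (hκ : Antitone κ) :
    Function.Surjective (encode hκ) := by
  intro b
  have key : ∀ t, ∃ x : Filling κ, ∀ s < t, Encodes κ s x.1 fun i => b.1 i s := by
    intro t
    induction t with
    | zero => exact ⟨b, fun s hs => absurd hs (Nat.not_lt_zero s)⟩
    | succ t ih =>
      obtain ⟨x, hx⟩ := ih
      obtain ⟨y, hxy, hy⟩ := exists_column t x (v := fun i => b.1 i t) fun i hi => b.2 i t hi
      refine ⟨y, fun s hs => ?_⟩
      rcases Nat.lt_succ_iff_lt_or_eq.1 hs with hs | rfl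
      · exact (hx s hs).congr fun i s' hs' => hxy i s' (by omega)
      · exact hy
  obtain ⟨x, hx⟩ := key (Finset.univ.sup κ)
  refine ⟨x, Subtype.ext ?_⟩
  funext i t
  by_cases ht : t < Finset.univ.sup κ
  · exact congrFun ((encodes_hermiteCoeff hκ t x.1).unique hκ (hx t ht)) i
  · have : κ i ≤ t := (Finset.le_sup (Finset.mem_univ i)).trans (not_lt.1 ht)
    rw [b.2 i t this, (encode hκ x).2 i t this]

end Hermite

/-! ### Pullback of functions -/

section Precomp

variable {D D' : Type}

/-- Composition with a map, as a homomorphism of algebras of functions. -/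
def precomp (Ψ : D → D') : (D' → ℂ) →ₐ[ℂ] (D → ℂ) where
  toFun f := f ∘ Ψ
  map_one' := rfl
  map_mul' _ _ := rfl
  map_zero' := rfl
  map_add' _ _ := rfl
  commutes' _ := rfl

theorem precomp_apply (Ψ : D → D') (f : D' → ℂ) : precomp Ψ f = f ∘ Ψ :=
  rfl

theorem precomp_injective {Ψ : D → D'} (h : Function.Surjective Ψ) :
    Function.Injective (precomp Ψ) := by
  intro f g hfg
  ext y
  obtain ⟨x, rfl⟩ := h y
  exact congrFun hfg x

/-- Pointwise inversion commutes with pullback, so the pullbacks of the closure form an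
inversion-closed algebra. In particular, whatever is built from pulled back functions factors
through `Ψ`. -/
theorem invClosure_image_le (Ψ : D → D') (R : Set (D' → ℂ)) :
    invClosure (precomp Ψ '' R) ≤ (invClosure R).map (precomp Ψ) := by
  refine invClosure_le ?_ ?_
  · rintro _ ⟨f, hf, rfl⟩
    exact ⟨f, subset_invClosure R hf, rfl⟩
  · rintro _ ⟨f, hf, rfl⟩
    exact ⟨f⁻¹, invClosed_invClosure R f hf, rfl⟩

theorem invClosure_mono {R R' : Set (D → ℂ)} (h : R ⊆ R') : invClosure R ≤ invClosure R' :=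
  invClosure_le (h.trans (subset_invClosure R')) (invClosed_invClosure R')

end Precomp

/-! ### Newton's identities -/

section Newton

theorem sum_pow_eq_esymm {ι : Type} (s : Finset ι) (f : ι → ℂ) {k : ℕ} (hk : 0 < k) :
    ∑ i ∈ s, f i ^ k = (-1) ^ (k + 1) * k * (s.val.map f).esymm k -
      ∑ a ∈ Finset.HasAntidiagonal.antidiagonal k with a.1 ∈ Set.Ioo 0 k,
        (-1) ^ a.1 * (s.val.map f).esymm a.1 * ∑ i ∈ s, f i ^ a.2 := by
  classical
  have h := congrArg (MvPolynomial.aeval fun i : s => f i)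
    (MvPolynomial.psum_eq_mul_esymm_sub_sum s ℂ k hk)
  have he : ∀ n, MvPolynomial.aeval (fun i : s => f i) (MvPolynomial.esymm s ℂ n) =
      (s.val.map f).esymm n := by
    intro n
    rw [MvPolynomial.aeval_esymm_eq_multiset_esymm]
    congr 1
    change Multiset.map (f ∘ Subtype.val) (Finset.univ : Finset s).val = _
    rw [← Multiset.map_map, ← Finset.attach_eq_univ, Finset.attach_val, Multiset.attach_map_val]
  have hp : ∀ n, MvPolynomial.aeval (fun i : s => f i) (MvPolynomial.psum s ℂ n) =
      ∑ i ∈ s, f i ^ n := by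
    intro n
    rw [MvPolynomial.psum, map_sum]
    simp only [map_pow, MvPolynomial.aeval_X]
    exact Finset.sum_coe_sort s fun i => f i ^ n
  simpa only [map_sub, map_mul, map_pow, map_neg, map_one, map_natCast, map_sum, he, hp] using h

end Newton

/-! ### Invariant polynomials and their recovery from the encoding -/

section Algebras

variable {m : ℕ}

/-- The functions invariant under the permutations of the rows of equal length. -/
def invariantFun (κ : Fin m → ℕ) : Subalgebra ℂ (Filling κ → ℂ) where
  carrier := {f | ∀ (σ : rowStab κ) x, f (σ • x) = f x}
  mul_mem' hf hg σ x := by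
    rw [Pi.mul_apply, Pi.mul_apply, hf, hg]
  add_mem' hf hg σ x := by
    rw [Pi.add_apply, Pi.add_apply, hf, hg]
  algebraMap_mem' _ _ _ := rfl

theorem invClosed_invariantFun (κ : Fin m → ℕ) : InvClosed (invariantFun κ) := by
  intro f hf σ x
  rw [Pi.inv_apply, Pi.inv_apply, hf σ x]

/-- The polynomial functions. -/
def polyFun (κ : Fin m → ℕ) : Subalgebra ℂ (Filling κ → ℂ) :=
  Algebra.adjoin ℂ (columnFun κ (Finset.univ.sup κ))

theorem columnFun_subset_polyFun (κ : Fin m → ℕ) (t : ℕ) : columnFun κ t ⊆ polyFun κ := by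
  rintro _ ⟨i, s, -, rfl⟩
  by_cases hs : s < Finset.univ.sup κ
  · exact Algebra.subset_adjoin ⟨i, s, hs, rfl⟩
  · have : fillingCoord κ i s = 0 := by
      funext x
      exact x.2 i s ((Finset.le_sup (Finset.mem_univ i)).trans (not_lt.1 hs))
    rw [this]
    exact (polyFun κ).zero_mem

theorem fillingCoord_mem (κ : Fin m → ℕ) (i : Fin m) (s : ℕ) : fillingCoord κ i s ∈ polyFun κ :=
  columnFun_subset_polyFun κ (s + 1) ⟨i, s, Nat.lt_succ_self s, rfl⟩

/-- The invariant polynomial functions. -/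
def invPolyFun (κ : Fin m → ℕ) : Subalgebra ℂ (Filling κ → ℂ) :=
  polyFun κ ⊓ invariantFun κ

theorem polyFun_fg (κ : Fin m → ℕ) : (polyFun κ).FG := by
  refine Subalgebra.fg_def.2 ⟨_, ?_, rfl⟩
  refine ((Set.finite_univ (α := Fin m)).prod (Set.finite_lt_nat (Finset.univ.sup κ))).image
    (fun p => fillingCoord κ p.1 p.2) |>.subset ?_
  rintro _ ⟨i, s, hs, rfl⟩
  exact ⟨(i, s), ⟨trivial, hs⟩, rfl⟩

/-- The transfer from functions to invariant functions. -/
noncomputable def symSum (κ : Fin m → ℕ) : (Filling κ → ℂ) →ₗ[ℂ] (Filling κ → ℂ) :=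
  ∑ σ : rowStab κ, (precomp (fun x => σ • x)).toLinearMap

theorem symSum_apply (κ : Fin m → ℕ) (f : Filling κ → ℂ) (x : Filling κ) :
    symSum κ f x = ∑ σ : rowStab κ, f (σ • x) := by
  simp [symSum, precomp_apply]

theorem symSum_mem_invariantFun (κ : Fin m → ℕ) (f : Filling κ → ℂ) :
    symSum κ f ∈ invariantFun κ := by
  intro τ x
  rw [symSum_apply, symSum_apply]
  refine Fintype.sum_equiv (Equiv.mulRight τ) _ _ fun σ => ?_
  rw [Equiv.coe_mulRight, mul_smul]

theorem symSum_mul {κ : Fin m → ℕ} {e : Filling κ → ℂ} (he : e ∈ invariantFun κ)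
    (f : Filling κ → ℂ) : symSum κ (e * f) = e * symSum κ f := by
  ext x
  rw [Pi.mul_apply, symSum_apply, symSum_apply, Finset.mul_sum]
  refine Finset.sum_congr rfl fun σ _ => ?_
  rw [Pi.mul_apply, he]

/-- An invariant function is its own average, and the group order is invertible in `ℂ`. -/
theorem mem_of_symSum_mem {κ : Fin m → ℕ} {E : Subalgebra ℂ (Filling κ → ℂ)} {f : Filling κ → ℂ}
    (hf : f ∈ invariantFun κ) (h : symSum κ f ∈ E) : f ∈ E := by
  have h0 : (Fintype.card (rowStab κ) : ℂ) ≠ 0 := by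
    exact_mod_cast Fintype.card_ne_zero
  have : f = (Fintype.card (rowStab κ) : ℂ)⁻¹ • symSum κ f := by
    ext x
    rw [Pi.smul_apply, symSum_apply, Finset.sum_congr rfl fun σ _ => hf σ x, Finset.sum_const,
      Finset.card_univ, nsmul_eq_mul, smul_eq_mul, inv_mul_cancel_left₀ h0]
  rw [this]
  exact E.smul_mem h _

theorem precomp_smul_mem_adjoin {κ : Fin m → ℕ} {R : Set (Filling κ → ℂ)}
    (hR : ∀ f ∈ R, ∀ σ : rowStab κ, precomp (fun x => σ • x) f ∈ R) {f : Filling κ → ℂ}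
    (hf : f ∈ Algebra.adjoin ℂ R) (σ : rowStab κ) :
    precomp (fun x => σ • x) f ∈ Algebra.adjoin ℂ R := by
  have : Algebra.adjoin ℂ R ≤ (Algebra.adjoin ℂ R).comap (precomp fun x => σ • x) :=
    Algebra.adjoin_le fun f hf => Algebra.subset_adjoin (hR f hf σ)
  exact this hf

theorem precomp_smul_mem_columnFun {κ : Fin m → ℕ} {t : ℕ} {f : Filling κ → ℂ}
    (hf : f ∈ columnFun κ t) (σ : rowStab κ) : precomp (fun x => σ • x) f ∈ columnFun κ t := by
  obtain ⟨i, s, hs, rfl⟩ := hf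
  exact ⟨σ⁻¹.1 i, s, hs, rfl⟩

theorem precomp_smul_mem_polyFun {κ : Fin m → ℕ} {f : Filling κ → ℂ} (hf : f ∈ polyFun κ)
    (σ : rowStab κ) : precomp (fun x => σ • x) f ∈ polyFun κ :=
  precomp_smul_mem_adjoin (fun _ hf σ => precomp_smul_mem_columnFun hf σ) hf σ

theorem symSum_mem_invPolyFun {κ : Fin m → ℕ} {f : Filling κ → ℂ} (hf : f ∈ polyFun κ) :
    symSum κ f ∈ invPolyFun κ := by
  refine ⟨?_, symSum_mem_invariantFun κ f⟩
  rw [symSum, LinearMap.sum_apply]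
  exact (polyFun κ).sum_mem fun σ _ => precomp_smul_mem_polyFun hf σ

/-- The monomials in the first `t` columns. -/
def columnMonomial (κ : Fin m → ℕ) (t : ℕ) (α : Fin m → ℕ → ℕ) : Filling κ → ℂ :=
  fun x => ∏ k, ∏ s ∈ Finset.range t, x.1 k s ^ α k s

theorem columnMonomial_mul (κ : Fin m → ℕ) (t : ℕ) (α β : Fin m → ℕ → ℕ) :
    columnMonomial κ t α * columnMonomial κ t β = columnMonomial κ t (α + β) := by
  ext x
  simp only [columnMonomial, Pi.mul_apply, Pi.add_apply, pow_add, Finset.prod_mul_distrib]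

theorem columnMonomial_mem (κ : Fin m → ℕ) (t : ℕ) (α : Fin m → ℕ → ℕ) :
    columnMonomial κ t α ∈ Algebra.adjoin ℂ (columnFun κ t) :=
  prod_mem_apply fun k _ => prod_mem_apply fun s hs => (Algebra.adjoin ℂ (columnFun κ t)).pow_mem
    (Algebra.subset_adjoin ⟨k, s, Finset.mem_range.1 hs, rfl⟩) _

section Extension

variable {κ : Fin m → ℕ} {t : ℕ} {E : Subalgebra ℂ (Filling κ → ℂ)}

/-- The adjoined algebra is spanned over `E` by the column monomials, and `symSum` is linear over
the invariant functions. -/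
theorem symSum_mem_of_mem_adjoin (hE : E ≤ invariantFun κ)
    (hmono : ∀ α, symSum κ (columnMonomial κ t α) ∈ E) {f : Filling κ → ℂ}
    (hf : f ∈ Algebra.adjoin ℂ ((E : Set (Filling κ → ℂ)) ∪ columnFun κ t)) : symSum κ f ∈ E := by
  classical
  let M : Set (Filling κ → ℂ) := {f | ∃ e ∈ E, ∃ α, f = e * columnMonomial κ t α}
  have h1 : ∀ e ∈ E, e ∈ Submodule.span ℂ M := fun e he =>
    Submodule.subset_span ⟨e, he, 0, by ext x; simp [columnMonomial]⟩
  have hspan : f ∈ Submodule.span ℂ M := by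
    induction hf using Algebra.adjoin_induction with
    | mem f hf =>
      rcases hf with hf | ⟨i, s, hs, rfl⟩
      · exact h1 f hf
      · refine Submodule.subset_span ⟨1, E.one_mem, Pi.single i (Pi.single s 1), ?_⟩
        ext x
        rw [one_mul, columnMonomial, Finset.prod_eq_single i, Finset.prod_eq_single s]
        · simp [fillingCoord]
        · intro s' _ hs'
          simp [hs']
        · exact fun h => absurd (Finset.mem_range.2 hs) h
        · intro i' _ hi'
          simp [hi']
        · simp
    | algebraMap c => exact h1 _ (E.algebraMap_mem c)
    | add f g _ _ hf hg => exact Submodule.add_mem _ hf hg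
    | mul f g _ _ hf hg =>
      have : Submodule.span ℂ M * Submodule.span ℂ M ≤ Submodule.span ℂ M := by
        rw [Submodule.span_mul_span]
        refine Submodule.span_mono ?_
        rintro _ ⟨_, ⟨e, he, α, rfl⟩, _, ⟨e', he', α', rfl⟩, rfl⟩
        refine ⟨e * e', E.mul_mem he he', α + α', ?_⟩
        rw [← columnMonomial_mul]
        beta_reduce
        ring
      exact this (Submodule.mul_mem_mul hf hg)
  have hle : Submodule.span ℂ M ≤ E.toSubmodule.comap (symSum κ) := by
    refine Submodule.span_le.2 ?_
    rintro _ ⟨e, he, α, rfl⟩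
    change symSum κ _ ∈ E
    rw [symSum_mul (hE he)]
    exact E.mul_mem he (hmono α)
  exact hle hspan

/-- By averaging, the invariants of the larger algebra lie in `E`, so it is integral over `E`.
Within it the individual coordinates may enter any definable construction. -/
theorem invClosed_adjoin_columnFun (hE : E ≤ invariantFun κ) (hEi : InvClosed E)
    (hmono : ∀ α, symSum κ (columnMonomial κ t α) ∈ E) :
    InvClosed (Algebra.adjoin ℂ ((E : Set (Filling κ → ℂ)) ∪ columnFun κ t)) := by
  refine invClosed_of_invariants_le (G := rowStab κ) hEi
    (fun f hf => Algebra.subset_adjoin (Or.inl hf)) (fun f hf σ => ?_)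
    fun f hf hinv => mem_of_symSum_mem hinv (symSum_mem_of_mem_adjoin hE hmono hf)
  refine precomp_smul_mem_adjoin (fun f hf σ => ?_) hf σ
  rcases hf with hf | hf
  · have : precomp (fun x => σ • x) f = f := funext fun x => hE hf σ x
    rw [this]
    exact Or.inl hf
  · exact Or.inr (precomp_smul_mem_columnFun hf σ)

end Extension

section Encode

variable {κ : Fin m → ℕ} {t : ℕ} {E : Subalgebra ℂ (Filling κ → ℂ)}

theorem rowClass_card_mem (hE : InvClosed E) (ht : columnFun κ t ⊆ E) (i : Fin m) :
    (fun x : Filling κ => ((rowClass κ t x.1 i).card : ℂ)) ∈ E := by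
  classical
  exact card_filter_mem (P := fun j (x : Filling κ) => RowRel κ t x.1 i j)
    fun j => definableIn_rowRel hE ht i j

theorem rowRank_mem (hE : InvClosed E) (ht : columnFun κ t ⊆ E) (i : Fin m) :
    (fun x : Filling κ => (rowRank κ t x.1 i : ℂ)) ∈ E := by
  classical
  simp only [rowRank, rowClass, Finset.filter_filter]
  exact card_filter_mem (P := fun j (x : Filling κ) => RowRel κ t x.1 i j ∧ j < i)
    fun j => (definableIn_rowRel hE ht i j).and (definableIn_const _)

theorem classEsymm_mem (hE : InvClosed E) (ht : columnFun κ (t + 1) ⊆ E) (i : Fin m) (k : ℕ) :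
    (fun x : Filling κ => classEsymm κ t x.1 i k) ∈ E := by
  classical
  have ht' := (columnFun_mono (Nat.le_succ t)).trans ht
  have h : (fun x : Filling κ => ∑ S ∈ Finset.powersetCard k (Finset.univ : Finset (Fin m)),
      if ∀ j ∈ S, RowRel κ t x.1 i j then ∏ j ∈ S, x.1 j t else 0) ∈ E := by
    refine sum_mem_apply fun S _ => DefinableIn.ite
      (DefinableIn.forall_mem S fun j _ => definableIn_rowRel hE ht' i j) ?_ (const_mem 0)
    exact prod_mem_apply fun j _ => ht ⟨j, t, Nat.lt_succ_self t, rfl⟩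
  convert h using 2 with x
  rw [classEsymm, Finset.esymm_map_val, ← Finset.sum_filter]
  refine Finset.sum_congr ?_ fun _ _ => rfl
  ext S
  simp only [Finset.mem_powersetCard, Finset.mem_filter, Finset.subset_iff, mem_rowClass,
    Finset.mem_univ, implies_true, true_and]
  exact and_comm

theorem rowRank_le (x : Fin m → ℕ → ℂ) (i : Fin m) : rowRank κ t x i ≤ m := by
  rw [rowRank]
  exact (Finset.card_le_univ _).trans (by simp)

theorem hermiteCoeff_mem (hE : InvClosed E) (ht : columnFun κ (t + 1) ⊆ E) (i : Fin m) :
    (fun x : Filling κ => hermiteCoeff κ t x.1 i) ∈ E := by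
  have ht' := (columnFun_mono (Nat.le_succ t)).trans ht
  have hrank := fun i r => definableIn_natCast hE (rowRank_mem hE ht' i) r
  refine inv_mulVec_mem hE (fun i e => ?_) (fun i => ?_) i
  · simp only [hermiteMatrix, Matrix.of_apply]
    by_cases hi : t < κ i
    · simp only [if_pos hi]
      exact comp_nat_mem (hrank i) (fun x => rowRank_le x.1 i)
        (φ := fun r x => ((e : ℕ).choose r : ℂ) * rowSep κ t x.1 i ^ ((e : ℕ) - r)) fun r =>
        E.mul_mem (const_mem _) (E.pow_mem (rowSep_mem hE ht' i) _)
    · simp only [if_neg hi]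
      exact const_mem _
  · simp only [hermiteData]
    by_cases hi : t < κ i
    · simp only [if_pos hi]
      exact comp_nat_mem (hrank i) (fun x => rowRank_le x.1 i)
        (φ := fun r x => classEsymm κ t x.1 i (r + 1)) fun r => classEsymm_mem hE ht i _
    · simp only [if_neg hi]
      exact const_mem _

/-- The functions of the first columns that are needed for multisymmetric power sums. -/
def rowMonomials (κ : Fin m → ℕ) (t : ℕ) : Set (Fin m → Filling κ → ℂ) :=
  {φ | ∃ (w : ℕ → ℂ) (α : ℕ → ℕ), φ = fun i x => w (κ i) * ∏ s ∈ Finset.range t, x.1 i s ^ α s}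

theorem mul_mem_rowMonomials : ∀ φ ∈ rowMonomials κ t, ∀ ψ ∈ rowMonomials κ t,
    φ * ψ ∈ rowMonomials κ t := by
  rintro _ ⟨w, α, rfl⟩ _ ⟨w', α', rfl⟩
  refine ⟨w * w', α + α', ?_⟩
  ext i x
  simp only [Pi.mul_apply, Pi.add_apply, pow_add, Finset.prod_mul_distrib]
  ring

/-- The weight `w` serves to insert the indicator of `κ i = κ k`: in the sum over all permutations
only those in `rowStab κ` survive. -/
theorem symSum_columnMonomial_mem (h : ∀ φ ∈ rowMonomials κ t, ∑ i, φ i ∈ E) (α : Fin m → ℕ → ℕ) :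
    symSum κ (columnMonomial κ t α) ∈ E := by
  classical
  let φ : Fin m → Fin m → Filling κ → ℂ := fun k i x =>
    (if κ i = κ k then 1 else 0) * ∏ s ∈ Finset.range t, x.1 i s ^ α k s
  have h1 := sum_perm_prod_mem E.toSubring (rowMonomials κ t) mul_mem_rowMonomials h φ fun k =>
    ⟨fun n => if n = κ k then 1 else 0, α k, rfl⟩
  have h2 : symSum κ (columnMonomial κ t α) =
      ∑ σ : Equiv.Perm (Fin m), ∏ k, φ k (σ k) := by
    ext x
    rw [symSum_apply, Finset.sum_apply]
    have h3 : ∀ σ : Equiv.Perm (Fin m), (∏ k, φ k (σ k)) x =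
        if σ ∈ rowStab κ then ∏ k, ∏ s ∈ Finset.range t, x.1 (σ k) s ^ α k s else 0 := by
      intro σ
      rw [Finset.prod_apply]
      split_ifs with hσ
      · refine Finset.prod_congr rfl fun k _ => ?_
        simp only [φ, if_pos (hσ k), one_mul]
      · rw [mem_rowStab] at hσ
        push Not at hσ
        obtain ⟨k, hk⟩ := hσ
        refine Finset.prod_eq_zero (Finset.mem_univ k) ?_
        simp only [φ, if_neg hk, zero_mul]
    simp only [h3]
    rw [← Finset.sum_filter, Finset.sum_subtype (p := (· ∈ rowStab κ)) _ (by simp)]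
    refine Fintype.sum_equiv (Equiv.inv _) _ _ fun σ => ?_
    rfl
  rw [h2]
  exact h1

/-- Lets `y` enter only through its sums over classes, which the encoding determines when `y` is a
power of column `t`. -/
theorem sum_mul_eq_sum_class (x : Fin m → ℕ → ℂ) (g y : Fin m → ℂ)
    (hg : ∀ i j, RowRel κ t x i j → g i = g j) :
    ∑ i, g i * y i =
      ∑ i, g i * ((∑ j ∈ rowClass κ t x i, y j) * ((rowClass κ t x i).card : ℂ)⁻¹) := by
  classical
  have h : ∀ i, g i * ((∑ j ∈ rowClass κ t x i, y j) * ((rowClass κ t x i).card : ℂ)⁻¹) =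
      ∑ j, if j ∈ rowClass κ t x i then g j * y j * ((rowClass κ t x j).card : ℂ)⁻¹ else 0 := by
    intro i
    rw [Finset.sum_ite_mem, Finset.univ_inter, Finset.sum_mul, Finset.mul_sum]
    refine Finset.sum_congr rfl fun j hj => ?_
    rw [rowClass_eq hj, hg i j (mem_rowClass.1 hj)]
    ring
  rw [Finset.sum_congr rfl fun i _ => h i, Finset.sum_comm]
  refine Finset.sum_congr rfl fun j _ => ?_
  have h' : ∀ i, (j ∈ rowClass κ t x i) ↔ i ∈ rowClass κ t x j := fun i => by
    rw [mem_rowClass, mem_rowClass]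
    exact ⟨RowRel.symm, RowRel.symm⟩
  simp only [h']
  rw [Finset.sum_ite_mem, Finset.univ_inter, Finset.sum_const, nsmul_eq_mul]
  have h0 : ((rowClass κ t x j).card : ℂ) ≠ 0 := by
    exact_mod_cast (Finset.card_pos.2 ⟨j, mem_rowClass.2 (RowRel.refl j)⟩).ne'
  field_simp

/-- For `k` below the size of the class this is a Taylor coefficient of the encoding polynomial, and
otherwise it is zero. The size varies with `x`, but the case distinction is definable. -/
theorem classEsymm_succ_mem (hκ : Antitone κ) (hE : InvClosed E) (ht : columnFun κ t ⊆ E)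
    (hc : ∀ i, (fun x : Filling κ => (encode hκ x).1 i t) ∈ E) {i : Fin m} (hi : t < κ i) (k : ℕ) :
    (fun x : Filling κ => classEsymm κ t x.1 i (k + 1)) ∈ E := by
  classical
  have hcard := fun r => definableIn_natCast hE (rowClass_card_mem hE ht i) r
  have h : (fun x : Filling κ => if ∀ r ∈ Finset.range (k + 1), ¬ (rowClass κ t x.1 i).card = r then
      ∑ e : Fin m, ((e : ℕ).choose k : ℂ) * rowSep κ t x.1 i ^ ((e : ℕ) - k) * (encode hκ x).1 e t
      else 0) ∈ E := by
    refine DefinableIn.ite (DefinableIn.forall_mem _ fun r _ => (hcard r).not) ?_ (const_mem 0)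
    exact sum_mem_apply fun e _ => E.mul_mem (E.mul_mem (const_mem _)
      (E.pow_mem (rowSep_mem hE ht i) _)) (hc e)
  convert h using 2 with x
  split_ifs with hk
  · have hlt : k < (rowClass κ t x.1 i).card := by
      by_contra hlt
      exact hk _ (Finset.mem_range.2 (by omega)) rfl
    rw [← (encodes_hermiteCoeff hκ t x.1).2 i hi k hlt, taylor_coeff_polyOfCoeff]
    rfl
  · push Not at hk
    obtain ⟨r, hr, hkr⟩ := hk
    have hlt : (rowClass κ t x.1 i).card < k + 1 := hkr ▸ Finset.mem_range.1 hr
    rw [classEsymm, Finset.esymm_map_val, Finset.powersetCard_eq_empty.2 hlt, Finset.sum_empty]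

theorem classPowerSum_mem (hκ : Antitone κ) (hE : InvClosed E) (ht : columnFun κ t ⊆ E)
    (hc : ∀ i, (fun x : Filling κ => (encode hκ x).1 i t) ∈ E) (i : Fin m) (k : ℕ) :
    (fun x : Filling κ => ∑ j ∈ rowClass κ t x.1 i, x.1 j t ^ k) ∈ E := by
  by_cases hi : t < κ i
  · induction k using Nat.strong_induction_on with
    | _ k ih =>
      rcases Nat.eq_zero_or_pos k with rfl | hk
      · simpa using rowClass_card_mem hE ht i
      · have he : ∀ n, 0 < n → (fun x : Filling κ =>
            ((rowClass κ t x.1 i).val.map fun j => x.1 j t).esymm n) ∈ E := by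
          intro n hn
          obtain ⟨n, rfl⟩ := Nat.exists_eq_succ_of_ne_zero hn.ne'
          exact classEsymm_succ_mem hκ hE ht hc hi n
        simp only [sum_pow_eq_esymm _ _ hk]
        refine E.sub_mem (E.mul_mem (const_mem _) (he k hk)) (sum_mem_apply fun a ha => ?_)
        rw [Finset.mem_filter, Finset.HasAntidiagonal.mem_antidiagonal, Set.mem_Ioo] at ha
        exact E.mul_mem (E.mul_mem (const_mem _) (he _ ha.2.1)) (ih a.2 (by omega))
  · have : (fun x : Filling κ => ∑ j ∈ rowClass κ t x.1 i, x.1 j t ^ k) =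
        fun x : Filling κ => ((rowClass κ t x.1 i).card : ℂ) * 0 ^ k := by
      funext x
      rw [Finset.sum_congr rfl fun j hj => by
        rw [x.2 j t (by rw [← (mem_rowClass.1 hj).1]; exact not_lt.1 hi)], Finset.sum_const,
        nsmul_eq_mul]
    rw [this]
    exact E.mul_mem (rowClass_card_mem hE ht i) (const_mem _)

/-- Power sums in the first `t` columns yield all symmetrized monomials in them, so these columns
can be adjoined to `E` without losing inversion-closedness. In the larger algebra the classes are
definable, and the class power sums of column `t` are decoded by Newton's identities. This gives the
power sums in `t + 1` columns, which are invariant and return to `E` by averaging. -/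
theorem sum_rowMonomials_mem (hκ : Antitone κ) (hE : InvClosed E) (hinv : E ≤ invariantFun κ)
    (hc : ∀ i t, (fun x : Filling κ => (encode hκ x).1 i t) ∈ E) (t : ℕ) :
    ∀ φ ∈ rowMonomials κ t, ∑ i, φ i ∈ E := by
  induction t with
  | zero =>
    rintro _ ⟨w, α, rfl⟩
    refine E.sum_mem fun i _ => ?_
    simpa using const_mem (w (κ i))
  | succ t ih =>
    have hmono := symSum_columnMonomial_mem ih
    set B := Algebra.adjoin ℂ ((E : Set (Filling κ → ℂ)) ∪ columnFun κ t) with hB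
    have hBi : InvClosed B := invClosed_adjoin_columnFun hinv hE hmono
    have hEB : E ≤ B := fun f hf => Algebra.subset_adjoin (Or.inl hf)
    have ht : columnFun κ t ⊆ B := fun f hf => Algebra.subset_adjoin (Or.inr hf)
    rintro _ ⟨w, α, rfl⟩
    refine mem_of_symSum_mem ?_ (symSum_mem_of_mem_adjoin hinv hmono ?_)
    · intro σ x
      rw [Finset.sum_apply, Finset.sum_apply]
      refine Fintype.sum_equiv σ⁻¹.1 _ _ fun i => ?_
      rw [σ⁻¹.2 i]
      rfl
    · have h : (fun x : Filling κ => ∑ i, w (κ i) * (∏ s ∈ Finset.range t, x.1 i s ^ α s) *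
          ((∑ j ∈ rowClass κ t x.1 i, x.1 j t ^ α t) *
            ((rowClass κ t x.1 i).card : ℂ)⁻¹)) ∈ B := by
        refine sum_mem_apply fun i _ => B.mul_mem (B.mul_mem (const_mem _) ?_) (B.mul_mem
          (classPowerSum_mem hκ hBi ht (fun i => hEB (hc i t)) i _)
          (hBi _ (rowClass_card_mem hBi ht i)))
        exact prod_mem_apply fun s hs => B.pow_mem (ht ⟨i, s, Finset.mem_range.1 hs, rfl⟩) _
      convert h using 1
      ext x
      rw [Finset.sum_apply, ← sum_mul_eq_sum_class x.1 (t := t) (κ := κ)]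
      · refine Finset.sum_congr rfl fun i _ => ?_
        rw [Finset.prod_range_succ]
        ring
      · intro i j hij
        rw [hij.1, Finset.prod_congr rfl fun s hs => by rw [hij.2 s (Finset.mem_range.1 hs)]]

end Encode

end Algebras

/-! ### The coordinate algebra of the quotient, transported by the encoding -/

section EncodedAlgebra

variable {m : ℕ} {κ : Fin m → ℕ}

theorem exists_polyFun_separating (x : Filling κ) (S : Finset (Filling κ)) (hx : x ∉ S) :
    ∃ h ∈ polyFun κ, h x = 1 ∧ ∀ y ∈ S, h y = 0 := by
  classical
  have key : ∀ y : Filling κ, y ≠ x → ∃ h ∈ polyFun κ, h x = 1 ∧ h y = 0 := by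
    intro y hy
    obtain ⟨i, s, his⟩ : ∃ i s, y.1 i s ≠ x.1 i s := by
      by_contra! hne
      exact hy (Subtype.ext (funext fun i => funext fun s => hne i s))
    refine ⟨fun z => (z.1 i s - y.1 i s) * (x.1 i s - y.1 i s)⁻¹,
      (polyFun κ).mul_mem ((polyFun κ).sub_mem (fillingCoord_mem κ i s) (const_mem _))
        (const_mem _), ?_, ?_⟩
    · exact mul_inv_cancel₀ (sub_ne_zero.2 his.symm)
    · simp
  induction S using Finset.induction_on with
  | empty => exact ⟨1, (polyFun κ).one_mem, rfl, by simp⟩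
  | insert y S _ ih =>
    obtain ⟨h, hh, hhx, hhS⟩ := ih fun hxS => hx (Finset.mem_insert_of_mem hxS)
    obtain ⟨g, hg, hgx, hgy⟩ := key y fun hy => hx (hy ▸ Finset.mem_insert_self _ _)
    refine ⟨h * g, (polyFun κ).mul_mem hh hg, by simp [hhx, hgx], fun z hz => ?_⟩
    rcases Finset.mem_insert.1 hz with rfl | hz
    · simp [hgy]
    · simp [hhS z hz]

theorem columnMonomial_mem_polyFun (t : ℕ) (α : Fin m → ℕ → ℕ) :
    columnMonomial κ t α ∈ polyFun κ :=
  Algebra.adjoin_le (columnFun_subset_polyFun κ t) (columnMonomial_mem κ t α)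

theorem polyFun_le_adjoin (E : Subalgebra ℂ (Filling κ → ℂ)) :
    polyFun κ ≤ Algebra.adjoin ℂ ((E : Set (Filling κ → ℂ)) ∪
      columnFun κ (Finset.univ.sup κ)) :=
  Algebra.adjoin_mono Set.subset_union_right

theorem invClosure_invPolyFun_le : invClosure (invPolyFun κ : Set _) ≤ invariantFun κ :=
  invClosure_le (fun _ hf => hf.2) (invClosed_invariantFun κ)

/-- Invariant functions obtained from polynomials by inversions can be obtained from invariant
polynomials by inversions. -/
theorem mem_invClosure_invPolyFun {f : Filling κ → ℂ} (hf : f ∈ invClosure (polyFun κ : Set _))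
    (hinv : f ∈ invariantFun κ) : f ∈ invClosure (invPolyFun κ : Set _) := by
  set E := invClosure (invPolyFun κ : Set (Filling κ → ℂ)) with hE
  have hmono : ∀ α, symSum κ (columnMonomial κ (Finset.univ.sup κ) α) ∈ E := fun α =>
    subset_invClosure _ (symSum_mem_invPolyFun (columnMonomial_mem_polyFun _ α))
  -- Adjoining the coordinates to `E` gives an inversion-closed algebra containing `polyFun κ`,
  -- hence `f`; averaging brings the invariant `f` back to `E`.
  have hB := invClosed_adjoin_columnFun invClosure_invPolyFun_le (invClosed_invClosure _) hmono
  exact mem_of_symSum_mem hinv (symSum_mem_of_mem_adjoin invClosure_invPolyFun_le hmono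
    (invClosure_le (polyFun_le_adjoin E) hB hf))

variable (hκ : Antitone κ)

/-- The coordinates of the encoding. -/
def encodeCoord : Set (Filling κ → ℂ) :=
  precomp (encode hκ) '' (polyFun κ : Set (Filling κ → ℂ))

theorem encodeCoord_subset : encodeCoord hκ ⊆ invClosure (polyFun κ : Set (Filling κ → ℂ)) := by
  rintro _ ⟨f, hf, rfl⟩
  have : polyFun κ ≤ (invClosure (polyFun κ : Set _)).comap (precomp (encode hκ)) := by
    refine Algebra.adjoin_le ?_
    rintro _ ⟨i, s, -, rfl⟩
    exact hermiteCoeff_mem (invClosed_invClosure _)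
      ((columnFun_subset_polyFun κ (s + 1)).trans (subset_invClosure _)) i
  exact this hf

theorem encodeCoord_subset_invariantFun : encodeCoord hκ ⊆ invariantFun κ := by
  rintro _ ⟨f, -, rfl⟩ σ x
  rw [precomp_apply, Function.comp_apply, Function.comp_apply, encode_smul]

theorem invPolyFun_le_invClosure_encodeCoord : invPolyFun κ ≤ invClosure (encodeCoord hκ) := by
  rintro f ⟨hf, hinv⟩
  have hE : invClosure (encodeCoord hκ) ≤ invariantFun κ :=
    invClosure_le (encodeCoord_subset_invariantFun hκ) (invClosed_invariantFun κ)
  have h := sum_rowMonomials_mem hκ (invClosed_invClosure _) hE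
    (fun i t => subset_invClosure _ ⟨_, fillingCoord_mem κ i t, rfl⟩) (Finset.univ.sup κ)
  exact mem_of_symSum_mem hinv (symSum_mem_of_mem_adjoin hE (symSum_columnMonomial_mem h)
    (polyFun_le_adjoin _ hf))

/-- The fibres of the encoding are the orbits. -/
theorem encode_eq_iff {x y : Filling κ} :
    encode hκ x = encode hκ y ↔ ∃ σ : rowStab κ, y = σ • x := by
  classical
  constructor
  · intro hxy
    by_contra! hne
    obtain ⟨h, hh, hhy, hhx⟩ := exists_polyFun_separating y
      (Finset.univ.image fun σ : rowStab κ => σ • x) (by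
        rw [Finset.mem_image]
        rintro ⟨σ, -, hσ⟩
        exact hne σ hσ.symm)
    -- An invariant polynomial with value 1 at `x` and 0 at `y`. Invariant polynomials factor
    -- through `encode`, which contradicts `hxy`.
    let f : Filling κ → ℂ := ∏ σ : rowStab κ, precomp (fun z => σ • z) (1 - h)
    have hf : f ∈ invPolyFun κ := by
      constructor
      · exact (polyFun κ).prod_mem fun σ _ => precomp_smul_mem_polyFun
          ((polyFun κ).sub_mem (polyFun κ).one_mem hh) σ
      · intro τ z
        simp only [f, Finset.prod_apply]
        refine Fintype.prod_equiv (Equiv.mulRight τ) _ _ fun σ => ?_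
        rw [Equiv.coe_mulRight, precomp_apply, precomp_apply, Function.comp_apply,
          Function.comp_apply, mul_smul]
    obtain ⟨g, -, hg⟩ := invClosure_image_le _ _ (invPolyFun_le_invClosure_encodeCoord hκ hf)
    have h1 : f x = f y := by
      rw [← hg]
      change g (encode hκ x) = g (encode hκ y)
      rw [hxy]
    have h2 : f x = 1 := by
      simp only [f, Finset.prod_apply]
      refine Finset.prod_eq_one fun σ _ => ?_
      rw [precomp_apply, Function.comp_apply, Pi.sub_apply, hhx _
        (Finset.mem_image_of_mem _ (Finset.mem_univ σ)), Pi.one_apply, sub_zero]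
    have h3 : f y = 0 := by
      simp only [f, Finset.prod_apply]
      refine Finset.prod_eq_zero (Finset.mem_univ 1) ?_
      rw [precomp_apply, Function.comp_apply, one_smul, Pi.sub_apply, hhy, Pi.one_apply, sub_self]
    rw [h2, h3] at h1
    exact one_ne_zero h1
  · rintro ⟨σ, rfl⟩
    rw [encode_smul]

/-- The functions whose pullbacks under the encoding are invariant polynomials. -/
noncomputable def encodedFun : Subalgebra ℂ (Filling κ → ℂ) :=
  (invPolyFun κ).comap (precomp (encode hκ))

theorem exists_encodedFun {f : Filling κ → ℂ} (hf : f ∈ invPolyFun κ) :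
    ∃ g ∈ encodedFun hκ, precomp (encode hκ) g = f := by
  obtain ⟨g, -, hg⟩ := invClosure_image_le _ _ (invPolyFun_le_invClosure_encodeCoord hκ hf)
  refine ⟨g, ?_, hg⟩
  change precomp (encode hκ) g ∈ invPolyFun κ
  rwa [show precomp (encode hκ) g = f from hg]

/-- The pullback of `f` is an invariant polynomial, hence arises by inversion from pullbacks of
polynomials; as `encode` is surjective, the same construction carried out below gives `f` itself. -/
theorem encodedFun_le : encodedFun hκ ≤ invClosure (polyFun κ : Set _) := by
  intro f hf
  obtain ⟨g, hg, hgf⟩ := invClosure_image_le _ _ (invPolyFun_le_invClosure_encodeCoord hκ hf)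
  obtain rfl := precomp_injective (encode_surjective hκ) hgf
  exact hg

/-- Pulled back by `encode`, a polynomial becomes an invariant function constructible from
polynomials, hence constructible from invariant polynomials; these are pullbacks from `encodedFun`,
and surjectivity descends the construction. -/
theorem polyFun_le : polyFun κ ≤ invClosure (encodedFun hκ : Set _) := by
  intro f hf
  have h1 : precomp (encode hκ) f ∈ encodeCoord hκ := ⟨f, hf, rfl⟩
  have h2 := mem_invClosure_invPolyFun (encodeCoord_subset hκ h1)
    (encodeCoord_subset_invariantFun hκ h1)
  have h3 : (invPolyFun κ : Set (Filling κ → ℂ)) ⊆ precomp (encode hκ) '' (encodedFun hκ) :=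
    fun f hf => exists_encodedFun hκ hf
  obtain ⟨g, hg, hgf⟩ := invClosure_image_le _ _ (invClosure_mono h3 h2)
  obtain rfl := precomp_injective (encode_surjective hκ) hgf
  exact hg

/-- Noether's finiteness argument: `polyFun κ` is integral and of finite type, hence finite, over
the invariants, and the Artin–Tate lemma applies. -/
theorem invPolyFun_fg (κ : Fin m → ℕ) : (invPolyFun κ).FG := by
  have hle : invPolyFun κ ≤ polyFun κ := inf_le_left
  let _ : Algebra (invPolyFun κ) (polyFun κ) := (Subalgebra.inclusion hle).toAlgebra
  have : IsScalarTower ℂ (invPolyFun κ) (polyFun κ) := IsScalarTower.of_algebraMap_eq fun _ => rfl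
  have : IsScalarTower (invPolyFun κ) (polyFun κ) (Filling κ → ℂ) :=
    IsScalarTower.of_algebraMap_eq fun _ => rfl
  have hft : Algebra.FiniteType ℂ (polyFun κ) :=
    (Subalgebra.fg_iff_finiteType _).1 (polyFun_fg κ)
  have hft' : Algebra.FiniteType (invPolyFun κ) (polyFun κ) :=
    Algebra.FiniteType.of_restrictScalars_finiteType ℂ _ _
  have hint : Algebra.IsIntegral (invPolyFun κ) (polyFun κ) := by
    refine ⟨fun f => ?_⟩
    have := isIntegral_of_invariants_le (G := rowStab κ) (E := invPolyFun κ)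
      (fun f hf σ => precomp_smul_mem_polyFun hf σ) (fun f hf hinv => ⟨hf, hinv⟩) f.2
    exact (isIntegral_algHom_iff (IsScalarTower.toAlgHom (invPolyFun κ) (polyFun κ)
      (Filling κ → ℂ)) Subtype.val_injective).1 this
  have hfin : Module.Finite (invPolyFun κ) (polyFun κ) := Algebra.IsIntegral.finite
  have h := fg_of_fg_of_fg ℂ (invPolyFun κ) (polyFun κ) hft.1 hfin.1
    (Subalgebra.inclusion_injective hle)
  exact (Subalgebra.fg_iff_finiteType _).2 ⟨h⟩

theorem encodedFun_fg : (encodedFun hκ).FG := by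
  refine Subalgebra.fg_of_fg_map _ _ (precomp_injective (encode_surjective hκ)) ?_
  have : (encodedFun hκ).map (precomp (encode hκ)) = invPolyFun κ :=
    le_antisymm (by rintro _ ⟨f, hf, rfl⟩; exact hf) fun f hf => exists_encodedFun hκ hf
  rw [this]
  exact invPolyFun_fg κ

end EncodedAlgebra

/-! ### Regular functions on quotients of sets of affine points -/

section AffineQuotient

variable {I C Y : Type} {ι : C → I → ℂ} {π : C → Y}

/-- The structure on `Y` induced by a map to it from a set of points of an affine space. -/
abbrev affineQuotient (ι : C → I → ℂ) (π : C → Y) : SpaceWithFunctions Y :=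
  ((affineSpace I).induced ι).quotient π

theorem quotient_quotient {X X' X'' : Type} (s : SpaceWithFunctions X) (f : X → X')
    (g : X' → X'') : (s.quotient f).quotient g = s.quotient (g ∘ f) := by
  unfold SpaceWithFunctions.quotient
  simp only [coinduced_compose]
  rfl

theorem isOpen_setOf_eval_ne_zero (q : MvPolynomial I ℂ) :
    IsOpen[(affineSpace I).top] {z | MvPolynomial.eval z q ≠ 0} :=
  fun _ hx => ⟨q, hx, fun _ h => h⟩

theorem isOpen_affineQuotient {W : Set Y} {q : MvPolynomial I ℂ}
    (h : ∀ v, π v ∈ W ↔ MvPolynomial.eval (ι v) q ≠ 0) : IsOpen[(affineQuotient ι π).top] W :=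
  ⟨_, isOpen_setOf_eval_ne_zero q, by ext v; exact (h v).symm⟩

theorem regular_affineQuotient {W : Set Y} {p q : MvPolynomial I ℂ} {g : Y → ℂ}
    (hW : ∀ v, π v ∈ W → MvPolynomial.eval (ι v) q ≠ 0)
    (hg : ∀ v, π v ∈ W → g (π v) = MvPolynomial.eval (ι v) p / MvPolynomial.eval (ι v) q) :
    (affineQuotient ι π).Regular W g := by
  intro v hv
  exact ⟨_, isOpen_setOf_eval_ne_zero q, hW v hv,
    fun z => MvPolynomial.eval z p / MvPolynomial.eval z q,
    fun x hx => ⟨p, q, hx, fun y _ _ => rfl⟩, fun y hy _ => hg y hy⟩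

/-- A quotient of polynomials that is constant on the fibres of `π` is a regular function. -/
theorem exists_regular_affineQuotient (p q : MvPolynomial I ℂ)
    (h : ∀ v v', π v = π v' → MvPolynomial.eval (ι v) q ≠ 0 → MvPolynomial.eval (ι v') q ≠ 0 ∧
      MvPolynomial.eval (ι v) p / MvPolynomial.eval (ι v) q =
        MvPolynomial.eval (ι v') p / MvPolynomial.eval (ι v') q) :
    ∃ g, (affineQuotient ι π).Regular (π '' {v | MvPolynomial.eval (ι v) q ≠ 0}) g ∧
      ∀ v, g (π v) = MvPolynomial.eval (ι v) p / MvPolynomial.eval (ι v) q := by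
  have hf : Function.FactorsThrough
      (fun v => MvPolynomial.eval (ι v) p / MvPolynomial.eval (ι v) q) π := by
    intro v v' hvv
    beta_reduce
    by_cases hv : MvPolynomial.eval (ι v) q = 0
    · by_cases hv' : MvPolynomial.eval (ι v') q = 0
      · rw [hv, hv', div_zero, div_zero]
      · exact absurd hv (h v' v hvv.symm hv').1
    · exact (h v v' hvv hv).2
  refine ⟨Function.extend π _ 0, ?_, fun v => hf.extend_apply 0 v⟩
  refine regular_affineQuotient (p := p) (q := q) ?_ fun v _ => hf.extend_apply 0 v
  rintro v ⟨v', hv', hvv⟩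
  exact (h v' v hvv hv').1

theorem isOpen_image_affineQuotient (q : MvPolynomial I ℂ)
    (h : ∀ v v', π v = π v' → MvPolynomial.eval (ι v) q ≠ 0 → MvPolynomial.eval (ι v') q ≠ 0) :
    IsOpen[(affineQuotient ι π).top] (π '' {v | MvPolynomial.eval (ι v) q ≠ 0}) := by
  refine isOpen_affineQuotient (q := q) fun v => ⟨?_, fun hv => ⟨v, hv, rfl⟩⟩
  rintro ⟨v', hv', hvv⟩
  exact h v' v hvv hv'

theorem affineQuotient_pullback {W : Set Y} (hW : IsOpen[(affineQuotient ι π).top] W) {g : Y → ℂ}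
    (hg : (affineQuotient ι π).Regular W g) {v : C} (hv : π v ∈ W) :
    ∃ p q : MvPolynomial I ℂ, MvPolynomial.eval (ι v) q ≠ 0 ∧ ∀ v',
      MvPolynomial.eval (ι v') q ≠ 0 → π v' ∈ W ∧
        g (π v') = MvPolynomial.eval (ι v') p / MvPolynomial.eval (ι v') q := by
  obtain ⟨W', hW', hWW'⟩ := hW
  obtain ⟨W'', hW'', hvW'', g', hg', hgg'⟩ := hg v hv
  have hmem : ∀ v', ι v' ∈ W' ↔ π v' ∈ W := fun v' => Set.ext_iff.1 hWW' v'
  obtain ⟨q₁, hq₁, hqW'⟩ := hW' (ι v) ((hmem v).2 hv)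
  obtain ⟨q₂, hq₂, hqW''⟩ := hW'' (ι v) hvW''
  obtain ⟨p, q, hq, hpq⟩ := hg' (ι v) hvW''
  -- The factors `q₁` and `q₂` make nonvanishing of the single denominator imply membership in both
  -- neighbourhoods.
  refine ⟨p * (q₁ * q₂), q * (q₁ * q₂), ?_, fun v' hv' => ?_⟩
  · rw [map_mul, map_mul]
    exact mul_ne_zero hq (mul_ne_zero hq₁ hq₂)
  · rw [map_mul, map_mul] at hv'
    have h0 := left_ne_zero_of_mul hv'
    have h1 := left_ne_zero_of_mul (right_ne_zero_of_mul hv')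
    have h2 := right_ne_zero_of_mul (right_ne_zero_of_mul hv')
    have hvW : π v' ∈ W := (hmem v').1 (hqW' _ h1)
    have := hgg' v' hvW (hqW'' _ h2)
    rw [Function.comp_apply] at this
    refine ⟨hvW, ?_⟩
    rw [this, hpq _ (hqW'' _ h2) h0]
    simp only [map_mul]
    rw [mul_div_mul_right _ _ (mul_ne_zero h1 h2)]

variable {D : Type} {A : Subalgebra ℂ (D → ℂ)} {c : D → C}

theorem eval_comp_mem (hc : ∀ k, (fun x => ι (c x) k) ∈ A) (p : MvPolynomial I ℂ) :
    (fun x => MvPolynomial.eval (ι (c x)) p) ∈ A := by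
  induction p using MvPolynomial.induction_on with
  | C a => simpa using const_mem a
  | add p q hp hq =>
    simp only [map_add]
    exact A.add_mem hp hq
  | mul_X p k hp =>
    simp only [map_mul, MvPolynomial.eval_X]
    exact A.mul_mem hp (hc k)

theorem pullback_of_section (hc : ∀ k, (fun x => ι (c x) k) ∈ A) {W : Set Y}
    (hW : IsOpen[(affineQuotient ι π).top] W) {g : Y → ℂ}
    (hg : (affineQuotient ι π).Regular W g) {x : D} (hx : π (c x) ∈ W) :
    ∃ p ∈ A, ∃ q ∈ A, q x ≠ 0 ∧ ∀ x', q x' ≠ 0 →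
      π (c x') ∈ W ∧ g (π (c x')) = p x' / q x' := by
  obtain ⟨p, q, hq, hpq⟩ := affineQuotient_pullback hW hg hx
  exact ⟨_, eval_comp_mem hc p, _, eval_comp_mem hc q, hq, fun x' hx' => hpq _ hx'⟩

end AffineQuotient

theorem extend_adjoin {D Y : Type} {s : SpaceWithFunctions Y} {η : D → Y} {W : Set Y}
    (hW : IsOpen[s.top] W) {R : Set (D → ℂ)}
    (hR : ∀ a ∈ R, ∃ g, s.Regular W g ∧ ∀ x, g (η x) = a x) {a : D → ℂ}
    (ha : a ∈ Algebra.adjoin ℂ R) : ∃ g, s.Regular W g ∧ ∀ x, g (η x) = a x := by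
  induction ha using Algebra.adjoin_induction with
  | mem a ha => exact hR a ha
  | algebraMap c => exact ⟨_, s.regular_const c hW, fun x => rfl⟩
  | add a b _ _ iha ihb =>
    obtain ⟨g, hg, hga⟩ := iha
    obtain ⟨g', hg', hgb⟩ := ihb
    exact ⟨_, s.regular_add hW hg hg', fun x => by rw [hga, hgb]; rfl⟩
  | mul a b _ _ iha ihb =>
    obtain ⟨g, hg, hga⟩ := iha
    obtain ⟨g', hg', hgb⟩ := ihb
    exact ⟨_, s.regular_mul hW hg hg', fun x => by rw [hga, hgb]; rfl⟩

/-! ### Affine space as a chart of projective space -/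

section Projective

variable {m : ℕ}

/-- Polynomial functions on fillings come from an open affine subspace of a projective space. -/
theorem exists_isEmb_projectiveSpace (κ : Fin m → ℕ) :
    ∃ (n : ℕ) (η : Filling κ → Proj (Fin (n + 1) → ℂ)),
      IsEmb (projectiveSpace n) (polyFun κ) η := by
  let ix := {p : Fin m × Fin (Finset.univ.sup κ) // (p.2 : ℕ) < κ p.1}
  let e : Fin (Fintype.card ix) ≃ ix := (Fintype.equivFin ix).symm
  let n := Fintype.card ix
  let co : Filling κ → Fin (n + 1) → ℂ := fun x =>
    Fin.cons 1 fun k => x.1 (e k).1.1 ((e k).1.2 : ℕ)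
  have hco0 : ∀ x, co x 0 = 1 := fun x => rfl
  have hcos : ∀ x k, co x (Fin.succ k) = x.1 (e k).1.1 ((e k).1.2 : ℕ) := fun x k => rfl
  have hcoe : ∀ i s (hs : s < κ i), ∃ k : Fin n, ∀ x : Filling κ, co x k.succ = x.1 i s := by
    intro i s hs
    have hs' : s < Finset.univ.sup κ := hs.trans_le (Finset.le_sup (Finset.mem_univ i))
    refine ⟨e.symm ⟨(i, ⟨s, hs'⟩), hs⟩, fun x => ?_⟩
    rw [hcos, Equiv.apply_symm_apply]
  have hne : ∀ x, co x ≠ 0 := fun x h => one_ne_zero ((hco0 x).symm.trans (congrFun h 0))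
  let c : Filling κ → {v : Fin (n + 1) → ℂ | v ≠ 0} := fun x => ⟨co x, hne x⟩
  let π : {v : Fin (n + 1) → ℂ | v ≠ 0} → Proj (Fin (n + 1) → ℂ) :=
    fun v => Projectivization.mk ℂ v.1 v.2
  let ι : {v : Fin (n + 1) → ℂ | v ≠ 0} → Fin (n + 1) → ℂ := Subtype.val
  have hratio : ∀ k v v', π v = π v' → MvPolynomial.eval (ι v) (MvPolynomial.X 0) ≠ 0 →
      MvPolynomial.eval (ι v') (MvPolynomial.X 0) ≠ 0 ∧
      MvPolynomial.eval (ι v) (MvPolynomial.X k) / MvPolynomial.eval (ι v) (MvPolynomial.X 0) =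
        MvPolynomial.eval (ι v') (MvPolynomial.X k) /
          MvPolynomial.eval (ι v') (MvPolynomial.X 0) := by
    intro k v v' hvv hv
    obtain ⟨a, ha⟩ := (Projectivization.mk_eq_mk_iff ℂ v.1 v'.1 v.2 v'.2).1 hvv
    simp only [MvPolynomial.eval_X, ι, ← ha, Pi.smul_apply, Units.smul_def, smul_eq_mul] at hv ⊢
    exact ⟨right_ne_zero_of_mul hv, mul_div_mul_left _ _ a.ne_zero⟩
  have hopen := isOpen_image_affineQuotient (ι := ι) (π := π) (MvPolynomial.X 0)
    fun v v' hvv hv => (hratio 0 v v' hvv hv).1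
  have hmem : ∀ x, π (c x) ∈ π '' {v | MvPolynomial.eval (ι v) (MvPolynomial.X 0) ≠ 0} := by
    intro x
    refine ⟨c x, ?_, rfl⟩
    simp [ι, c, hco0]
  have hreg : ∀ k, ∃ g, (affineQuotient ι π).Regular
      (π '' {v | MvPolynomial.eval (ι v) (MvPolynomial.X 0) ≠ 0}) g ∧
      ∀ x, g (π (c x)) = co x k := by
    intro k
    obtain ⟨g, hg, hgv⟩ := exists_regular_affineQuotient _ _ (hratio k)
    refine ⟨g, hg, fun x => ?_⟩
    rw [hgv, MvPolynomial.eval_X, MvPolynomial.eval_X]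
    exact div_one _
  refine ⟨n, fun x => π (c x), ?_, ?_, ?_, ?_⟩
  · intro x y hxy
    apply Subtype.ext
    funext i s
    by_cases hs : s < κ i
    · obtain ⟨k, hk⟩ := hcoe i s hs
      obtain ⟨g, -, hg⟩ := hreg k.succ
      rw [← hk, ← hk, ← hg, ← hg]
      exact congrArg g hxy
    · rw [x.2 i s (not_lt.1 hs), y.2 i s (not_lt.1 hs)]
  -- The image is the whole open chart on which the coordinate number `0` is nonzero.
  · have hrange : Set.range (fun x => π (c x)) =
        π '' {v | MvPolynomial.eval (ι v) (MvPolynomial.X 0) ≠ 0} := by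
      refine Set.Subset.antisymm (Set.range_subset_iff.2 hmem) ?_
      rintro _ ⟨v, hv, rfl⟩
      rw [Set.mem_ofPred_eq, MvPolynomial.eval_X] at hv
      classical
      let x : Filling κ := ⟨fun i s => if h : s < κ i then
        v.1 (Fin.succ (e.symm ⟨(i, ⟨s, h.trans_le (Finset.le_sup (Finset.mem_univ i))⟩), h⟩)) *
          (v.1 0)⁻¹ else 0, fun i s hs => dif_neg (not_lt.2 hs)⟩
      refine ⟨x, ?_⟩
      refine (Projectivization.mk_eq_mk_iff' ℂ _ _ _ _).2 ⟨(v.1 0)⁻¹, ?_⟩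
      funext k
      refine Fin.cases ?_ (fun k => ?_) k
      · rw [Pi.smul_apply, smul_eq_mul]
        exact (inv_mul_cancel₀ hv).trans (hco0 x).symm
      · rw [Pi.smul_apply, smul_eq_mul]
        refine Eq.trans ?_ (hcos x k).symm
        have hk : ((e k).1.2 : ℕ) < κ (e k).1.1 := (e k).2
        simp only [x, dif_pos hk, Fin.eta, Prod.mk.eta, Subtype.coe_eta, Equiv.symm_apply_apply]
        exact mul_comm _ _
    rw [hrange]
    let _ := (projectiveSpace n).top
    exact IsOpen.isLocallyClosed (X := Proj (Fin (n + 1) → ℂ)) hopen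
  · intro a ha x
    obtain ⟨g, hg, hga⟩ := extend_adjoin (η := fun x => π (c x)) hopen (by
      rintro _ ⟨i, s, -, rfl⟩
      by_cases hs : s < κ i
      · obtain ⟨k, hk⟩ := hcoe i s hs
        obtain ⟨g, hg, hgk⟩ := hreg k.succ
        exact ⟨g, hg, fun x => (hgk x).trans (hk x)⟩
      · exact ⟨_, (affineQuotient ι π).regular_const 0 hopen,
          fun x => (x.2 i s (not_lt.1 hs)).symm⟩) ha
    exact ⟨_, hopen, hmem x, g, hg, fun x' _ => hga x'⟩
  · intro W hW g hg x hx
    refine pullback_of_section (ι := ι) (π := π) (c := c) (fun k => ?_) hW hg hx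
    refine Fin.cases ?_ (fun k => ?_) k
    · exact const_mem 1
    · exact fillingCoord_mem κ _ _

end Projective

/-! ### Schubert cells and reduced echelon matrices -/

section DualFamily

variable {ι V : Type} [Fintype ι] [DecidableEq ι] [AddCommGroup V] [Module ℂ V] {r : ι → V}
  {l : ι → V →ₗ[ℂ] ℂ}

theorem eq_sum_of_mem_span_of_dual (h : ∀ i k, l k (r i) = if i = k then 1 else 0) {w : V}
    (hw : w ∈ Submodule.span ℂ (Set.range r)) : w = ∑ k, l k w • r k := by
  obtain ⟨c, rfl⟩ := (Submodule.mem_span_range_iff_exists_fun ℂ).1 hw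
  refine Finset.sum_congr rfl fun k _ => ?_
  simp [map_sum, h]

theorem linearIndependent_of_dual (h : ∀ i k, l k (r i) = if i = k then 1 else 0) :
    LinearIndependent ℂ r := by
  refine Fintype.linearIndependent_iff.2 fun c hc k => ?_
  have := congrArg (l k) hc
  simpa [map_sum, h] using this

end DualFamily

theorem extendZero_apply (n : ℕ) (v : Fin n → ℂ) (k : ℕ) :
    extendZero n v k = if h : k < n then v ⟨k, h⟩ else 0 := by
  have h0 : extendZero n v = Finsupp.mapDomain Fin.val
      ((Finsupp.linearEquivFunOnFinite ℂ ℂ (Fin n)).symm v) := rfl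
  rw [h0]
  split_ifs with h
  · exact Finsupp.mapDomain_apply Fin.val_injective _ (⟨k, h⟩ : Fin n)
  · refine Finsupp.mapDomain_of_notMem_range _ k ?_
    rintro ⟨i, rfl⟩
    exact h i.2

section Schubert

variable {m : ℕ} {κ : Fin m → ℕ} (hκ : Antitone κ)

/-- The pivot of the row `i` of an echelon matrix with rows of `κ i` free entries. -/
def pivot (κ : Fin m → ℕ) (i : Fin m) : ℕ := κ i + (m - 1 - i)

include hκ in
theorem pivot_strictAnti : StrictAnti (pivot κ) := by
  intro i j hij
  have h1 := hκ hij.le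
  have h2 : (i : ℕ) < j := hij
  have h3 := j.2
  simp only [pivot]
  omega

/-- The positions of the free entries of a row. -/
def freeSet (κ : Fin m → ℕ) (i : Fin m) : Finset ℕ :=
  (Finset.range (pivot κ i)).filter fun j => ∀ k, j ≠ pivot κ k

theorem mem_freeSet {i : Fin m} {j : ℕ} :
    j ∈ freeSet κ i ↔ j < pivot κ i ∧ ∀ k, j ≠ pivot κ k := by
  rw [freeSet, Finset.mem_filter, Finset.mem_range]

include hκ in
theorem card_freeSet (i : Fin m) : (freeSet κ i).card = κ i := by
  have hp := pivot_strictAnti hκ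
  -- The pivots decrease, so those below the pivot of row `i` belong to the `m - 1 - i` later rows;
  -- the shift in `pivot` makes up for exactly these.
  have h : freeSet κ i = Finset.range (pivot κ i) \ (Finset.Ioi i).image (pivot κ) := by
    ext j
    simp only [mem_freeSet, Finset.mem_sdiff, Finset.mem_range, Finset.mem_image, Finset.mem_Ioi]
    refine and_congr_right fun hj => ?_
    constructor
    · rintro h ⟨k, -, rfl⟩
      exact h k rfl
    · rintro h k rfl
      exact h ⟨k, hp.lt_iff_gt.1 hj, rfl⟩
  have hsub : (Finset.Ioi i).image (pivot κ) ⊆ Finset.range (pivot κ i) := by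
    intro j hj
    obtain ⟨k, hk, rfl⟩ := Finset.mem_image.1 hj
    exact Finset.mem_range.2 (hp (Finset.mem_Ioi.1 hk))
  rw [h, Finset.card_sdiff_of_subset hsub, Finset.card_image_of_injective _ hp.injective,
    Finset.card_range, Fin.card_Ioi, pivot]
  omega

include hκ in
theorem exists_freePos : ∃ f g : Fin m → ℕ → ℕ,
    (∀ i, ∀ s < κ i, f i s ∈ freeSet κ i ∧ g i (f i s) = s) ∧
      ∀ i, ∀ j ∈ freeSet κ i, g i j < κ i ∧ f i (g i j) = j := by
  classical
  let e : ∀ i, freeSet κ i ≃ Fin (κ i) := fun i => Finset.equivFinOfCardEq (card_freeSet hκ i)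
  refine ⟨fun i s => if h : s < κ i then (e i).symm ⟨s, h⟩ else 0,
    fun i j => if h : j ∈ freeSet κ i then e i ⟨j, h⟩ else 0, fun i s hs => ?_, fun i j hj => ?_⟩
  · simp only [dif_pos hs]
    exact ⟨((e i).symm _).2, by rw [dif_pos ((e i).symm _).2]; simp⟩
  · simp only [dif_pos hj, Fin.is_lt, true_and, dif_pos, Fin.eta, Equiv.symm_apply_apply]

/-- The position of the free entry number `s` in the row `i`. -/
noncomputable def freePos : Fin m → ℕ → ℕ := (exists_freePos hκ).choose

/-- The number of the free entry at the position `j` in the row `i`. -/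
noncomputable def freeIdx : Fin m → ℕ → ℕ := (exists_freePos hκ).choose_spec.choose

theorem freePos_spec {i : Fin m} {s : ℕ} (hs : s < κ i) :
    freePos hκ i s ∈ freeSet κ i ∧ freeIdx hκ i (freePos hκ i s) = s :=
  (exists_freePos hκ).choose_spec.choose_spec.1 i s hs

theorem freeIdx_spec {i : Fin m} {j : ℕ} (hj : j ∈ freeSet κ i) :
    freeIdx hκ i j < κ i ∧ freePos hκ i (freeIdx hκ i j) = j :=
  (exists_freePos hκ).choose_spec.choose_spec.2 i j hj

/-- The entries of the reduced echelon matrix with given free entries. -/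
noncomputable def echelon (x : Filling κ) (i : Fin m) (j : ℕ) : ℂ :=
  if j = pivot κ i then 1 else if j ∈ freeSet κ i then x.1 i (freeIdx hκ i j) else 0

theorem echelon_pivot (x : Filling κ) (i k : Fin m) :
    echelon hκ x i (pivot κ k) = if i = k then 1 else 0 := by
  rw [echelon]
  by_cases hik : i = k
  · subst hik
    simp
  · rw [if_neg fun h => hik ((pivot_strictAnti hκ).injective h).symm, if_neg hik, if_neg]
    exact fun h => (mem_freeSet.1 h).2 k rfl

theorem echelon_of_lt (x : Filling κ) {i : Fin m} {j : ℕ} (hj : pivot κ i < j) :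
    echelon hκ x i j = 0 := by
  rw [echelon, if_neg hj.ne', if_neg]
  exact fun h => absurd (mem_freeSet.1 h).1 hj.le.not_gt

theorem echelon_freePos (x : Filling κ) {i : Fin m} {s : ℕ} (hs : s < κ i) :
    echelon hκ x i (freePos hκ i s) = x.1 i s := by
  obtain ⟨h1, h2⟩ := freePos_spec hκ hs
  rw [echelon, if_neg (mem_freeSet.1 h1).1.ne, if_pos h1, h2]

theorem exists_echelon_eq {u : Fin m → ℕ → ℂ}
    (hp : ∀ i k, u i (pivot κ k) = if i = k then 1 else 0)
    (hlt : ∀ i j, pivot κ i < j → u i j = 0) : ∃ x : Filling κ, ∀ i j, echelon hκ x i j = u i j := by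
  refine ⟨⟨fun i s => if s < κ i then u i (freePos hκ i s) else 0,
    fun i s hs => if_neg (not_lt.2 hs)⟩, fun i j => ?_⟩
  unfold echelon
  split_ifs with h1 h2
  · rw [h1, hp, if_pos rfl]
  · obtain ⟨h3, h4⟩ := freeIdx_spec hκ h2
    dsimp only
    rw [if_pos h3, h4]
  · rcases lt_trichotomy j (pivot κ i) with h | h | h
    · rw [mem_freeSet] at h2
      push Not at h2
      obtain ⟨k, rfl⟩ := h2 h
      rw [hp, if_neg]
      rintro rfl
      exact h1 rfl
    · exact absurd h h1
    · exact (hlt i j h).symm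

/-- The rows of the echelon matrix in `ℂ^N`. -/
noncomputable def echelonRow (N : ℕ) (x : Filling κ) (i : Fin m) : Fin N → ℂ :=
  fun j => echelon hκ x i j

/-- The rows of the echelon matrix in `ℂ^∞`. -/
noncomputable def echelonRowInf (x : Filling κ) (i : Fin m) : CInf :=
  Finsupp.onFinset (Finset.range (pivot κ i + 1)) (echelon hκ x i) fun j hj => by
    rw [Finset.mem_range, Nat.lt_succ_iff]
    by_contra h
    exact hj (echelon_of_lt hκ x (not_le.1 h))

theorem echelonRowInf_apply (x : Filling κ) (i : Fin m) (j : ℕ) :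
    echelonRowInf hκ x i j = echelon hκ x i j :=
  rfl

theorem echelonRowInf_dual (x : Filling κ) (i k : Fin m) :
    Finsupp.lapply (R := ℂ) (pivot κ k) (echelonRowInf hκ x i) = if i = k then 1 else 0 :=
  echelon_pivot hκ x i k

/-- The subspace spanned by the rows of an echelon matrix. -/
noncomputable def schubertCell (x : Filling κ) : Gr m CInf :=
  ⟨Submodule.span ℂ (Set.range (echelonRowInf hκ x)), by
    have hli := linearIndependent_of_dual (l := fun k => Finsupp.lapply (R := ℂ) (pivot κ k))
      (echelonRowInf_dual hκ x)
    rw [rank_span hli, Cardinal.mk_range_eq _ hli.injective]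
    simp⟩

section Level

variable {N : ℕ} (hN : ∀ i, pivot κ i < N)

theorem echelonRow_dual (x : Filling κ) (i k : Fin m) :
    LinearMap.proj (R := ℂ) (φ := fun _ : Fin N => ℂ) ⟨pivot κ k, hN k⟩ (echelonRow hκ N x i) =
      if i = k then 1 else 0 :=
  echelon_pivot hκ x i k

/-- The Schubert cell in a finite Grassmannian, lifted to linearly independent tuples. -/
noncomputable def echelonTuple (x : Filling κ) :
    {v : Fin m → Fin N → ℂ // LinearIndependent ℂ v} :=
  ⟨echelonRow hκ N x, linearIndependent_of_dual
    (l := fun k => LinearMap.proj (R := ℂ) (φ := fun _ : Fin N => ℂ) ⟨pivot κ k, hN k⟩)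
    (echelonRow_dual hκ hN x)⟩

theorem grIncl_echelonTuple (x : Filling κ) :
    grIncl m N (spanGr (echelonTuple hκ hN x)) = schubertCell hκ x := by
  apply Subtype.ext
  change (Submodule.span ℂ (Set.range (echelonRow hκ N x))).map (extendZero N) = _
  rw [Submodule.map_span, ← Set.range_comp]
  have : extendZero N ∘ echelonRow hκ N x = echelonRowInf hκ x := by
    funext i
    ext j
    rw [Function.comp_apply, extendZero_apply, echelonRowInf_apply]
    split_ifs with h
    · rfl
    · exact (echelon_of_lt hκ x ((hN i).trans_le (not_lt.1 h))).symm
  rw [this]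
  rfl

/-- The values of a tuple of vectors at the pivots. -/
def pivotMatrix (v : Fin m → Fin N → ℂ) : Matrix (Fin m) (Fin m) ℂ :=
  Matrix.of fun i k => v i ⟨pivot κ k, hN k⟩

theorem vecMul_pivotMatrix (v : Fin m → Fin N → ℂ) (c : Fin m → ℂ) (k : Fin m) :
    Matrix.vecMul c (pivotMatrix hN v) k = (∑ i, c i • v i) ⟨pivot κ k, hN k⟩ := by
  simp [Matrix.vecMul, dotProduct, pivotMatrix]

/-- Expresses the condition by the span alone, which makes it independent of the basis. -/
theorem pivotMatrix_det_ne_zero_iff {v : Fin m → Fin N → ℂ} (hv : LinearIndependent ℂ v) :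
    (pivotMatrix hN v).det ≠ 0 ↔
      ∀ w ∈ Submodule.span ℂ (Set.range v), (∀ k, w ⟨pivot κ k, hN k⟩ = 0) → w = 0 := by
  constructor
  · intro hdet w hw hw0
    obtain ⟨c, rfl⟩ := (Submodule.mem_span_range_iff_exists_fun ℂ).1 hw
    have hc : Matrix.vecMul c (pivotMatrix hN v) = 0 := by
      funext k
      rw [vecMul_pivotMatrix, hw0 k, Pi.zero_apply]
    have : c = 0 := by
      by_contra hc0
      exact hdet (Matrix.exists_vecMul_eq_zero_iff.1 ⟨c, hc0, hc⟩)
    simp [this]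
  · intro h hdet
    obtain ⟨c, hc0, hc⟩ := Matrix.exists_vecMul_eq_zero_iff.2 hdet
    refine hc0 (funext fun i => Fintype.linearIndependent_iff.1 hv c (h _ ?_ fun k => ?_) i)
    · exact (Submodule.mem_span_range_iff_exists_fun ℂ).2 ⟨c, rfl⟩
    · rw [← vecMul_pivotMatrix, hc, Pi.zero_apply]

/-- The basis of the span of `v` dual to the pivot coordinates. -/
noncomputable def reducedRow (v : Fin m → Fin N → ℂ) (i : Fin m) : Fin N → ℂ :=
  ∑ k, (pivotMatrix hN v)⁻¹ i k • v k

theorem reducedRow_mem (v : Fin m → Fin N → ℂ) (i : Fin m) :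
    reducedRow hN v i ∈ Submodule.span ℂ (Set.range v) :=
  (Submodule.mem_span_range_iff_exists_fun ℂ).2 ⟨_, rfl⟩

theorem reducedRow_pivot {v : Fin m → Fin N → ℂ} (hv : (pivotMatrix hN v).det ≠ 0)
    (i k : Fin m) : reducedRow hN v i ⟨pivot κ k, hN k⟩ = if i = k then 1 else 0 := by
  have h := Matrix.nonsing_inv_mul (pivotMatrix hN v) (isUnit_iff_ne_zero.2 hv)
  have h' := congrFun (congrFun h i) k
  rw [Matrix.one_apply] at h'
  rw [← h', reducedRow, ← vecMul_pivotMatrix]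
  rfl

/-- The determinant of the pivot matrix as a polynomial. -/
noncomputable def pivotDetPoly : MvPolynomial (Fin m × Fin N) ℂ :=
  (Matrix.of fun i k : Fin m => MvPolynomial.X (i, ⟨pivot κ k, hN k⟩)).det

/-- The numerators of the entries of the reduced rows as polynomials. -/
noncomputable def reducedPoly (i : Fin m) (j : Fin N) : MvPolynomial (Fin m × Fin N) ℂ :=
  ∑ k, (Matrix.of fun i k : Fin m => (MvPolynomial.X (i, ⟨pivot κ k, hN k⟩) :
    MvPolynomial (Fin m × Fin N) ℂ)).adjugate i k * MvPolynomial.X (k, j)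

theorem eval_map_pivot (v : Fin m → Fin N → ℂ) :
    (Matrix.of fun i k : Fin m => (MvPolynomial.X (i, ⟨pivot κ k, hN k⟩) :
      MvPolynomial (Fin m × Fin N) ℂ)).map (MvPolynomial.eval fun p => v p.1 p.2) =
      pivotMatrix hN v := by
  ext i k
  simp [pivotMatrix]

theorem eval_pivotDetPoly (v : Fin m → Fin N → ℂ) :
    MvPolynomial.eval (fun p => v p.1 p.2) (pivotDetPoly hN) = (pivotMatrix hN v).det := by
  rw [pivotDetPoly, RingHom.map_det, RingHom.mapMatrix_apply, eval_map_pivot]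

theorem eval_reducedPoly_div (v : Fin m → Fin N → ℂ) (i : Fin m) (j : Fin N) :
    MvPolynomial.eval (fun p => v p.1 p.2) (reducedPoly hN i j) /
      MvPolynomial.eval (fun p => v p.1 p.2) (pivotDetPoly hN) = reducedRow hN v i j := by
  have h := RingHom.map_adjugate (MvPolynomial.eval fun p : Fin m × Fin N => v p.1 p.2)
    (Matrix.of fun i k : Fin m => (MvPolynomial.X (i, ⟨pivot κ k, hN k⟩) :
      MvPolynomial (Fin m × Fin N) ℂ))
  rw [RingHom.mapMatrix_apply, RingHom.mapMatrix_apply, eval_map_pivot] at h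
  have h' : ∀ k, MvPolynomial.eval (fun p : Fin m × Fin N => v p.1 p.2)
      ((Matrix.of fun i k : Fin m => (MvPolynomial.X (i, ⟨pivot κ k, hN k⟩) :
      MvPolynomial (Fin m × Fin N) ℂ)).adjugate i k) = (pivotMatrix hN v).adjugate i k :=
    fun k => congrFun (congrFun h i) k
  rw [eval_pivotDetPoly, reducedPoly, map_sum, reducedRow, Finset.sum_apply, Finset.sum_div]
  refine Finset.sum_congr rfl fun k _ => ?_
  rw [map_mul, h', MvPolynomial.eval_X, Matrix.inv_def, Ring.inverse_eq_inv', Matrix.smul_apply,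
    Pi.smul_apply, smul_eq_mul, smul_eq_mul]
  field_simp

/-- Corresponding reduced rows lie in the same span and agree at the pivots, and on that span a
vector is determined by its pivot coordinates. -/
theorem pivot_invariance {v v' : {v : Fin m → Fin N → ℂ // LinearIndependent ℂ v}}
    (h : spanGr v = spanGr v') (hv : (pivotMatrix hN v.1).det ≠ 0) :
    (pivotMatrix hN v'.1).det ≠ 0 ∧ ∀ i, reducedRow hN v.1 i = reducedRow hN v'.1 i := by
  have hs : Submodule.span ℂ (Set.range v.1) = Submodule.span ℂ (Set.range v'.1) :=
    congrArg Subtype.val h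
  have h0 := (pivotMatrix_det_ne_zero_iff hN v.2).1 hv
  have hv' := (pivotMatrix_det_ne_zero_iff hN v'.2).2 (by rwa [← hs])
  refine ⟨hv', fun i => sub_eq_zero.1 (h0 _ (Submodule.sub_mem _ (reducedRow_mem hN _ i) ?_) ?_)⟩
  · rw [hs]
    exact reducedRow_mem hN _ i
  · intro k
    rw [Pi.sub_apply, reducedRow_pivot hN hv, reducedRow_pivot hN hv', sub_self]

theorem pivotMatrix_echelonTuple (x : Filling κ) :
    pivotMatrix hN (echelonTuple hκ hN x).1 = 1 := by
  ext i k
  rw [Matrix.one_apply]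
  exact echelon_pivot hκ x i k

theorem reducedRow_echelonTuple (x : Filling κ) (i : Fin m) :
    reducedRow hN (echelonTuple hκ hN x).1 i = echelonRow hκ N x i := by
  rw [reducedRow, pivotMatrix_echelonTuple, inv_one]
  simp only [Matrix.one_apply, ite_smul, one_smul, zero_smul, Finset.sum_ite_eq, Finset.mem_univ,
    if_true]
  rfl

/-- The subspaces with nonvanishing determinant of the pivot coordinates. -/
def pivotLocus : Set (Gr m (Fin N → ℂ)) :=
  spanGr '' {v | MvPolynomial.eval (fun p : Fin m × Fin N => v.1 p.1 p.2) (pivotDetPoly hN) ≠ 0}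

theorem isOpen_pivotLocus : IsOpen[(grassmannian m N).top] (pivotLocus hN) :=
  isOpen_image_affineQuotient (pivotDetPoly hN) fun v v' hvv hv => by
    rw [eval_pivotDetPoly] at hv ⊢
    exact (pivot_invariance hN hvv hv).1

theorem exists_regular_reducedRow (i : Fin m) (j : Fin N) :
    ∃ g, (grassmannian m N).Regular (pivotLocus hN) g ∧
      ∀ v, g (spanGr v) = reducedRow hN v.1 i j := by
  obtain ⟨g, hg, hgv⟩ := exists_regular_affineQuotient (ι := fun
    (v : {v : Fin m → Fin N → ℂ // LinearIndependent ℂ v}) (p : Fin m × Fin N) => v.1 p.1 p.2)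
    (π := spanGr) (reducedPoly hN i j) (pivotDetPoly hN) (by
      intro v v' hvv hv
      rw [eval_reducedPoly_div, eval_reducedPoly_div, eval_pivotDetPoly]
      rw [eval_pivotDetPoly] at hv
      obtain ⟨h1, h2⟩ := pivot_invariance hN hvv hv
      exact ⟨h1, by rw [h2]⟩)
  exact ⟨g, hg, fun v => (hgv v).trans (eval_reducedPoly_div hN v.1 i j)⟩

/-- On the open locus of nonvanishing pivot determinant, the reduced rows form an echelon matrix
exactly if their entries to the right of the pivots vanish. These entries are regular functions
there, so the cell is locally closed. -/
theorem range_schubert {g : Fin m → Fin N → Gr m (Fin N → ℂ) → ℂ}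
    (hg : ∀ i j v, g i j (spanGr v) = reducedRow hN v.1 i j) :
    Set.range (fun x => spanGr (echelonTuple hκ hN x)) =
      pivotLocus hN ∩ ⋂ i, ⋂ j : Fin N, ⋂ _ : pivot κ i < j,
        {y | y ∈ pivotLocus hN ∧ g i j y ≠ 0}ᶜ := by
  classical
  ext y
  constructor
  · rintro ⟨x, rfl⟩
    refine ⟨⟨_, ?_, rfl⟩, ?_⟩
    · rw [Set.mem_ofPred_eq, eval_pivotDetPoly, pivotMatrix_echelonTuple, Matrix.det_one]
      exact one_ne_zero
    · simp only [Set.mem_iInter]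
      rintro i j hij ⟨-, h⟩
      rw [hg, reducedRow_echelonTuple] at h
      exact h (echelon_of_lt hκ x hij)
  · rintro ⟨⟨v, hv, rfl⟩, hy⟩
    have hv' := hv
    rw [Set.mem_ofPred_eq, eval_pivotDetPoly] at hv'
    simp only [Set.mem_iInter] at hy
    have hzero : ∀ i (j : Fin N), pivot κ i < j → reducedRow hN v.1 i j = 0 := by
      intro i j hij
      by_contra h
      exact hy i j hij ⟨⟨v, hv, rfl⟩, by rwa [hg]⟩
    obtain ⟨x, hx⟩ := exists_echelon_eq hκ
      (u := fun i j => if h : j < N then reducedRow hN v.1 i ⟨j, h⟩ else 0)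
      (fun i k => by rw [dif_pos (hN k), reducedRow_pivot hN hv'])
      (fun i j hij => by
        split_ifs with h
        · exact hzero i _ hij
        · rfl)
    have hrow : echelonRow hκ N x = reducedRow hN v.1 := by
      funext i j
      rw [echelonRow, hx, dif_pos j.2]
    refine ⟨x, Subtype.ext ?_⟩
    change Submodule.span ℂ (Set.range (echelonRow hκ N x)) = Submodule.span ℂ (Set.range v.1)
    refine Submodule.eq_of_le_of_finrank_eq (Submodule.span_le.2 ?_) ?_
    · rintro _ ⟨i, rfl⟩
      rw [hrow]
      exact reducedRow_mem hN v.1 i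
    · exact (finrank_span_eq_card (echelonTuple hκ hN x).2).trans (finrank_span_eq_card v.2).symm

/-- The free entries extend to entries of the reduced rows, regular on the pivot locus. Conversely
the echelon matrix is a polynomial section of the quotient map, along which regular functions become
quotients of polynomials. -/
theorem isEmb_schubert :
    IsEmb (grassmannian m N) (polyFun κ) (fun x => spanGr (echelonTuple hκ hN x)) := by
  choose g hg hgv using exists_regular_reducedRow (κ := κ) hN
  have hrange := range_schubert hκ hN hgv
  have hcoord : ∀ i s (hs : s < κ i), ∃ j : Fin N, ∀ x : Filling κ,
      g i j (spanGr (echelonTuple hκ hN x)) = x.1 i s := by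
    intro i s hs
    have hj := (mem_freeSet.1 (freePos_spec hκ hs).1).1.trans (hN i)
    refine ⟨⟨freePos hκ i s, hj⟩, fun x => ?_⟩
    rw [hgv, reducedRow_echelonTuple]
    exact echelon_freePos hκ x hs
  refine ⟨?_, ?_, ?_, ?_⟩
  · intro x y hxy
    apply Subtype.ext
    funext i s
    by_cases hs : s < κ i
    · obtain ⟨j, hj⟩ := hcoord i s hs
      rw [← hj, ← hj]
      exact congrArg _ hxy
    · rw [x.2 i s (not_lt.1 hs), y.2 i s (not_lt.1 hs)]
  · rw [hrange]
    let _ := (grassmannian m N).top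
    refine (isOpen_pivotLocus hN).isLocallyClosed.inter (IsClosed.isLocallyClosed ?_)
    refine isClosed_iInter fun i => isClosed_iInter fun j => isClosed_iInter fun _ => ?_
    exact IsOpen.isClosed_compl
      ((grassmannian m N).isOpen_ne_zero (isOpen_pivotLocus hN) (hg i j))
  · intro a ha x
    have hmem := Set.mem_range_self (f := fun x => spanGr (echelonTuple hκ hN x)) x
    rw [hrange] at hmem
    replace hmem := hmem.1
    obtain ⟨f, hf, hfa⟩ := extend_adjoin (η := fun x => spanGr (echelonTuple hκ hN x))
      (isOpen_pivotLocus hN) (by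
        rintro _ ⟨i, s, -, rfl⟩
        by_cases hs : s < κ i
        · obtain ⟨j, hj⟩ := hcoord i s hs
          exact ⟨g i j, hg i j, hj⟩
        · exact ⟨_, (grassmannian m N).regular_const 0 (isOpen_pivotLocus hN),
            fun x => (x.2 i s (not_lt.1 hs)).symm⟩) ha
    exact ⟨_, isOpen_pivotLocus hN, hmem, f, hf, fun x' _ => hfa x'⟩
  · intro W hW f hf x hx
    refine pullback_of_section (ι := fun
      (v : {v : Fin m → Fin N → ℂ // LinearIndependent ℂ v}) (p : Fin m × Fin N) => v.1 p.1 p.2)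
      (π := spanGr) (c := echelonTuple hκ hN) (fun p => ?_) hW hf hx
    change (fun x => echelon hκ x p.1 p.2) ∈ polyFun κ
    simp only [echelon]
    split_ifs
    · exact const_mem 1
    · exact fillingCoord_mem κ _ _
    · exact const_mem 0

end Level

end Schubert

/-! ### Decomposition of the Grassmannian into Schubert cells -/

/-- The positions of the last nonzero entries of the elements of `W`. -/
def leads (W : Submodule ℂ CInf) : Set ℕ := {j | ∃ w ∈ W, w j ≠ 0 ∧ ∀ k, j < k → w k = 0}

theorem exists_last_ne_zero {w : CInf} (hw0 : w ≠ 0) : ∃ j, w j ≠ 0 ∧ ∀ k, j < k → w k = 0 := by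
  have hne : w.support.Nonempty := Finsupp.support_nonempty_iff.2 hw0
  have h1 : w (w.support.max' hne) ≠ 0 := Finsupp.mem_support_iff.1 (Finset.max'_mem _ hne)
  have h2 : ∀ k, w.support.max' hne < k → w k = 0 := by
    intro k hk
    by_contra h
    exact hk.not_ge (Finset.le_max' _ _ (Finsupp.mem_support_iff.2 h))
  exact ⟨_, h1, h2⟩

theorem exists_mem_leads {W : Submodule ℂ CInf} {w : CInf} (hw : w ∈ W) (hw0 : w ≠ 0) :
    ∃ j ∈ leads W, w j ≠ 0 ∧ ∀ k, j < k → w k = 0 := by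
  obtain ⟨j, h1, h2⟩ := exists_last_ne_zero hw0
  exact ⟨j, ⟨w, hw, h1, h2⟩, h1, h2⟩

theorem finrank_eq_and_surjective_of_coordinates {K V L : Type} [Field K] [AddCommGroup V]
    [Module K V] [Module.Finite K V] [Fintype L] (f : V →ₗ[K] (L → K))
    (hf : ∀ w, f w = 0 → w = 0) (hL : Fintype.card L ≤ Module.finrank K V) :
    Module.finrank K V = Fintype.card L ∧ Function.Surjective f := by
  have hinj : Function.Injective f := LinearMap.ker_eq_bot.1 (LinearMap.ker_eq_bot'.2 hf)
  have hcard : Module.finrank K V = Fintype.card L := by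
    refine le_antisymm ?_ hL
    have h := LinearMap.finrank_le_finrank_of_injective hinj
    rwa [Module.finrank_fintype_fun_eq_card] at h
  refine ⟨hcard, (LinearMap.injective_iff_surjective_of_finrank_eq_finrank ?_).1 hinj⟩
  rw [Module.finrank_fintype_fun_eq_card, hcard]

/-- Triangularity: at the largest position whose coefficient is nonzero, no other term of the
relation contributes. -/
theorem linearIndependent_of_lead {S : Finset ℕ} {u : S → CInf} (h : ∀ l, u l l ≠ 0)
    (h' : ∀ (l : S) (k : ℕ), l < k → u l k = 0) : LinearIndependent ℂ u := by
  classical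
  refine Fintype.linearIndependent_iff.2 fun c hc => ?_
  by_contra! hne
  obtain ⟨l, hl, hmax⟩ := (Finset.univ.filter fun l => c l ≠ 0).exists_max_image id
    (by obtain ⟨i, hi⟩ := hne; exact ⟨i, by simpa using hi⟩)
  have hcl : c l ≠ 0 := by simpa using hl
  have h0 := DFunLike.congr_fun hc (l : ℕ)
  rw [Finsupp.finsetSum_apply, Finset.sum_eq_single l] at h0
  · exact mul_ne_zero hcl (h l) (by simpa using h0)
  · intro l' _ hne'
    by_cases hc' : c l' = 0
    · simp [hc']
    · have hlt : l' < l := lt_of_le_of_ne (hmax l' (by simpa using hc')) hne'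
      simp [h' l' l hlt]
  · simp

section

variable {m : ℕ}

theorem finrank_gr {V : Type} [AddCommGroup V] [Module ℂ V] (W : Gr m V) :
    Module.finrank ℂ W.1 = m :=
  Module.finrank_eq_of_rank_eq W.2

theorem finite_gr {V : Type} [AddCommGroup V] [Module ℂ V] (W : Gr m V) :
    Module.Finite ℂ W.1 := by
  have : Module.Free ℂ W.1 := Module.Free.of_divisionRing ℂ W.1
  rw [← Module.rank_lt_aleph0_iff, W.2]
  exact Cardinal.natCast_lt_aleph0

theorem card_le_of_subset_leads (W : Gr m CInf) {S : Finset ℕ} (hS : (S : Set ℕ) ⊆ leads W.1) :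
    S.card ≤ m := by
  have := finite_gr W
  choose u hu hul hu0 using fun l : S => hS l.2
  have hli := linearIndependent_of_lead hul hu0
  have hli' : LinearIndependent ℂ (fun l => (⟨u l, hu l⟩ : W.1)) :=
    LinearIndependent.of_comp W.1.subtype hli
  have := hli'.fintype_card_le_finrank
  rwa [finrank_gr, Fintype.card_coe] at this

/-- The coordinates at the leads are injective on `W`, since a nonzero element does not vanish at
its own lead; as there are at most `m` leads, these coordinates identify `W` with `ℂ^L`. A dual
basis vector vanishes after its index `l`, because its lead lies in `L`, where `l` is its only
nonzero coordinate. -/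
theorem exists_finset_leads (W : Gr m CInf) : ∃ L : Finset ℕ, (L : Set ℕ) = leads W.1 ∧
    L.card = m ∧ ∀ l ∈ L, ∃ u ∈ W.1, (∀ k ∈ L, u k = if l = k then 1 else 0) ∧
      ∀ k, l < k → u k = 0 := by
  classical
  have := finite_gr W
  have hfin : (leads W.1).Finite := by
    by_contra hinf
    obtain ⟨S, hS, hcard⟩ := Set.Infinite.exists_subset_card_eq hinf (m + 1)
    have := card_le_of_subset_leads W hS
    omega
  have hL : (hfin.toFinset : Set ℕ) = leads W.1 := hfin.coe_toFinset
  generalize hfin.toFinset = L at hL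
  let ev : W.1 →ₗ[ℂ] (L → ℂ) := LinearMap.pi fun l => Finsupp.lapply (l : ℕ) ∘ₗ W.1.subtype
  have hev : ∀ w, ev w = 0 → w = 0 := by
    intro w hw
    by_contra hw0
    obtain ⟨j, hj, hwj, -⟩ := exists_mem_leads w.2 fun h => hw0 (Subtype.ext h)
    rw [← hL] at hj
    exact hwj (congrFun hw ⟨j, hj⟩)
  obtain ⟨hcard, hsurj⟩ := finrank_eq_and_surjective_of_coordinates (K := ℂ) (V := W.1) (L := L) ev
    hev (by rw [finrank_gr, Fintype.card_coe]; exact card_le_of_subset_leads W hL.le)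
  replace hcard : L.card = m := by rw [← Fintype.card_coe, ← hcard, finrank_gr]
  refine ⟨L, hL, hcard, fun l hl => ?_⟩
  obtain ⟨u, hu⟩ := hsurj fun k => if l = k then 1 else 0
  have huk : ∀ k ∈ L, u.1 k = if l = k then 1 else 0 := fun k hk => congrFun hu ⟨k, hk⟩
  refine ⟨u.1, u.2, huk, ?_⟩
  have hu0 : u.1 ≠ 0 := by
    intro h
    have := huk l hl
    rw [h, if_pos rfl] at this
    exact zero_ne_one this
  obtain ⟨j, hj, huj, hju⟩ := exists_mem_leads u.2 hu0
  rw [← hL] at hj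
  rw [huk j hj] at huj
  obtain rfl : l = j := by
    by_contra h
    exact huj (if_neg h)
  exact hju

theorem add_sub_le_of_strictAnti {p : Fin m → ℕ} (hp : StrictAnti p) {i j : Fin m} (hij : i ≤ j) :
    p j + (j - i) ≤ p i := by
  obtain ⟨j, hj⟩ := j
  induction j with
  | zero =>
    obtain rfl : i = ⟨0, hj⟩ := le_antisymm hij (Fin.mk_le_of_le_val (Nat.zero_le _))
    simp
  | succ j ih =>
    rcases hij.eq_or_lt with rfl | hlt
    · simp
    · have hle : i ≤ ⟨j, Nat.lt_of_succ_lt hj⟩ := Nat.lt_succ_iff.1 hlt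
      have h1 := ih _ hle
      have h2 : p ⟨j + 1, hj⟩ < p ⟨j, Nat.lt_of_succ_lt hj⟩ := hp (Nat.lt_succ_self j)
      have h3 : (i : ℕ) ≤ j := hle
      simp only at h1 ⊢
      omega

/-- A strictly decreasing family satisfies `p i ≥ m - 1 - i`, so subtracting the staircase is not
truncated. -/
theorem exists_pivot_eq {p : Fin m → ℕ} (hp : StrictAnti p) :
    ∃ κ : Fin m → ℕ, Antitone κ ∧ pivot κ = p := by
  have hlow : ∀ i : Fin m, m - 1 - i ≤ p i := by
    intro i
    have hm := i.2
    have h := add_sub_le_of_strictAnti hp (i := i) (j := ⟨m - 1, by omega⟩)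
      (Fin.le_def.2 (by simp only; omega))
    simp only at h
    omega
  refine ⟨fun i => p i - (m - 1 - i), fun i j hij => ?_, funext fun i => ?_⟩
  · have h := add_sub_le_of_strictAnti hp hij
    have h1 := hlow i
    have h2 := hlow j
    have h3 : (i : ℕ) ≤ j := hij
    have := j.2
    simp only
    omega
  · exact Nat.sub_add_cancel (hlow i)

theorem pivot_injective : Function.Injective (pivot (m := m)) := by
  intro κ κ' h
  funext i
  exact Nat.add_right_cancel (congrFun h i)

variable {κ κ' : Fin m → ℕ} (hκ : Antitone κ) (hκ' : Antitone κ')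

theorem echelonRowInf_mem (x : Filling κ) (i : Fin m) :
    echelonRowInf hκ x i ∈ (schubertCell hκ x).1 :=
  Submodule.subset_span ⟨i, rfl⟩

/-- Recovers the pivots, hence `κ`, from the subspace, so different cells are disjoint. -/
theorem leads_schubertCell (x : Filling κ) : leads (schubertCell hκ x).1 = Set.range (pivot κ) := by
  ext j
  constructor
  · rintro ⟨w, hw, hwj, hw0⟩
    have hsum := eq_sum_of_mem_span_of_dual
      (l := fun k => Finsupp.lapply (R := ℂ) (pivot κ k)) (echelonRowInf_dual hκ x) hw
    have hj : w j = ∑ k, w (pivot κ k) * echelon hκ x k j := by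
      conv_lhs => rw [hsum]
      rw [Finsupp.finsetSum_apply]
      rfl
    rw [hj] at hwj
    obtain ⟨i, -, hi⟩ := Finset.exists_ne_zero_of_sum_ne_zero hwj
    refine ⟨i, le_antisymm ?_ ?_⟩
    · by_contra h
      exact left_ne_zero_of_mul hi (hw0 _ (not_le.1 h))
    · by_contra h
      exact right_ne_zero_of_mul hi (echelon_of_lt hκ x (not_le.1 h))
  · rintro ⟨i, rfl⟩
    refine ⟨_, echelonRowInf_mem hκ x i, ?_, fun k hk => echelon_of_lt hκ x hk⟩
    rw [echelonRowInf_apply, echelon_pivot, if_pos rfl]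
    exact one_ne_zero

include hκ hκ' in
theorem eq_of_range_pivot_eq (h : Set.range (pivot κ) = Set.range (pivot κ')) : κ = κ' := by
  apply pivot_injective
  have h1 := (pivot_strictAnti hκ).dual_right
  have h2 := (pivot_strictAnti hκ').dual_right
  have h3 := (StrictMono.range_inj h1 h2).1 (by rw [Set.range_comp, Set.range_comp, h])
  exact h3

theorem exists_schubertCell_eq (W : Gr m CInf) :
    ∃ (κ : Fin m → ℕ) (hκ : Antitone κ) (x : Filling κ), schubertCell hκ x = W := by
  obtain ⟨L, hL, hcard, hu⟩ := exists_finset_leads W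
  let p : Fin m → ℕ := fun i => L.orderEmbOfFin hcard (Fin.rev i)
  have hp : StrictAnti p := fun i j hij =>
    (L.orderEmbOfFin hcard).strictMono (Fin.rev_lt_rev.2 hij)
  have hpL : ∀ i, p i ∈ L := fun i => L.orderEmbOfFin_mem hcard _
  choose u huW huk hu0 using fun i => hu (p i) (hpL i)
  obtain ⟨κ, hκ, hκp⟩ := exists_pivot_eq hp
  obtain ⟨x, hx⟩ := exists_echelon_eq hκ (u := fun i j => u i j)
    (fun i k => by
      rw [hκp, huk i _ (hpL k)]
      exact if_congr hp.injective.eq_iff rfl rfl)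
    (fun i j hij => hu0 i j (by rwa [hκp] at hij))
  refine ⟨κ, hκ, x, Subtype.ext ?_⟩
  have := finite_gr W
  refine Submodule.eq_of_le_of_finrank_eq (Submodule.span_le.2 ?_) ?_
  · rintro _ ⟨i, rfl⟩
    have : echelonRowInf hκ x i = u i := Finsupp.ext fun j => hx i j
    rw [this]
    exact huW i
  · exact (finrank_gr (schubertCell hκ x)).trans (finrank_gr W).symm

/-- The Grassmannian of `ℂ^∞` with its Schubert cells. -/
theorem isCellFamily_schubert (m : ℕ) :
    IsCellFamily (grassmannianInf m) (fun k : {κ : Fin m → ℕ // Antitone κ} => Filling k.1)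
      (fun k => polyFun k.1) (fun k => schubertCell k.2)
      (fun k => Finset.univ.sup fun i => pivot k.1 i + 1) := by
  refine ⟨?_, ?_, ?_, ?_⟩
  · rintro ⟨κ, hκ⟩ ⟨κ', hκ'⟩ x x' h
    refine Subtype.ext (eq_of_range_pivot_eq hκ hκ' ?_)
    rw [← leads_schubertCell hκ x, ← leads_schubertCell hκ' x']
    exact congrArg (fun W : Gr m CInf => leads W.1) h
  · intro W
    obtain ⟨κ, hκ, x, hx⟩ := exists_schubertCell_eq W
    exact ⟨⟨κ, hκ⟩, x, hx⟩
  · rintro ⟨κ, hκ⟩ N hlevel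
    have hN : ∀ i, pivot κ i < N := fun i => Finset.sup_le_iff.1 hlevel i (Finset.mem_univ i)
    exact ⟨_, grIncl_echelonTuple hκ hN, isEmb_schubert hκ hN⟩
  · rintro ⟨κ, hκ⟩ N x hx
    refine Finset.sup_le fun i _ => ?_
    have h := (mem_range_grIncl m N _).1 hx (echelonRowInf_mem hκ x i)
    by_contra hi
    have h1 := (mem_range_extendZero N _).1 h (pivot κ i)
      (Nat.le_of_lt_succ (not_le.1 hi))
    rw [echelonRowInf_apply, echelon_pivot, if_pos rfl] at h1
    exact one_ne_zero h1

end

/-! ### Cells of the symmetric power -/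

theorem toSym_eq_iff {α : Type} {m : ℕ} {l l' : Fin m → α} :
    toSym l = toSym l' ↔ ∃ σ : Equiv.Perm (Fin m), l' = l ∘ σ := by
  classical
  constructor
  · intro h
    have h' : Finset.univ.val.map l = Finset.univ.val.map l' := congrArg Subtype.val h
    have hcard : ∀ (l : Fin m → α) a,
        Fintype.card {i // l i = a} = (Finset.univ.val.map l).count a := by
      intro l a
      rw [Multiset.count_map, Fintype.card_subtype, Finset.card, Finset.filter_val]
      simp only [eq_comm]
    let e : ∀ a, {i // l' i = a} ≃ {i // l i = a} := fun a =>
      Fintype.equivOfCardEq (by rw [hcard, hcard, h'])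
    exact ⟨Equiv.ofFiberEquiv e, funext fun i => (Equiv.ofFiberEquiv_map e i).symm⟩
  · rintro ⟨σ, rfl⟩
    refine Subtype.ext ?_
    change Finset.univ.val.map l = Finset.univ.val.map (l ∘ σ)
    rw [← Multiset.map_map, Multiset.map_univ_val_equiv]

theorem map_toSym {α β : Type} {m : ℕ} (f : α → β) (l : Fin m → α) :
    (toSym l).map f = toSym (f ∘ l) := by
  refine Sym.coe_injective ?_
  rw [Sym.coe_map]
  exact Multiset.map_map f l Finset.univ.val

theorem exists_toSym_eq {α : Type} {m : ℕ} (z : Sym α m) : ∃ l : Fin m → α, toSym l = z := by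
  obtain ⟨s, hs⟩ := z
  induction s using Quot.inductionOn with
  | h L =>
    obtain rfl : L.length = m := hs
    refine ⟨L.get, Subtype.ext ?_⟩
    change Finset.univ.val.map L.get = (L : Multiset α)
    rw [Fin.univ_val_map, List.ofFn_get]

/-- Both sides have the same sum over `i`, so no inequality is strict. This forces permutations
found through nonvanishing coordinates into `rowStab κ`. -/
theorem eq_comp_of_le_comp {m : ℕ} {κ : Fin m → ℕ} {τ : Equiv.Perm (Fin m)}
    (h : ∀ i, κ i ≤ κ (τ i)) (i : Fin m) : κ (τ i) = κ i :=
  ((Finset.sum_eq_sum_iff_of_le fun i _ => h i).1 (Equiv.sum_comp τ κ).symm i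
    (Finset.mem_univ i)).symm

section MonicRow

variable {m : ℕ} {κ κ' : Fin m → ℕ}

/-- The vector with last nonzero entry `1` at `κ i` and the other entries taken from the row `i`. -/
noncomputable def monicRow (x : Filling κ) (i : Fin m) (j : ℕ) : ℂ :=
  if j = κ i then 1 else x.1 i j

theorem monicRow_last (x : Filling κ) (i : Fin m) : monicRow x i (κ i) = 1 :=
  if_pos rfl

theorem monicRow_of_lt (x : Filling κ) {i : Fin m} {j : ℕ} (hj : κ i < j) : monicRow x i j = 0 := by
  rw [monicRow, if_neg hj.ne', x.2 i j hj.le]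

theorem le_of_monicRow_ne_zero {x : Filling κ} {i : Fin m} {j : ℕ} (h : monicRow x i j ≠ 0) :
    j ≤ κ i := by
  by_contra hj
  exact h (monicRow_of_lt x (not_le.1 hj))

theorem eq_of_mul_monicRow_eq {x : Filling κ} {x' : Filling κ'} {i i' : Fin m} {a : ℂ}
    (h : ∀ j, a * monicRow x i j = monicRow x' i' j) :
    κ' i' = κ i ∧ ∀ s, x'.1 i' s = x.1 i s := by
  have h1 := h (κ' i')
  rw [monicRow_last] at h1
  have ha : a ≠ 0 := left_ne_zero_of_mul (h1 ▸ one_ne_zero)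
  have h2 := h (κ i)
  rw [monicRow_last, mul_one] at h2
  have hκ : κ' i' = κ i := le_antisymm
    (le_of_monicRow_ne_zero (right_ne_zero_of_mul (h1 ▸ one_ne_zero)))
    (le_of_monicRow_ne_zero (h2 ▸ ha))
  rw [← hκ, monicRow_last] at h2
  refine ⟨hκ, fun s => ?_⟩
  by_cases hs : s = κ i
  · rw [x.2 i s hs.ge, x'.2 i' s (hκ.le.trans hs.ge)]
  · have h3 := h s
    rwa [h2, one_mul, monicRow, monicRow, if_neg hs, if_neg (by rwa [hκ]), eq_comm] at h3

/-- The monic rows as elements of `ℂ^∞`. -/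
noncomputable def monicRowInf (x : Filling κ) (i : Fin m) : CInf :=
  Finsupp.onFinset (Finset.range (κ i + 1)) (monicRow x i) fun _ hj =>
    Finset.mem_range.2 (Nat.lt_succ_of_le (le_of_monicRow_ne_zero hj))

theorem monicRowInf_apply (x : Filling κ) (i : Fin m) (j : ℕ) :
    monicRowInf x i j = monicRow x i j :=
  rfl

theorem monicRowInf_ne_zero (x : Filling κ) (i : Fin m) : monicRowInf x i ≠ 0 := by
  intro h
  have h1 := monicRow_last x i
  rw [← monicRowInf_apply, h] at h1
  exact zero_ne_one h1

/-- The unordered tuple of the points given by the monic rows. -/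
noncomputable def symCell (x : Filling κ) : Sym (Proj CInf) m :=
  toSym fun i => Projectivization.mk ℂ (monicRowInf x i) (monicRowInf_ne_zero x i)

theorem exists_perm_of_symCell_eq {x : Filling κ} {x' : Filling κ'} (h : symCell x = symCell x') :
    ∃ σ : Equiv.Perm (Fin m), κ' = κ ∘ σ ∧ ∀ i s, x'.1 i s = x.1 (σ i) s := by
  obtain ⟨σ, hσ⟩ := toSym_eq_iff.1 h
  have key : ∀ i, κ' i = κ (σ i) ∧ ∀ s, x'.1 i s = x.1 (σ i) s := by
    intro i
    obtain ⟨a, ha⟩ := (Projectivization.mk_eq_mk_iff' ℂ _ _ _ _).1 (congrFun hσ i)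
    exact eq_of_mul_monicRow_eq fun j => DFunLike.congr_fun ha j
  exact ⟨σ, funext fun i => (key i).1, fun i => (key i).2⟩

theorem symCell_smul (σ : rowStab κ) (x : Filling κ) : symCell (σ • x) = symCell x := by
  refine (toSym_eq_iff.2 ⟨(σ⁻¹).1, funext fun i => ?_⟩).symm
  refine (Projectivization.mk_eq_mk_iff' ℂ _ _ _ _).2 ⟨1, Finsupp.ext fun j => ?_⟩
  rw [one_smul, monicRowInf_apply, monicRowInf_apply, monicRow, monicRow,
    mem_rowStab.1 (σ⁻¹).2 i]
  rfl

theorem symCell_eq_iff (hκ : Antitone κ) {x y : Filling κ} :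
    symCell x = symCell y ↔ encode hκ x = encode hκ y := by
  rw [encode_eq_iff]
  constructor
  · intro h
    obtain ⟨σ, hσ, hxy⟩ := exists_perm_of_symCell_eq h
    let τ : rowStab κ := ⟨σ, mem_rowStab.2 fun i => (congrFun hσ i).symm⟩
    refine ⟨τ⁻¹, Subtype.ext (funext fun i => funext fun s => ?_)⟩
    rw [smul_filling_apply, inv_inv]
    exact hxy i s
  · rintro ⟨σ, rfl⟩
    exact (symCell_smul σ x).symm

/-- The bijective parametrization of the image of `symCell` induced by the encoding. -/
noncomputable def symParam (hκ : Antitone κ) (b : Filling κ) : Sym (Proj CInf) m :=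
  symCell (Function.surjInv (encode_surjective hκ) b)

theorem symParam_encode (hκ : Antitone κ) (x : Filling κ) :
    symParam hκ (encode hκ x) = symCell x :=
  (symCell_eq_iff hκ).2 (Function.surjInv_eq _ _)

theorem exists_symCell_eq (z : Sym (Proj CInf) m) :
    ∃ (κ : Fin m → ℕ) (_ : Antitone κ) (x : Filling κ), symCell x = z := by
  obtain ⟨l, rfl⟩ := exists_toSym_eq z
  choose d hd hd0 using fun i => exists_last_ne_zero (l i).rep_nonzero
  -- Sorting in the dual order makes the positions of the last nonzero coordinates decrease.
  let σ := Tuple.sort (OrderDual.toDual ∘ d)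
  have hmono : Monotone (OrderDual.toDual ∘ d ∘ σ) := Tuple.monotone_sort (OrderDual.toDual ∘ d)
  let x : Filling (d ∘ σ) := ⟨fun i s => if s < d (σ i) then
    ((l (σ i)).rep (d (σ i)))⁻¹ * (l (σ i)).rep s else 0, fun i s hs => if_neg (not_lt.2 hs)⟩
  have hx : ∀ i, monicRowInf x i = ((l (σ i)).rep (d (σ i)))⁻¹ • (l (σ i)).rep := by
    intro i
    ext j
    change (if j = d (σ i) then (1 : ℂ) else if j < d (σ i) then
      ((l (σ i)).rep (d (σ i)))⁻¹ * (l (σ i)).rep j else 0) =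
        ((l (σ i)).rep (d (σ i)))⁻¹ * (l (σ i)).rep j
    rcases lt_trichotomy j (d (σ i)) with h | h | h
    · rw [if_neg h.ne, if_pos h]
    · rw [if_pos h, h, inv_mul_cancel₀ (hd _)]
    · rw [if_neg h.ne', if_neg h.le.not_gt, hd0 _ _ h, mul_zero]
  refine ⟨d ∘ σ, fun i j hij => hmono hij, x, (toSym_eq_iff.2 ⟨σ, funext fun i => ?_⟩).symm⟩
  rw [Function.comp_apply]
  conv_rhs => rw [← (l (σ i)).mk_rep]
  exact (Projectivization.mk_eq_mk_iff' ℂ _ _ _ _).2 ⟨_, (hx i).symm⟩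

end MonicRow

/-! ### Multihomogeneous polynomials on tuples of vectors -/

section Tuples

variable {m N : ℕ}

/-- The polynomial functions of the entries of a tuple of vectors. -/
def tuplePoly (m N : ℕ) : Subalgebra ℂ ((Fin m → Fin (N + 1) → ℂ) → ℂ) where
  carrier := {f | ∃ p : MvPolynomial (Fin m × Fin (N + 1)) ℂ,
    ∀ w, f w = MvPolynomial.eval (fun k => w k.1 k.2) p}
  mul_mem' := by
    rintro f g ⟨p, hp⟩ ⟨q, hq⟩
    exact ⟨p * q, fun w => by rw [Pi.mul_apply, hp, hq, map_mul]⟩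
  add_mem' := by
    rintro f g ⟨p, hp⟩ ⟨q, hq⟩
    exact ⟨p + q, fun w => by rw [Pi.add_apply, hp, hq, map_add]⟩
  algebraMap_mem' c := ⟨MvPolynomial.C c, fun w => by rw [MvPolynomial.eval_C]; rfl⟩

theorem entry_mem_tuplePoly (i : Fin m) (j : Fin (N + 1)) : (fun w => w i j) ∈ tuplePoly m N :=
  ⟨MvPolynomial.X (i, j), fun w => by rw [MvPolynomial.eval_X]⟩

theorem comp_perm_mem_tuplePoly {f : (Fin m → Fin (N + 1) → ℂ) → ℂ} (hf : f ∈ tuplePoly m N)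
    (τ : Equiv.Perm (Fin m)) : (fun w => f (w ∘ τ)) ∈ tuplePoly m N := by
  obtain ⟨p, hp⟩ := hf
  refine ⟨MvPolynomial.rename (fun k => (τ k.1, k.2)) p, fun w => ?_⟩
  rw [MvPolynomial.eval_rename]
  exact hp _

/-- The tuples of nonzero vectors. -/
abbrev NonzeroTuple (m N : ℕ) : Type := {v : Fin m → Fin (N + 1) → ℂ // ∀ k, v k ≠ 0}

/-- The coordinates of a tuple of nonzero vectors. -/
abbrev tupleCoord (v : NonzeroTuple m N) (k : Fin m × Fin (N + 1)) : ℂ := v.1 k.1 k.2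

/-- The unordered tuple of points given by a tuple of nonzero vectors. -/
noncomputable def tupleSym (v : NonzeroTuple m N) : Sym (Proj (Fin (N + 1) → ℂ)) m :=
  toSym fun k => Projectivization.mk ℂ (v.1 k) (v.2 k)

theorem symPowProj_eq (m N : ℕ) : symPowProj m N = affineQuotient tupleCoord tupleSym :=
  quotient_quotient _ _ _

theorem tupleSym_eq_iff {v v' : NonzeroTuple m N} : tupleSym v = tupleSym v' ↔
    ∃ (σ : Equiv.Perm (Fin m)) (a : Fin m → ℂ), (∀ k, a k ≠ 0) ∧
      v'.1 = fun k => a k • v.1 (σ k) := by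
  refine toSym_eq_iff.trans (exists_congr fun σ => ?_)
  constructor
  · intro h
    choose a ha using fun k => (Projectivization.mk_eq_mk_iff' ℂ _ _ _ _).1 (congrFun h k)
    refine ⟨a, fun k hk => v'.2 k ?_, funext fun k => (ha k).symm⟩
    rw [← ha, hk, zero_smul]
  · rintro ⟨a, -, ha⟩
    exact funext fun k => (Projectivization.mk_eq_mk_iff' ℂ _ _ _ _).2 ⟨a k, (congrFun ha k).symm⟩

variable {κ : Fin m → ℕ} (hN : ∀ i, κ i ≤ N)

/-- The position `κ i` as an index of `ℂ^{N+1}`. -/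
def lastIdx (i : Fin m) : Fin (N + 1) := ⟨κ i, Nat.lt_succ_of_le (hN i)⟩

/-- The tuple of the monic rows in `ℂ^{N+1}`. -/
noncomputable def monicTuple (x : Filling κ) : NonzeroTuple m N :=
  ⟨fun i j => monicRow x i j, fun i h => zero_ne_one
    ((congrFun h (lastIdx hN i)).symm.trans (monicRow_last x i))⟩

theorem symPowIncl_monicTuple (x : Filling κ) :
    symPowIncl m N (tupleSym (monicTuple hN x)) = symCell x := by
  rw [symPowIncl, tupleSym, map_toSym, symCell]
  congr 1
  funext i
  rw [Function.comp_apply, Projectivization.map_mk]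
  refine (Projectivization.mk_eq_mk_iff' ℂ _ _ _ _).2 ⟨1, Finsupp.ext fun j => ?_⟩
  rw [one_smul, monicRowInf_apply, extendZero_apply]
  split_ifs with h
  · rfl
  · exact monicRow_of_lt x (by have := hN i; omega)

/-- The product of the entries at the positions `κ i`. -/
def leadProd (w : Fin m → Fin (N + 1) → ℂ) : ℂ := ∏ i, w i (lastIdx hN i)

/-- The rows divided by their entries at `κ i`. -/
noncomputable def normalizeTuple (w : Fin m → Fin (N + 1) → ℂ) : Filling κ :=
  ⟨fun i s => if h : s < κ i then
    w i ⟨s, (h.trans_le (hN i)).trans (Nat.lt_succ_self N)⟩ / w i (lastIdx hN i) else 0,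
    fun _ _ hs => dif_neg (not_lt.2 hs)⟩

theorem leadProd_mem : leadProd hN ∈ tuplePoly m N :=
  prod_mem_apply fun i _ => entry_mem_tuplePoly i (lastIdx hN i)

theorem leadProd_smul (a : Fin m → ℂ) (w : Fin m → Fin (N + 1) → ℂ) :
    leadProd hN (fun k => a k • w k) = (∏ k, a k) * leadProd hN w := by
  simp only [leadProd, Pi.smul_apply, smul_eq_mul, Finset.prod_mul_distrib]

theorem normalizeTuple_smul {a : Fin m → ℂ} (ha : ∀ k, a k ≠ 0) (w : Fin m → Fin (N + 1) → ℂ) :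
    normalizeTuple hN (fun k => a k • w k) = normalizeTuple hN w := by
  refine Subtype.ext (funext fun i => funext fun s => ?_)
  simp only [normalizeTuple, Pi.smul_apply, smul_eq_mul, mul_div_mul_left _ _ (ha i)]

theorem exists_homogenization {P : Filling κ → ℂ} (hP : P ∈ polyFun κ) :
    ∃ D, ∃ H ∈ tuplePoly m N, ∀ w, leadProd hN w ≠ 0 →
      H w = leadProd hN w ^ D * P (normalizeTuple hN w) := by
  classical
  induction hP using Algebra.adjoin_induction with
  | mem P hP =>
    obtain ⟨i, s, -, rfl⟩ := hP
    by_cases hs : s < κ i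
    · refine ⟨1, fun w => w i ⟨s, (hs.trans_le (hN i)).trans (Nat.lt_succ_self N)⟩ *
        ∏ k ∈ Finset.univ.erase i, w k (lastIdx hN k),
        (tuplePoly m N).mul_mem (entry_mem_tuplePoly _ _)
          (prod_mem_apply fun k _ => entry_mem_tuplePoly _ _), fun w hw => ?_⟩
      have hi : w i (lastIdx hN i) ≠ 0 := Finset.prod_ne_zero_iff.1 hw i (Finset.mem_univ i)
      have h1 : fillingCoord κ i s (normalizeTuple hN w) =
        w i ⟨s, (hs.trans_le (hN i)).trans (Nat.lt_succ_self N)⟩ / w i (lastIdx hN i) := dif_pos hs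
      rw [h1, leadProd, ← Finset.mul_prod_erase _ _ (Finset.mem_univ i), pow_one]
      field_simp
    · exact ⟨0, 0, (tuplePoly m N).zero_mem, fun w _ => by
        rw [show fillingCoord κ i s (normalizeTuple hN w) = 0 from dif_neg hs, mul_zero]; rfl⟩
  | algebraMap c => exact ⟨0, _, const_mem c, fun w _ => by rw [pow_zero, one_mul]; rfl⟩
  | add P P' _ _ ih ih' =>
    obtain ⟨D, H, hH, h⟩ := ih
    obtain ⟨D', H', hH', h'⟩ := ih'
    refine ⟨D + D', H * leadProd hN ^ D' + H' * leadProd hN ^ D,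
      (tuplePoly m N).add_mem ((tuplePoly m N).mul_mem hH ((tuplePoly m N).pow_mem
        (leadProd_mem hN) _)) ((tuplePoly m N).mul_mem hH' ((tuplePoly m N).pow_mem
        (leadProd_mem hN) _)), fun w hw => ?_⟩
    simp only [Pi.add_apply, Pi.mul_apply, Pi.pow_apply, h w hw, h' w hw]
    ring
  | mul P P' _ _ ih ih' =>
    obtain ⟨D, H, hH, h⟩ := ih
    obtain ⟨D', H', hH', h'⟩ := ih'
    refine ⟨D + D', H * H', (tuplePoly m N).mul_mem hH hH', fun w hw => ?_⟩
    simp only [Pi.mul_apply, h w hw, h' w hw]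
    ring

/-- The sum over the permutations of the values of a multiple of a power of `leadProd`. -/
noncomputable def leadSum (D : ℕ) (P : Filling κ → ℂ) (w : Fin m → Fin (N + 1) → ℂ) : ℂ :=
  ∑ τ : Equiv.Perm (Fin m), leadProd hN (w ∘ τ) ^ (D + 1) * P (normalizeTuple hN (w ∘ τ))

/-- The factor does not depend on `P`, so the quotient of `leadSum hN D P` by `leadSum hN D 1`
depends only on the unordered tuple of points. -/
theorem leadSum_smul_comp (D : ℕ) (P : Filling κ → ℂ) {a : Fin m → ℂ} (ha : ∀ k, a k ≠ 0)
    (σ : Equiv.Perm (Fin m)) (w : Fin m → Fin (N + 1) → ℂ) :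
    leadSum hN D P (fun k => a k • w (σ k)) = (∏ k, a k) ^ (D + 1) * leadSum hN D P w := by
  rw [leadSum, leadSum, Finset.mul_sum]
  refine Fintype.sum_equiv (Equiv.mulLeft σ) _ _ fun τ => ?_
  have h : (fun k => a k • w (σ k)) ∘ τ = fun k => (a ∘ τ) k • (w ∘ (σ * τ)) k := rfl
  rw [h, leadProd_smul, normalizeTuple_smul hN (a := a ∘ τ) (fun k => ha (τ k)), Equiv.coe_mulLeft, mul_pow,
    mul_assoc]
  congr 2
  exact Equiv.prod_comp τ a

/-- The exponent `D + 1` instead of `D` matters where `leadProd` vanishes: there the normalization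
is meaningless, and the extra factor makes both sides zero. -/
theorem exists_leadSum_mem {P : Filling κ → ℂ} (hP : P ∈ polyFun κ) :
    ∃ D, leadSum hN D P ∈ tuplePoly m N ∧ leadSum hN D 1 ∈ tuplePoly m N := by
  obtain ⟨D, H, hH, h⟩ := exists_homogenization hN hP
  refine ⟨D, sum_mem_apply fun τ _ => ?_, sum_mem_apply fun τ _ => ?_⟩
  · refine comp_perm_mem_tuplePoly
      (f := fun w => leadProd hN w ^ (D + 1) * P (normalizeTuple hN w)) ?_ τ
    convert (tuplePoly m N).mul_mem (leadProd_mem hN) hH using 1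
    ext w
    rw [Pi.mul_apply]
    by_cases hw : leadProd hN w = 0
    · rw [hw, zero_pow (Nat.succ_ne_zero D), zero_mul, zero_mul]
    · rw [h w hw]
      ring
  · refine comp_perm_mem_tuplePoly (f := fun w => leadProd hN w ^ (D + 1) * 1) ?_ τ
    exact (tuplePoly m N).mul_mem ((tuplePoly m N).pow_mem (leadProd_mem hN) _)
      (tuplePoly m N).one_mem

end Tuples

theorem mem_toSym {α : Type} {m : ℕ} (l : Fin m → α) (i : Fin m) : l i ∈ toSym l :=
  Multiset.mem_map.2 ⟨i, Finset.mem_univ_val i, rfl⟩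

/-! ### Charts of the cells in the symmetric power -/

section Chart

variable {m N : ℕ} {κ : Fin m → ℕ} (hN : ∀ i, κ i ≤ N)

theorem eq_comp_of_leadProd_ne_zero {x : Filling κ} {τ : Equiv.Perm (Fin m)}
    (h : leadProd hN ((monicTuple hN x).1 ∘ τ) ≠ 0) (i : Fin m) : κ (τ i) = κ i :=
  eq_comp_of_le_comp (fun i =>
    le_of_monicRow_ne_zero (x := x) (Finset.prod_ne_zero_iff.1 h i (Finset.mem_univ i))) i

theorem leadProd_monicTuple {x : Filling κ} {τ : Equiv.Perm (Fin m)} (h : ∀ i, κ (τ i) = κ i) :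
    leadProd hN ((monicTuple hN x).1 ∘ τ) = 1 := by
  refine Finset.prod_eq_one fun i _ => ?_
  change monicRow x (τ i) (κ i) = 1
  rw [← h i, monicRow_last]

theorem normalizeTuple_monicTuple {x : Filling κ} {τ : rowStab κ} :
    normalizeTuple hN ((monicTuple hN x).1 ∘ τ.1) = τ⁻¹ • x := by
  have hτ := mem_rowStab.1 τ.2
  refine Subtype.ext (funext fun i => funext fun s => ?_)
  rw [smul_filling_apply, inv_inv]
  change (if h : s < κ i then monicRow x (τ.1 i) s / monicRow x (τ.1 i) (κ i) else 0) = _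
  split_ifs with h
  · rw [← hτ i] at h ⊢
    rw [monicRow_last, div_one, monicRow, if_neg h.ne]
  · rw [x.2 _ _ ((hτ i).le.trans (not_lt.1 h))]

/-- At a monic tuple only permutations preserving `κ` contribute, and for these the normalized tuple
is a row permutation of `x`, where the invariant `P` has the value `P x`. -/
theorem leadSum_monicTuple (D : ℕ) {P : Filling κ → ℂ} (hP : P ∈ invariantFun κ) (x : Filling κ) :
    leadSum hN D P (monicTuple hN x).1 = leadSum hN D 1 (monicTuple hN x).1 * P x := by
  rw [leadSum, leadSum, Finset.sum_mul]
  refine Finset.sum_congr rfl fun τ _ => ?_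
  by_cases h : leadProd hN ((monicTuple hN x).1 ∘ τ) = 0
  · rw [h, zero_pow (Nat.succ_ne_zero D), zero_mul, zero_mul, zero_mul]
  · have hτ := eq_comp_of_leadProd_ne_zero hN h
    rw [normalizeTuple_monicTuple hN (τ := ⟨τ, mem_rowStab.2 hτ⟩), hP, Pi.one_apply, mul_one]

/-- The value is the number of permutations preserving `κ`. -/
theorem leadSum_one_monicTuple_ne_zero (D : ℕ) (x : Filling κ) :
    leadSum hN D 1 (monicTuple hN x).1 ≠ 0 := by
  classical
  have h : leadSum hN D 1 (monicTuple hN x).1 =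
      ∑ τ : Equiv.Perm (Fin m), if ∀ i, κ (τ i) = κ i then (1 : ℂ) else 0 := by
    refine Finset.sum_congr rfl fun τ _ => ?_
    rw [Pi.one_apply, mul_one]
    split_ifs with h
    · rw [leadProd_monicTuple hN h, one_pow]
    · by_contra hne
      refine h (eq_comp_of_leadProd_ne_zero hN (x := x) fun h0 => hne ?_)
      rw [h0, zero_pow (Nat.succ_ne_zero D)]
  rw [h, Finset.sum_boole, Nat.cast_ne_zero, ← Nat.pos_iff_ne_zero, Finset.card_pos]
  exact ⟨1, by simp⟩

/-- The unordered tuples at which `leadSum` does not vanish. -/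
def leadLocus (D : ℕ) : Set (Sym (Proj (Fin (N + 1) → ℂ)) m) :=
  tupleSym '' {v | leadSum hN D 1 v.1 ≠ 0}

theorem monicTuple_mem_leadLocus (D : ℕ) (x : Filling κ) :
    tupleSym (monicTuple hN x) ∈ leadLocus hN D :=
  ⟨_, leadSum_one_monicTuple_ne_zero hN D x, rfl⟩

theorem exists_regular_leadLocus {P : Filling κ → ℂ} (hP : P ∈ invPolyFun κ) :
    ∃ D, IsOpen[(symPowProj m N).top] (leadLocus hN D) ∧
      ∃ g, (symPowProj m N).Regular (leadLocus hN D) g ∧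
        ∀ x, g (tupleSym (monicTuple hN x)) = P x := by
  obtain ⟨D, ⟨p, hp⟩, q, hq⟩ := exists_leadSum_mem hN hP.1
  have hlocus : leadLocus hN D = tupleSym '' {v | MvPolynomial.eval (tupleCoord v) q ≠ 0} := by
    simp only [leadLocus, hq]
  have key : ∀ v v' : NonzeroTuple m N, tupleSym v = tupleSym v' →
      MvPolynomial.eval (tupleCoord v) q ≠ 0 → MvPolynomial.eval (tupleCoord v') q ≠ 0 ∧
      MvPolynomial.eval (tupleCoord v) p / MvPolynomial.eval (tupleCoord v) q =
        MvPolynomial.eval (tupleCoord v') p / MvPolynomial.eval (tupleCoord v') q := by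
    intro v v' hvv hv
    obtain ⟨σ, a, ha, hv'⟩ := tupleSym_eq_iff.1 hvv
    have ha' : (∏ k, a k) ^ (D + 1) ≠ 0 := pow_ne_zero _ (Finset.prod_ne_zero_iff.2 fun k _ => ha k)
    rw [← hq] at hv
    rw [← hq, ← hq, ← hp, ← hp, hv', leadSum_smul_comp hN D _ ha, leadSum_smul_comp hN D _ ha]
    exact ⟨mul_ne_zero ha' hv, (mul_div_mul_left _ _ ha').symm⟩
  refine ⟨D, ?_⟩
  rw [hlocus, symPowProj_eq]
  refine ⟨isOpen_image_affineQuotient q fun v v' hvv hv => (key v v' hvv hv).1, ?_⟩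
  obtain ⟨g, hg, hgv⟩ := exists_regular_affineQuotient p q key
  refine ⟨g, hg, fun x => ?_⟩
  rw [hgv, ← hq, ← hp, leadSum_monicTuple hN D hP.2,
    mul_div_cancel_left₀ _ (leadSum_one_monicTuple_ne_zero hN D x)]

/-- The unordered tuples of points that have, in some order, no nonzero coordinates after the
positions `κ i`. -/
def tailLocus (κ : Fin m → ℕ) (N : ℕ) : Set (Sym (Proj (Fin (N + 1) → ℂ)) m) :=
  tupleSym '' {v | ∀ i (s : Fin (N + 1)), κ i < s → v.1 i s = 0}

theorem tupleSym_mem_tailLocus {v : NonzeroTuple m N} : tupleSym v ∈ tailLocus κ N ↔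
    ∃ τ : Equiv.Perm (Fin m), ∀ i (s : Fin (N + 1)), κ i < s → v.1 (τ i) s = 0 := by
  constructor
  · rintro ⟨v', hv', hvv⟩
    obtain ⟨σ, a, ha, h⟩ := tupleSym_eq_iff.1 hvv.symm
    refine ⟨σ, fun i s hs => ?_⟩
    have h1 := hv' i s hs
    rw [h] at h1
    exact (mul_eq_zero.1 h1).resolve_left (ha i)
  · rintro ⟨τ, hτ⟩
    exact ⟨⟨v.1 ∘ τ, fun k => v.2 (τ k)⟩, hτ, (tupleSym_eq_iff.2
      ⟨τ, 1, fun _ => one_ne_zero, funext fun k => (one_smul ℂ _).symm⟩).symm⟩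

theorem isClosed_tailLocus (κ : Fin m → ℕ) (N : ℕ) :
    @IsClosed _ (symPowProj m N).top (tailLocus κ N) := by
  rw [symPowProj_eq]
  let _ := (affineQuotient (tupleCoord (m := m) (N := N)) tupleSym).top
  let _ := ((affineSpace (Fin m × Fin (N + 1))).induced (tupleCoord (m := m) (N := N))).top
  refine ⟨?_⟩
  have h : tupleSym (m := m) (N := N) ⁻¹' (tailLocus κ N)ᶜ = ⋂ τ : Equiv.Perm (Fin m), ⋃ i,
      ⋃ s : Fin (N + 1), ⋃ _ : κ i < s, {v | v.1 (τ i) s ≠ 0} := by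
    ext v
    rw [Set.mem_preimage, Set.mem_compl_iff, tupleSym_mem_tailLocus]
    simp
  change IsOpen (tupleSym (m := m) (N := N) ⁻¹' (tailLocus κ N)ᶜ)
  rw [h]
  refine isOpen_iInter_of_finite fun τ => isOpen_iUnion fun i => isOpen_iUnion fun s =>
    isOpen_iUnion fun _ => ⟨_, isOpen_setOf_eval_ne_zero (MvPolynomial.X (τ i, s)), ?_⟩
  ext v
  simp

/-- A point of the lead locus has an order `ρ` with nonzero coordinates at the positions `κ i`, a
point of the tail locus an order `τ` with no coordinates after them. Hence `τ⁻¹ * ρ` cannot lower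
`κ`, so it preserves `κ`, and in the order `τ` the last nonzero coordinates stand exactly at the `κ
i`. -/
theorem range_monicTuple (D : ℕ) : Set.range (fun x => tupleSym (monicTuple hN x)) =
    leadLocus hN D ∩ tailLocus κ N := by
  refine Set.Subset.antisymm (Set.range_subset_iff.2 fun x =>
    ⟨monicTuple_mem_leadLocus hN D x, _, fun i s hs => monicRow_of_lt x hs, rfl⟩) ?_
  rintro _ ⟨⟨v, hv, rfl⟩, hC⟩
  obtain ⟨τ, hτ⟩ := tupleSym_mem_tailLocus.1 hC
  obtain ⟨ρ, -, hρ⟩ := Finset.exists_ne_zero_of_sum_ne_zero hv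
  have hρ' : leadProd hN (v.1 ∘ ρ) ≠ 0 := fun h0 => hρ (by
    rw [h0, zero_pow (Nat.succ_ne_zero D), zero_mul])
  have hne : ∀ i, v.1 (ρ i) (lastIdx hN i) ≠ 0 := fun i =>
    Finset.prod_ne_zero_iff.1 hρ' i (Finset.mem_univ i)
  have hκ : ∀ i, κ ((τ⁻¹ * ρ) i) = κ i := by
    refine eq_comp_of_le_comp fun i => ?_
    by_contra h
    refine hne i ?_
    have := hτ ((τ⁻¹ * ρ) i) (lastIdx hN i) (not_le.1 h)
    rwa [← Equiv.Perm.mul_apply, mul_inv_cancel_left] at this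
  have hlead : ∀ i, v.1 (τ i) (lastIdx hN i) ≠ 0 := by
    intro i
    have h1 := hne ((τ⁻¹ * ρ)⁻¹ i)
    have h2 := hκ ((τ⁻¹ * ρ)⁻¹ i)
    rw [← Equiv.Perm.mul_apply, mul_inv_cancel, Equiv.Perm.one_apply] at h2
    have h3 : lastIdx hN ((τ⁻¹ * ρ)⁻¹ i) = lastIdx hN i := Fin.ext h2.symm
    rwa [h3, ← Equiv.Perm.mul_apply, mul_inv_rev, inv_inv, mul_inv_cancel_left] at h1
  refine ⟨normalizeTuple hN (v.1 ∘ τ), (tupleSym_eq_iff.2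
    ⟨τ, fun k => (v.1 (τ k) (lastIdx hN k))⁻¹, fun k => inv_ne_zero (hlead k), ?_⟩).symm⟩
  funext i j
  change (if (j : ℕ) = κ i then (1 : ℂ) else if h : (j : ℕ) < κ i then
    v.1 (τ i) j / v.1 (τ i) (lastIdx hN i) else 0) =
      (v.1 (τ i) (lastIdx hN i))⁻¹ * v.1 (τ i) j
  split_ifs with h1 h2
  · rw [show j = lastIdx hN i from Fin.ext h1, inv_mul_cancel₀ (hlead i)]
  · rw [div_eq_inv_mul]
  · rw [hτ i j (by omega), mul_zero]

variable (hκ : Antitone κ)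

/-- The parametrization of the cell in the symmetric power of `ℂP^N`. -/
noncomputable def symChart (b : Filling κ) : Sym (Proj (Fin (N + 1) → ℂ)) m :=
  tupleSym (monicTuple hN (Function.surjInv (encode_surjective hκ) b))

theorem symPowIncl_symChart (b : Filling κ) :
    symPowIncl m N (symChart hN hκ b) = symParam hκ b :=
  symPowIncl_monicTuple hN _

theorem symChart_encode (x : Filling κ) :
    symChart hN hκ (encode hκ x) = tupleSym (monicTuple hN x) := by
  refine Sym.map_injective (Projectivization.map_injective _ (extendZero_injective (N + 1))) m ?_
  exact (symPowIncl_symChart hN hκ _).trans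
    ((symParam_encode hκ x).trans (symPowIncl_monicTuple hN x).symm)

theorem tupleSym_monicTuple_smul (σ : rowStab κ) (x : Filling κ) :
    tupleSym (monicTuple hN (σ • x)) = tupleSym (monicTuple hN x) := by
  have hκ' := fun x => symPowIncl_monicTuple hN x
  refine Sym.map_injective (Projectivization.map_injective _ (extendZero_injective (N + 1))) m ?_
  exact (hκ' _).trans ((symCell_smul σ x).trans (hκ' _).symm)

/-- A quotient `p / q` of polynomials is symmetrized to `∑ h p q / ∑ h q²` over the orbit. The
polynomial `h`, equal to 1 at `x` and to 0 at the rest of its orbit, keeps the denominator nonzero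
at `x`; the extra factor `q` removes the orbit points at which `p / q` is not known to represent
`g`. -/
theorem exists_invPolyFun_quotient {W : Set (Sym (Proj (Fin (N + 1) → ℂ)) m)}
    (hW : IsOpen[(symPowProj m N).top] W) {g : Sym (Proj (Fin (N + 1) → ℂ)) m → ℂ}
    (hg : (symPowProj m N).Regular W g) {x : Filling κ} (hx : tupleSym (monicTuple hN x) ∈ W) :
    ∃ p ∈ invPolyFun κ, ∃ q ∈ invPolyFun κ, q x ≠ 0 ∧ ∀ x', q x' ≠ 0 →
      tupleSym (monicTuple hN x') ∈ W ∧ g (tupleSym (monicTuple hN x')) = p x' / q x' := by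
  classical
  rw [symPowProj_eq] at hW hg
  obtain ⟨p, hp, q, hq, hqx, hpq⟩ := pullback_of_section (ι := tupleCoord) (π := tupleSym)
    (c := monicTuple hN) (A := polyFun κ) (fun k => by
      change (fun x : Filling κ => if (k.2 : ℕ) = κ k.1 then (1 : ℂ) else x.1 k.1 k.2) ∈ _
      split_ifs
      · exact const_mem 1
      · exact fillingCoord_mem κ _ _) hW hg hx
  obtain ⟨h, hh, hhx, hh0⟩ := exists_polyFun_separating x
    ((Finset.univ.image fun σ : rowStab κ => σ • x).erase x) (Finset.notMem_erase _ _)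
  refine ⟨symSum κ (h * (p * q)), symSum_mem_invPolyFun ((polyFun κ).mul_mem hh
    ((polyFun κ).mul_mem hp hq)), symSum κ (h * (q * q)), symSum_mem_invPolyFun
    ((polyFun κ).mul_mem hh ((polyFun κ).mul_mem hq hq)), ?_, fun x' hx' => ?_⟩
  · have h1 : symSum κ (h * (q * q)) x =
        ∑ σ : rowStab κ, (if σ • x = x then (1 : ℂ) else 0) * (q x * q x) := by
      rw [symSum_apply]
      refine Finset.sum_congr rfl fun σ _ => ?_
      simp only [Pi.mul_apply]
      split_ifs with hσ
      · rw [hσ, hhx]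
      · rw [hh0 _ (Finset.mem_erase.2 ⟨hσ, Finset.mem_image_of_mem _ (Finset.mem_univ σ)⟩),
          zero_mul, zero_mul]
    rw [h1, ← Finset.sum_mul, Finset.sum_boole]
    refine mul_ne_zero ?_ (mul_ne_zero hqx hqx)
    rw [Nat.cast_ne_zero, ← Nat.pos_iff_ne_zero, Finset.card_pos]
    exact ⟨1, by simp⟩
  · have hval : g (tupleSym (monicTuple hN x')) * symSum κ (h * (q * q)) x' =
        symSum κ (h * (p * q)) x' := by
      rw [symSum_apply, symSum_apply, Finset.mul_sum]
      refine Finset.sum_congr rfl fun σ _ => ?_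
      simp only [Pi.mul_apply]
      by_cases hσ : q (σ • x') = 0
      · simp [hσ]
      · rw [← tupleSym_monicTuple_smul hN σ x', (hpq _ hσ).2]
        field_simp
    refine ⟨?_, by rw [← hval, mul_div_cancel_right₀ _ hx']⟩
    rw [symSum_apply] at hx'
    obtain ⟨σ, -, hσ⟩ := Finset.exists_ne_zero_of_sum_ne_zero hx'
    rw [← tupleSym_monicTuple_smul hN σ x']
    exact (hpq _ (left_ne_zero_of_mul (right_ne_zero_of_mul hσ))).1

/-- By surjectivity of `encode`, every condition is checked on monic tuples, where functions of
`encodedFun hκ` become invariant polynomials. -/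
theorem isEmb_symChart : IsEmb (symPowProj m N) (encodedFun hκ) (symChart hN hκ) := by
  refine ⟨?_, ?_, ?_, ?_⟩
  · intro b b' h
    obtain ⟨x, rfl⟩ := encode_surjective hκ b
    obtain ⟨x', rfl⟩ := encode_surjective hκ b'
    have h1 := congrArg (symPowIncl m N) h
    rw [symPowIncl_symChart, symPowIncl_symChart, symParam_encode, symParam_encode] at h1
    exact (symCell_eq_iff hκ).1 h1
  · obtain ⟨D, hD, -⟩ := exists_regular_leadLocus hN (invPolyFun κ).one_mem
    have hrange : Set.range (symChart hN hκ) = leadLocus hN D ∩ tailLocus κ N := by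
      rw [← range_monicTuple, ← (encode_surjective hκ).range_comp]
      exact congrArg Set.range (funext (symChart_encode hN hκ))
    rw [hrange]
    let _ := (symPowProj m N).top
    exact IsLocallyClosed.inter (IsOpen.isLocallyClosed hD)
      (IsClosed.isLocallyClosed (isClosed_tailLocus κ N))
  · intro a ha b
    obtain ⟨D, hD, g, hg, hgx⟩ := exists_regular_leadLocus hN
      (show precomp (encode hκ) a ∈ invPolyFun κ from ha)
    obtain ⟨x, rfl⟩ := encode_surjective hκ b
    refine ⟨_, hD, ?_, g, hg, fun b' _ => ?_⟩
    · rw [symChart_encode]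
      exact monicTuple_mem_leadLocus hN D x
    · obtain ⟨x', rfl⟩ := encode_surjective hκ b'
      rw [symChart_encode, hgx]
      rfl
  · intro W hW g hg b hb
    obtain ⟨x, rfl⟩ := encode_surjective hκ b
    rw [symChart_encode] at hb
    obtain ⟨p, hp, q, hq, hqx, hpq⟩ := exists_invPolyFun_quotient hN hW hg hb
    obtain ⟨p', hp', rfl⟩ := exists_encodedFun hκ hp
    obtain ⟨q', hq', rfl⟩ := exists_encodedFun hκ hq
    refine ⟨p', hp', q', hq', hqx, fun b' hb' => ?_⟩
    obtain ⟨x', rfl⟩ := encode_surjective hκ b'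
    rw [symChart_encode]
    exact hpq x' hb'

end Chart

/-- The symmetric power of `ℂP^∞` with the cells of given positions of the last nonzero
coordinates. -/
theorem isCellFamily_symParam (m : ℕ) :
    IsCellFamily (symPowProjInf m) (fun k : {κ : Fin m → ℕ // Antitone κ} => Filling k.1)
      (fun k => encodedFun k.2) (fun k => symParam k.2) (fun k => Finset.univ.sup k.1) := by
  refine ⟨?_, ?_, ?_, ?_⟩
  · rintro ⟨κ, hκ⟩ ⟨κ', hκ'⟩ b b' h
    obtain ⟨σ, rfl, -⟩ := exists_perm_of_symCell_eq h
    -- Two antitone rearrangements of the same function coincide.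
    exact Subtype.ext (Tuple.unique_antitone (f := κ) (σ := 1) (τ := σ) hκ hκ')
  · intro z
    obtain ⟨κ, hκ, x, hx⟩ := exists_symCell_eq z
    exact ⟨⟨κ, hκ⟩, encode hκ x, (symParam_encode hκ x).trans hx⟩
  · rintro ⟨κ, hκ⟩ N hlevel
    have hN : ∀ i, κ i ≤ N := fun i => Finset.sup_le_iff.1 hlevel i (Finset.mem_univ i)
    exact ⟨_, symPowIncl_symChart hN hκ, isEmb_symChart hN hκ⟩
  · rintro ⟨κ, hκ⟩ N b hb
    refine Finset.sup_le fun i _ => ?_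
    let x := Function.surjInv (encode_surjective hκ) b
    have hmem : Projectivization.mk ℂ (monicRowInf x i) (monicRowInf_ne_zero x i) ∈
        symParam hκ b := mem_toSym
        (fun i => Projectivization.mk ℂ (monicRowInf x i) (monicRowInf_ne_zero x i)) i
    have h := (mem_range_symPowIncl m N _).1 hb _ hmem
    obtain ⟨a, ha⟩ := Projectivization.exists_smul_eq_mk_rep ℂ (monicRowInf x i)
      (monicRowInf_ne_zero x i)
    rw [← ha] at h
    by_contra hi
    have h1 := (mem_range_extendZero (N + 1) _).1 h (κ i) (not_le.1 hi)
    rw [Finsupp.smul_apply, monicRowInf_apply, monicRow_last, Units.smul_def, smul_eq_mul,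
      mul_one] at h1
    exact a.ne_zero h1

end PiecewiseVar

open PiecewiseVar

theorem theorem2 (m : ℕ) :
    ∃ (J : Type) (U : J → Set (Sym (Proj CInf) m)) (V : J → Set (Gr m CInf)),
      IsCompatiblePartition (symPowProjInf m) U ∧
      IsCompatiblePartition (grassmannianInf m) V ∧
      ∀ (j : J) (N M : ℕ),
        U j ⊆ Set.range ((symPowProjInf m).incl N) →
        V j ⊆ Set.range ((grassmannianInf m).incl M) →
        Isomorphic ((symPowProjInf m).stratum N (U j)) ((grassmannianInf m).stratum M (V j)) :=
  exists_partitions (isCellFamily_symParam m) (isCellFamily_schubert m)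
    (fun k => encodedFun_fg k.2) (fun k => polyFun_fg k.1) (fun k => encodedFun_le k.2)
    (fun k => polyFun_le k.2) (fun k => exists_isEmb_projectiveSpace k.1)
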